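/- **Setting.** Colours are $0_+,0_-,1,2,3,\dots$; a box of colour $n$ has $2n$ marked points on its boundary, read clockwise from its distinguished ($*$) region; drawn as a rectangle with $*$ on its left it has $n$ of them on top and $n$ on the bottom. The regions of a planar tangle are shaded in a checkerboard way; the $*$-region of a box of positive colour is white. Let $P=(P_n)$ be a subfactor planar algebra, i.e. a complex planar algebra (a multilinear action $T\mapsto Z_T$ of isotopy classes of planar tangles, compatible with substitution of tangles, with the identity tangles acting as the identity, and independent of the numbering of internal boxes) such that: every $P_n$ is finite-dimensional and $\dim P_{0_\pm}=1$; there is a modulus $\delta>0$, removal of a contractible closed loop multiplying $Z_T$ by $\delta$; $P$ is spherical; every $P_n$ has an involution making it (for a suitable norm) a $C^*$-algebra, with $Z_T(x_1\otimes\cdots\otimes x_b)^*=Z_{T^*}(x_1^*\otimes\cdots\otimes x_b^*)$, where $T^*$ is the adjoint (mirror image) tangle; and the normalised picture trace on each $P_n$ is positive and faithful, i.e. the value at $x^*x$ is a positive multiple of $1$ for every $x\neq0$. **Depth.** $P$ has finite depth if there is $d\ge 1$ such that $P_{d+1}$ is the linear span of the products $xE_{d+1}y$ with $x,y\in P_d\subseteq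 P_{d+1}$, where $E_{d+1}=Z_{E^{d+1}}(1)$; the least such $d$ is the depth of $P$. **Templates.** A template $S\Rightarrow T$ is an ordered pair of tangles of the same colour. For a set $B\subseteq\coprod_n P_n$, let $R_{(P,B)}(T)$ be the linear span of all $Z_T(x_1\otimes\cdots\otimes x_b)$, where each $x_i\in B$ lies in the space of the colour of the $i$-th internal box of $T$ (the span of $Z_T(1)$ if $T$ has no internal box). The template $S\Rightarrow T$ holds for $(P,B)$ if $R_{(P,B)}(S)\subseteq R_{(P,B)}(T)$. **Tangles.** - $1^n$: no internal box; $n$ vertical strings. $C^{0_\pm}$: the $0_\pm$-tangle consisting of one closed loop. - $I_n^k$ ($n\le k$): the external box has colour $k$, the one internal box has colour $n$; the $n$ left-most marked points on top and on bottom of the external box are joined to the internal box, and $k-n$ vertical strings pass on its right. $I^k_k$ is the identity tangle. - $E^n$ ($n\ge2$): no internal box; $n-2$ vertical strings on the left, then a cup joining the last two marked points on top and a cap joining the last two on the bottom. - $M_{k,k}^k$: two internal boxes of colour $k$, one on top of the other (multiplication). - $ER_k^{k-1}$: external box of colour $k-1$, one internal box of colour $k$ whose right-most marked points on top and bottom are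 joined to each other by a string around its right. - $T^n$ ($n\ge k$): external box of colour $n$ and $n-k+1$ internal boxes of colour $k$ stacked vertically; consecutive boxes are joined by strings between the $k-1$ left-most marked points on the bottom of one and on the top of the next; the top of the first and the bottom of the last box are joined likewise by $k-1$ strings to the left-most points of the external box; the remaining, right-most, marked points (one on top and one on the bottom of each internal box) are joined to the external box. - $SH_k^{k+2}$: external box of colour $k+2$, one internal box of colour $k$, with two vertical strings on its left. **Proposition.** Let $k\ge1$, let $P$ be a subfactor planar algebra of finite depth at most $k$, and let $B$ be a basis of $P_k$. Then all of the following (the basic templates) hold for $(P,B)$: - modulus: $C^{0_+}\Rightarrow 1^{0_+}$, $\;1^{0_+}\Rightarrow C^{0_+}$, $\;C^{0_-}\Rightarrow 1^{0_-}$, $\;1^{0_-}\Rightarrow C^{0_-}$; - identity: $1^k\Rightarrow I_k^k$; - inclusion: $I_k^{k+1}\Rightarrow T^{k+1}$; - Jones projections: $I_n^k\circ E^n\Rightarrow I_k^k$ for all $2\le n\le k$; - multiplication: $M_{k,k}^k\Rightarrow I_k^k$; - conditional expectation: $I_{k-1}^k\circ ER_k^{k-1}\Rightarrow I_k^k$ (for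 $k=1$, $I_{k-1}^k$ and $ER_k^{k-1}$ are taken with $0=0_+$); - depth: $1^{k+1}\Rightarrow T^{k+1}$; - shift: $SH_k^{k+2}\Rightarrow T^{k+2}$. -/

import Mathlib

open scoped ComplexConjugate

universe u v

namespace PlanarAlg

/-! ### Colours -/

/-- The set of colours `{0₊, 0₋, 1, 2, …}`. A colour is a natural number `size`, together with a
flag which tells whether the distinguished region (the one marked `*`) is black; this is only
possible when `size = 0`, so `⟨0, false⟩ = 0₊`, `⟨0, true⟩ = 0₋`. -/
@[ext] structure Col where
  size : ℕ
  shaded : Bool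
  white_of_pos : 0 < size → shaded = false

/-- The colour `n`, where `0` stands for `0₊`. -/
def Col.ofNat (n : ℕ) : Col := ⟨n, false, fun _ => rfl⟩

/-- The colour `0₊` (for `s = false`) or `0₋` (for `s = true`). -/
def Col.zero (s : Bool) : Col := ⟨0, s, fun h => absurd h (lt_irrefl 0)⟩

/-- The colours of all boxes of a tangle: `none` is the external box, `some i` are the internal
ones. -/
def allCol {Box : Type} (n₀ : Col) (col : Box → Col) : Option Box → Col
  | none => n₀
  | some i => col i

/-- The direction of the string at the `a`-th marked point (`a = 0, 1, …`, clockwise from `*`) of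
the box `o`, if strings are oriented with the black region on their left: on internal boxes the
strings with even `a` end, those with odd `a` start, and conversely on the external box. -/
def direction {Box : Type} (o : Option Box) (a : ℕ) : ℕ :=
  ((if o.isSome then 1 else 0) + a) % 2

/-! ### Tangles -/

/-- A planar tangle with external box of colour `n₀`, up to planar isotopy, described
combinatorially by its boxes, strings and regions.

The `a`-th marked point (`a < 2 n`, numbered clockwise starting at `*`) of the box `o` lies on the
string `str o a`. The `a`-th boundary interval of the box `o` (`a ≤ 2 n`), which is the interval
before the marked point `a` and after the marked point `a - 1`, touches the region `gap o a`; the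
intervals `0` and `2 n` are the same, namely the one marked `*`.
Each string `s` separates the white region `white s` from the black region `black s`.
Strings without end points are closed loops.

The surface which is glued from the boxes (with the external box seen as a disc around infinity),
the strings and the regions has to be the sphere. The dual graph (vertices the regions, edges the
strings) is connected, and Euler's formula holds: if there are `V` boxes in total, `E` strings that
are not closed, `ℓ` closed strings, `F` regions, and if the boxes are joined by strings to form `c`
clusters, then `V - E + F = 1 + (c + ℓ)`, as `c + ℓ` is the number of connected components of the
diagram. For a connected surface in which distinct components of the diagram may share a region,
`V - E + F ≤ 1 + (c + ℓ)` holds in general and the equality characterizes the sphere. With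
`V = |Box| + 1` and `E + ℓ = |Str|` the formula reads `|Box| + |Reg| = |Str| + c`. -/
structure Tangle (n₀ : Col) where
  /-- the internal boxes -/
  Box : Type
  /-- the colours of the internal boxes -/
  col : Box → Col
  /-- the strings -/
  Str : Type
  /-- the regions -/
  Reg : Type
  finite_box : Finite Box
  finite_str : Finite Str
  finite_reg : Finite Reg
  str : ∀ o : Option Box, Fin (2 * (allCol n₀ col o).size) → Str
  gap : ∀ o : Option Box, Fin (2 * (allCol n₀ col o).size + 1) → Reg
  white : Str → Reg
  black : Str → Reg
  /-- the chequerboard shading, `true` being black -/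
  shade : Reg → Bool
  /-- a string with an end point has a second one, with opposite direction -/
  exists_end : ∀ o a, ∃ o' a', str o' a' = str o a ∧ direction o' a' ≠ direction o a
  /-- a string has at most one end point of each direction -/
  end_unique : ∀ o a o' a', str o a = str o' a' → direction o a = direction o' a' →
    (⟨o, a⟩ : Σ o, Fin (2 * (allCol n₀ col o).size)) = ⟨o', a'⟩
  gap_last : ∀ o, gap o (Fin.last _) = gap o 0
  shade_white : ∀ s, shade (white s) = false
  shade_black : ∀ s, shade (black s) = true
  /-- the region at `*` of a box of positive colour or of a `0₊`-box is white, the region around a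
  `0₋`-box is black, and the colours alternate along the boundary of a box -/
  shade_gap : ∀ o a, shade (gap o a) = ((allCol n₀ col o).shaded ^^ decide (a.val % 2 = 1))
  /-- the string at the point `a` has the intervals `a` and `a + 1` on its two sides -/
  side_even : ∀ o a, a.val % 2 = 0 →
    white (str o a) = gap o a.castSucc ∧ black (str o a) = gap o a.succ
  side_odd : ∀ o a, a.val % 2 = 1 →
    black (str o a) = gap o a.castSucc ∧ white (str o a) = gap o a.succ
  connected : ∀ r r', Relation.EqvGen (fun r r' => ∃ s, white s = r ∧ black s = r') r r'
  euler : Nat.card Box + Nat.card Reg =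
    Nat.card Str + Nat.card (Quot fun o o' : Option Box => ∃ a a', str o a = str o' a')

namespace Tangle

/-- The colours of all boxes of a tangle, `none` standing for the external box. -/
abbrev boxCol {n₀ : Col} (T : Tangle n₀) : Option T.Box → Col := allCol n₀ T.col

/-- An isomorphism of tangles: the same tangle up to planar isotopy, with the internal boxes
renumbered by `box`. -/
structure Iso {n₀ : Col} (T T' : Tangle n₀) where
  box : T.Box ≃ T'.Box
  strEquiv : T.Str ≃ T'.Str
  regEquiv : T.Reg ≃ T'.Reg
  col_eq : ∀ i, T'.col (box i) = T.col i
  str_ext : ∀ a, T'.str none a = strEquiv (T.str none a)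
  gap_ext : ∀ a, T'.gap none a = regEquiv (T.gap none a)
  str_int : ∀ i a a', a'.val = a.val → T'.str (some (box i)) a' = strEquiv (T.str (some i) a)
  gap_int : ∀ i a a', a'.val = a.val → T'.gap (some (box i)) a' = regEquiv (T.gap (some i) a)
  white_eq : ∀ s, T'.white (strEquiv s) = regEquiv (T.white s)
  black_eq : ∀ s, T'.black (strEquiv s) = regEquiv (T.black s)
  shade_eq : ∀ r, T'.shade (regEquiv r) = T.shade r

/-- Substituting `S i` into the internal box `i` of `T` joins the string of `T` at each marked
point of the box `i` to the string of `S i` at the same marked point of its external box. -/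
inductive GlueStr {n₀ : Col} (T : Tangle n₀) (S : ∀ i, Tangle (T.col i)) :
    T.Str ⊕ (Σ i, (S i).Str) → T.Str ⊕ (Σ i, (S i).Str) → Prop
  | mk (i : T.Box) (a : Fin (2 * (T.col i).size)) :
      GlueStr T S (Sum.inl (T.str (some i) a)) (Sum.inr ⟨i, (S i).str none a⟩)

/-- Substituting `S i` into the internal box `i` of `T` joins the region of `T` at each boundary
interval of the box `i` to the region of `S i` at the same interval of its external box. -/
inductive GlueReg {n₀ : Col} (T : Tangle n₀) (S : ∀ i, Tangle (T.col i)) :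
    T.Reg ⊕ (Σ i, (S i).Reg) → T.Reg ⊕ (Σ i, (S i).Reg) → Prop
  | mk (i : T.Box) (a : Fin (2 * (T.col i).size + 1)) :
      GlueReg T S (Sum.inl (T.gap (some i) a)) (Sum.inr ⟨i, (S i).gap none a⟩)

/-- The data which exhibit `U` as the tangle `T ∘ (S i)_i`, the result of substituting the tangle
`S i` into each internal box `i` of `T`: the internal boxes of `U` are those of all the `S i`, and
the strings and regions of `U` are obtained from those of `T` and of all the `S i` by gluing. -/
structure Composite {n₀ : Col} (T : Tangle n₀) (S : ∀ i, Tangle (T.col i)) (U : Tangle n₀) where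
  box : (Σ i, (S i).Box) ≃ U.Box
  onStr : T.Str ⊕ (Σ i, (S i).Str) → U.Str
  onReg : T.Reg ⊕ (Σ i, (S i).Reg) → U.Reg
  col_eq : ∀ j, U.col (box j) = (S j.1).col j.2
  onStr_surj : Function.Surjective onStr
  onStr_eq_iff : ∀ s s', onStr s = onStr s' ↔ Relation.EqvGen (GlueStr T S) s s'
  onReg_surj : Function.Surjective onReg
  onReg_eq_iff : ∀ r r', onReg r = onReg r' ↔ Relation.EqvGen (GlueReg T S) r r'
  str_ext : ∀ a, U.str none a = onStr (Sum.inl (T.str none a))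
  gap_ext : ∀ a, U.gap none a = onReg (Sum.inl (T.gap none a))
  str_int : ∀ j a a', a'.val = a.val →
    U.str (some (box j)) a' = onStr (Sum.inr ⟨j.1, (S j.1).str (some j.2) a⟩)
  gap_int : ∀ j a a', a'.val = a.val →
    U.gap (some (box j)) a' = onReg (Sum.inr ⟨j.1, (S j.1).gap (some j.2) a⟩)
  white_inl : ∀ s, U.white (onStr (Sum.inl s)) = onReg (Sum.inl (T.white s))
  black_inl : ∀ s, U.black (onStr (Sum.inl s)) = onReg (Sum.inl (T.black s))
  white_inr : ∀ i s, U.white (onStr (Sum.inr ⟨i, s⟩)) = onReg (Sum.inr ⟨i, (S i).white s⟩)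
  black_inr : ∀ i s, U.black (onStr (Sum.inr ⟨i, s⟩)) = onReg (Sum.inr ⟨i, (S i).black s⟩)
  shade_inl : ∀ r, U.shade (onReg (Sum.inl r)) = T.shade r
  shade_inr : ∀ i r, U.shade (onReg (Sum.inr ⟨i, r⟩)) = (S i).shade r

/-- `U = T ∘ (S i)_i` up to planar isotopy. -/
def IsComposite {n₀ : Col} (T : Tangle n₀) (S : ∀ i, Tangle (T.col i)) (U : Tangle n₀) : Prop :=
  Nonempty (Composite T S U)

/-! ### Tools to verify planarity -/

theorem connected_of_descent {Reg : Type} {R : Reg → Reg → Prop} (f : Reg → ℕ) (root : Reg)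
    (h : ∀ r, r ≠ root → ∃ r', f r' < f r ∧ (R r r' ∨ R r' r)) :
    ∀ r r', Relation.EqvGen R r r' := by
  have key : ∀ n r, f r = n → Relation.EqvGen R r root := by
    intro n
    induction n using Nat.strong_induction_on with
    | _ n ih =>
      intro r hr
      by_cases hroot : r = root
      · subst hroot; exact .refl _
      · obtain ⟨r', hlt, hR⟩ := h r hroot
        have h1 := ih (f r') (hr ▸ hlt) r' rfl
        rcases hR with hR | hR
        · exact .trans _ _ _ (.rel _ _ hR) h1
        · exact .trans _ _ _ (.symm _ _ (.rel _ _ hR)) h1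
  intro r r'
  exact .trans _ _ _ (key _ r rfl) (.symm _ _ (key _ r' rfl))

theorem card_quot_eq_one {α : Type} {R : Option α → Option α → Prop}
    (h : ∀ i, R (some i) none) : Nat.card (Quot R) = 1 := by
  have : ∀ q : Quot R, q = Quot.mk R none := by
    intro q
    induction q using Quot.ind with
    | _ o =>
      cases o with
      | none => rfl
      | some i => exact Quot.sound (h i)
  rw [Nat.card_eq_one_iff_unique]
  exact ⟨⟨fun a b => (this a).trans (this b).symm⟩, ⟨Quot.mk R none⟩⟩

theorem card_quot_eq_self {α : Type} {R : α → α → Prop} (h : ∀ o o', R o o' → o = o') :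
    Nat.card (Quot R) = Nat.card α :=
  Nat.card_congr ⟨Quot.lift id h, Quot.mk R, fun q => by
    induction q using Quot.ind with
    | _ o => rfl, fun _ => rfl⟩

/-! ### Operations on tangles -/

/-- The adjoint `T*` of a tangle: its mirror image, which reverses the cyclic order of the marked
points on each box and keeps the regions marked `*`. -/
def adj {n₀ : Col} (T : Tangle n₀) : Tangle n₀ where
  Box := T.Box
  col := T.col
  Str := T.Str
  Reg := T.Reg
  finite_box := T.finite_box
  finite_str := T.finite_str
  finite_reg := T.finite_reg
  str o a := T.str o a.rev
  gap o a := T.gap o a.rev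
  white := T.white
  black := T.black
  shade := T.shade
  exists_end o a := by
    obtain ⟨o', a', h, hd⟩ := T.exists_end o a.rev
    refine ⟨o', a'.rev, by rw [Fin.rev_rev, h], ?_⟩
    have h1 := a.2
    have h2 := a'.2
    simp only [direction, Fin.val_rev] at hd ⊢
    omega
  end_unique o a o' a' h hd := by
    have h1 := a.2
    have h2 := a'.2
    have := T.end_unique o a.rev o' a'.rev h (by
      simp only [direction, Fin.val_rev] at hd ⊢
      omega)
    obtain ⟨rfl, h3⟩ := Sigma.mk.inj_iff.1 this
    rw [heq_eq_eq, Fin.rev_inj] at h3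
    rw [h3]
  gap_last o := by
    rw [Fin.rev_last, Fin.rev_zero, T.gap_last]
  shade_white := T.shade_white
  shade_black := T.shade_black
  shade_gap o a := by
    rw [T.shade_gap]
    congr 2
    have h1 := a.2
    simp only [Fin.val_rev]
    apply propext
    omega
  side_even o a h := by
    have h1 := a.2
    have := T.side_odd o a.rev (by simp only [Fin.val_rev]; omega)
    rw [Fin.rev_castSucc, Fin.rev_succ]
    exact ⟨this.2, this.1⟩
  side_odd o a h := by
    have h1 := a.2
    have := T.side_even o a.rev (by simp only [Fin.val_rev]; omega)
    rw [Fin.rev_castSucc, Fin.rev_succ]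
    exact ⟨this.2, this.1⟩
  connected := T.connected
  euler := by
    rw [T.euler]
    congr 2
    apply congrArg
    funext o o'
    apply propext
    constructor
    · rintro ⟨a, a', h⟩
      exact ⟨a.rev, a'.rev, by simpa using h⟩
    · rintro ⟨a, a', h⟩
      exact ⟨a.rev, a'.rev, h⟩

/-- The tangle `T` with a small closed loop inserted into the region `r`. The new string and the
new region (the disc inside of the loop) are both called `none`. -/
def addLoop {n₀ : Col} (T : Tangle n₀) (r : T.Reg) : Tangle n₀ where
  Box := T.Box
  col := T.col
  Str := Option T.Str
  Reg := Option T.Reg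
  finite_box := T.finite_box
  finite_str := have := T.finite_str; inferInstance
  finite_reg := have := T.finite_reg; inferInstance
  str o a := some (T.str o a)
  gap o a := some (T.gap o a)
  white
    | none => if T.shade r then none else some r
    | some s => some (T.white s)
  black
    | none => if T.shade r then some r else none
    | some s => some (T.black s)
  shade
    | none => !(T.shade r)
    | some r' => T.shade r'
  exists_end o a := by
    obtain ⟨o', a', h, hd⟩ := T.exists_end o a
    exact ⟨o', a', by rw [h], hd⟩
  end_unique o a o' a' h hd := T.end_unique o a o' a' (Option.some.inj h) hd
  gap_last o := by rw [T.gap_last]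
  shade_white s := by
    cases s with
    | none => cases h : T.shade r <;> simp [h]
    | some s => exact T.shade_white s
  shade_black s := by
    cases s with
    | none => cases h : T.shade r <;> simp [h]
    | some s => exact T.shade_black s
  shade_gap := T.shade_gap
  side_even o a h := by
    obtain ⟨h1, h2⟩ := T.side_even o a h
    exact ⟨congrArg some h1, congrArg some h2⟩
  side_odd o a h := by
    obtain ⟨h1, h2⟩ := T.side_odd o a h
    exact ⟨congrArg some h1, congrArg some h2⟩
  connected := by
    have key : ∀ r₁ r₂, Relation.EqvGen (fun r r' => ∃ s, T.white s = r ∧ T.black s = r') r₁ r₂ →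
        Relation.EqvGen (fun q q' : Option T.Reg => ∃ s : Option T.Str,
          (match s with
            | none => if T.shade r then none else some r
            | some s => some (T.white s)) = q ∧
          (match s with
            | none => if T.shade r then some r else none
            | some s => some (T.black s)) = q') (some r₁) (some r₂) := by
      intro r₁ r₂ h
      induction h with
      | rel _ _ h =>
        obtain ⟨s, rfl, rfl⟩ := h
        exact .rel _ _ ⟨some s, rfl, rfl⟩
      | refl _ => exact .refl _
      | symm _ _ _ ih => exact .symm _ _ ih
      | trans _ _ _ _ _ ih1 ih2 => exact .trans _ _ _ ih1 ih2
    have toR : ∀ q : Option T.Reg, Relation.EqvGen (fun q q' : Option T.Reg =>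
        ∃ s : Option T.Str,
          (match s with
            | none => if T.shade r then none else some r
            | some s => some (T.white s)) = q ∧
          (match s with
            | none => if T.shade r then some r else none
            | some s => some (T.black s)) = q') q (some r) := by
      intro q
      cases q with
      | some r₁ => exact key _ _ (T.connected _ _)
      | none =>
        cases h : T.shade r with
        | true => exact .rel _ _ ⟨none, by simp, by simp⟩
        | false => exact .symm _ _ (.rel _ _ ⟨none, by simp, by simp⟩)
    intro q q'
    exact .trans _ _ _ (toR q) (.symm _ _ (toR q'))
  euler := by
    have := T.finite_str
    have := T.finite_reg
    have h := T.euler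
    rw [Finite.card_option, Finite.card_option]
    simp only [Option.some.injEq]
    omega

/-- The `0`-tangle `T` with its external box moved into the region `r`, if both are seen on the
two-sphere. -/
def moveExt {s : Bool} (T : Tangle (Col.zero s)) (r : T.Reg) : Tangle (Col.zero (T.shade r)) where
  Box := T.Box
  col := T.col
  Str := T.Str
  Reg := T.Reg
  finite_box := T.finite_box
  finite_str := T.finite_str
  finite_reg := T.finite_reg
  str
    | none, a => T.str none a
    | some i, a => T.str (some i) a
  gap
    | none, _ => r
    | some i, a => T.gap (some i) a
  white := T.white
  black := T.black
  shade := T.shade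
  exists_end o a := by
    match o, a with
    | none, a => exact absurd a.2 (by simp [allCol, Col.zero])
    | some i, a =>
      obtain ⟨o', a', h, hd⟩ := T.exists_end (some i) a
      match o', a' with
      | none, a' => exact absurd a'.2 (by simp [allCol, Col.zero])
      | some j, a' => exact ⟨some j, a', h, hd⟩
  end_unique o a o' a' h hd := by
    match o, a, o', a' with
    | none, a, _, _ => exact absurd a.2 (by simp [allCol, Col.zero])
    | some i, a, none, a' => exact absurd a'.2 (by simp [allCol, Col.zero])
    | some i, a, some j, a' =>
      have := T.end_unique (some i) a (some j) a' h hd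
      obtain ⟨h1, h2⟩ := Sigma.mk.inj_iff.1 this
      obtain rfl := Option.some.inj h1
      rw [eq_of_heq h2]
  gap_last o := by
    match o with
    | none => rfl
    | some i => exact T.gap_last (some i)
  shade_white := T.shade_white
  shade_black := T.shade_black
  shade_gap o a := by
    match o, a with
    | none, a =>
      have h : a.val = 0 := by
        have := a.2
        simp only [allCol, Col.zero] at this
        omega
      simp [allCol, Col.zero, h]
    | some i, a => exact T.shade_gap (some i) a
  side_even o a h := by
    match o, a with
    | none, a => exact absurd a.2 (by simp [allCol, Col.zero])
    | some i, a => exact T.side_even (some i) a h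
  side_odd o a h := by
    match o, a with
    | none, a => exact absurd a.2 (by simp [allCol, Col.zero])
    | some i, a => exact T.side_odd (some i) a h
  connected := T.connected
  euler := by
    rw [T.euler]
    congr 2
    apply congrArg
    funext o o'
    apply propext
    match o, o' with
    | none, _ =>
      constructor
      · rintro ⟨a, _⟩
        exact absurd a.2 (by simp [allCol, Col.zero])
      · rintro ⟨a, _⟩
        exact absurd a.2 (by simp [allCol, Col.zero])
    | some i, none =>
      constructor
      · rintro ⟨_, a, _⟩
        exact absurd a.2 (by simp [allCol, Col.zero])
      · rintro ⟨_, a, _⟩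
        exact absurd a.2 (by simp [allCol, Col.zero])
    | some i, some j => exact Iff.rfl

/-! ### The standard tangles

All tangles below are drawn with the marked points of a box of colour `n` on its top side (points
`0, …, n - 1`, from left to right) and on its bottom side (points `n, …, 2 n - 1`, from right to
left), the region marked `*` being on the left. -/

/-- A tangle with `b` internal boxes whose strings and regions are numbered: `left s` and `right s`
are the regions on the two sides of the string `s`, and `parity r` (together with `sh`) determines
the shading of the region `r`. -/
def ofCode (n₀ : Col) (b : ℕ) (col : Fin b → Col) (s r : ℕ) (str gap : Option (Fin b) → ℕ → ℕ)
    (left right parity : ℕ → ℕ) (sh : Bool)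
    (str_lt : ∀ o a, a < 2 * (allCol n₀ col o).size → str o a < s)
    (gap_lt : ∀ o a, a ≤ 2 * (allCol n₀ col o).size → gap o a < r)
    (left_lt : ∀ x, x < s → left x < r) (right_lt : ∀ x, x < s → right x < r)
    (hsh : 0 < s → sh = false) (hsh_col : ∀ o, (allCol n₀ col o).shaded = sh)
    (exists_end : ∀ o a, a < 2 * (allCol n₀ col o).size → ∃ o' a',
      a' < 2 * (allCol n₀ col o').size ∧ str o' a' = str o a ∧ direction o' a' ≠ direction o a)
    (end_unique : ∀ o a o' a', a < 2 * (allCol n₀ col o).size → a' < 2 * (allCol n₀ col o').size →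
      str o a = str o' a' → direction o a = direction o' a' → o = o' ∧ a = a')
    (gap_last : ∀ o, gap o (2 * (allCol n₀ col o).size) = gap o 0)
    (parity_side : ∀ x, x < s → parity (left x) % 2 ≠ parity (right x) % 2)
    (parity_gap : ∀ o a, a ≤ 2 * (allCol n₀ col o).size → parity (gap o a) % 2 = a % 2)
    (side : ∀ o a, a < 2 * (allCol n₀ col o).size →
      (left (str o a) = gap o a ∧ right (str o a) = gap o (a + 1)) ∨
      (left (str o a) = gap o (a + 1) ∧ right (str o a) = gap o a))
    (connected : ∀ x, 0 < x → x < r → ∃ y, y < s ∧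
      ((left y = x ∧ right y < x) ∨ (right y = x ∧ left y < x)))
    (euler : (b + r = s + 1 ∧ ∀ i, ∃ a a', a < 2 * (col i).size ∧ a' < 2 * n₀.size ∧
        str (some i) a = str none a') ∨
      (r = s + 1 ∧ ∀ o o' a a', a < 2 * (allCol n₀ col o).size →
        a' < 2 * (allCol n₀ col o').size → str o a = str o' a' → o = o')) :
    Tangle n₀ where
  Box := Fin b
  col := col
  Str := Fin s
  Reg := Fin r
  finite_box := inferInstance
  finite_str := inferInstance
  finite_reg := inferInstance
  str o a := ⟨str o a, str_lt o a a.2⟩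
  gap o a := ⟨gap o a, gap_lt o a (Nat.le_of_lt_succ a.2)⟩
  white x := ⟨if parity (left x) % 2 = 0 then left x else right x, by
    have := left_lt x x.2
    have := right_lt x x.2
    split_ifs <;> assumption⟩
  black x := ⟨if parity (left x) % 2 = 0 then right x else left x, by
    have := left_lt x x.2
    have := right_lt x x.2
    split_ifs <;> assumption⟩
  shade x := sh ^^ decide (parity x % 2 = 1)
  exists_end o a := by
    obtain ⟨o', a', h, h1, h2⟩ := exists_end o a a.2
    exact ⟨o', ⟨a', h⟩, Fin.ext h1, h2⟩
  end_unique o a o' a' h hd := by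
    obtain ⟨h1, h2⟩ := end_unique o a o' a' a.2 a'.2 (congrArg Fin.val h) hd
    subst h1
    obtain rfl := Fin.ext h2
    rfl
  gap_last o := Fin.ext (gap_last o)
  shade_white x := by
    have := parity_side x x.2
    rw [hsh (by have := x.2; omega), Bool.false_xor, decide_eq_false_iff_not]
    dsimp only
    split_ifs <;> omega
  shade_black x := by
    have := parity_side x x.2
    rw [hsh (by have := x.2; omega), Bool.false_xor, decide_eq_true_iff]
    dsimp only
    split_ifs <;> omega
  shade_gap o a := by
    rw [hsh_col]
    dsimp only
    rw [parity_gap o a (Nat.le_of_lt_succ a.2)]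
  side_even o a ha := by
    have h1 := side o a a.2
    have h2 := parity_gap o a a.2.le
    have h3 := parity_gap o (a + 1) a.2
    constructor <;> apply Fin.ext <;> dsimp only [Fin.val_castSucc, Fin.val_succ] <;>
      rcases h1 with ⟨h4, h5⟩ | ⟨h4, h5⟩ <;> rw [h4, h5] <;> split_ifs <;> first | rfl | omega
  side_odd o a ha := by
    have h1 := side o a a.2
    have h2 := parity_gap o a a.2.le
    have h3 := parity_gap o (a + 1) a.2
    constructor <;> apply Fin.ext <;> dsimp only [Fin.val_castSucc, Fin.val_succ] <;>
      rcases h1 with ⟨h4, h5⟩ | ⟨h4, h5⟩ <;> rw [h4, h5] <;> split_ifs <;> first | rfl | omega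
  connected := by
    by_cases hr : r = 0
    · intro x
      exact absurd x.2 (by omega)
    · refine connected_of_descent Fin.val ⟨0, by omega⟩ fun x hx => ?_
      have h0 : 0 < x.val := Nat.pos_of_ne_zero fun h => hx (Fin.ext h)
      obtain ⟨y, hy, h⟩ := connected x h0 x.2
      have hl := left_lt y hy
      have hr := right_lt y hy
      rcases h with ⟨h1, h2⟩ | ⟨h1, h2⟩
      · refine ⟨⟨right y, hr⟩, h2, ?_⟩
        by_cases hp : parity (left y) % 2 = 0
        · exact .inl ⟨⟨y, hy⟩, Fin.ext (by grind), Fin.ext (by grind)⟩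
        · exact .inr ⟨⟨y, hy⟩, Fin.ext (by grind), Fin.ext (by grind)⟩
      · refine ⟨⟨left y, hl⟩, h2, ?_⟩
        by_cases hp : parity (left y) % 2 = 0
        · exact .inr ⟨⟨y, hy⟩, Fin.ext (by grind), Fin.ext (by grind)⟩
        · exact .inl ⟨⟨y, hy⟩, Fin.ext (by grind), Fin.ext (by grind)⟩
  euler := by
    rcases euler with ⟨h1, h2⟩ | ⟨h1, h2⟩
    · rw [card_quot_eq_one]
      · simpa using h1
      · intro i
        obtain ⟨a, a', ha, ha', h⟩ := h2 i
        exact ⟨⟨a, ha⟩, ⟨a', ha'⟩, Fin.ext h⟩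
    · rw [card_quot_eq_self]
      · simp
        omega
      · rintro o o' ⟨a, a', h⟩
        exact h2 o o' a a' a.2 a'.2 (congrArg Fin.val h)

/-- The unit tangle `1^n`: there is no internal box, and the marked points on top of the external
box are joined to those on the bottom by `n` vertical strings. The string `s` has the region `s` on
its left and the region `s + 1` on its right. -/
def unit (c : Col) : Tangle c :=
  ofCode c 0 (fun i => i.elim0) c.size (c.size + 1)
    (fun _ a => if a < c.size then a else 2 * c.size - 1 - a)
    (fun _ a => if a ≤ c.size then a else 2 * c.size - a)
    (fun s => s) (fun s => s + 1) (fun r => r) c.shaded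
    (by rintro (_ | i) a h
        · dsimp only [allCol] at *; split_ifs <;> omega
        · exact i.elim0)
    (by rintro (_ | i) a h
        · dsimp only [allCol] at *; split_ifs <;> omega
        · exact i.elim0)
    (by intros; omega) (by intros; omega) c.white_of_pos
    (by rintro (_ | i)
        · rfl
        · exact i.elim0)
    (by rintro (_ | i) a h
        · refine ⟨none, 2 * c.size - 1 - a, ?_⟩
          dsimp only [allCol, direction] at *; split_ifs <;> omega
        · exact i.elim0)
    (by rintro (_ | i) a (_ | i') a' h h' he hd
        · refine ⟨rfl, ?_⟩
          dsimp only [allCol, direction] at *; split_ifs at he <;> omega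
        all_goals first | exact i.elim0 | exact i'.elim0)
    (by rintro (_ | i)
        · dsimp only [allCol]; grind
        · exact i.elim0)
    (by intros; omega)
    (by rintro (_ | i) a h
        · dsimp only [allCol] at *; split_ifs <;> omega
        · exact i.elim0)
    (by rintro (_ | i) a h
        · dsimp only [allCol] at *; split_ifs <;> omega
        · exact i.elim0)
    (fun x h h' => ⟨x - 1, by omega⟩)
    (.inl ⟨by omega, fun i => i.elim0⟩)

/-- The identity tangle `I_n^n`: each marked point of the external box is joined to the
corresponding marked point of the internal box. -/
def identity (c : Col) : Tangle c :=
  ofCode c 1 (fun _ => c) (2 * c.size) (2 * c.size - 1 + 1)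
    (fun _ a => a)
    (fun _ a => if a = 2 * c.size then 0 else a)
    (fun s => s) (fun s => if s + 1 = 2 * c.size then 0 else s + 1) (fun r => r) c.shaded
    (by rintro (_ | i) a h <;> exact h)
    (by rintro (_ | i) a h <;> dsimp only [allCol] at * <;> split_ifs <;> omega)
    (by intros; omega) (by intros; split_ifs <;> omega)
    (fun h => c.white_of_pos (by omega))
    (by rintro (_ | i) <;> rfl)
    (by rintro (_ | i) a h
        · refine ⟨some 0, a, h, rfl, ?_⟩
          simp [direction]; omega
        · refine ⟨none, a, h, rfl, ?_⟩
          simp [direction]; omega)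
    (by rintro (_ | i) a (_ | i') a' h h' he hd
        · exact ⟨rfl, he⟩
        · simp [direction] at *; omega
        · simp [direction] at *; omega
        · exact ⟨by rw [Subsingleton.elim i i'], he⟩)
    (by rintro (_ | i) <;> dsimp only [allCol] <;> grind)
    (by intros; split_ifs <;> omega)
    (by rintro (_ | i) a h <;> dsimp only [allCol] at * <;> split_ifs <;> omega)
    (by rintro (_ | i) a h <;> dsimp only [allCol] at * <;> split_ifs <;> omega)
    (fun x h h' => ⟨x - 1, by split_ifs <;> omega⟩)
    (by rcases Nat.eq_zero_or_pos c.size with h | h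
        · refine .inr ⟨by omega, ?_⟩
          rintro (_ | i) o' a a' ha <;> dsimp only [allCol] at ha <;> omega
        · exact .inl ⟨by omega, fun i => ⟨0, 0, by omega, by omega, rfl⟩⟩)

/-- Auxiliary for `mult`: the regions, where `off = 0`, `n - 1`, `2 * (n - 1)` for those above,
between and below the two boxes, and `t` is the number of strings to the left. -/
def multReg (n off t : ℕ) : ℕ := if t = 0 then 0 else if t = n then 3 * n - 2 else off + t

/-- Auxiliary for `mult`: the shading of the regions, as the number of strings to the left. -/
def multParity (n r : ℕ) : ℕ :=
  if r = 0 then 0 else if r = 3 * n - 2 then n else if r ≤ n - 1 then r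
  else if r ≤ 2 * (n - 1) then r - (n - 1) else r - 2 * (n - 1)

theorem multParity_multReg (n off t : ℕ) (ht : t ≤ n)
    (h : off = 0 ∨ off = n - 1 ∨ off = 2 * (n - 1)) : multParity n (multReg n off t) = t := by
  unfold multParity multReg
  rcases h with rfl | rfl | rfl <;> split_ifs <;> omega

/-- The multiplication tangle `M_{n,n}^n`: the internal box `0` is on top of the internal box `1`.
The strings are three groups of `n` vertical strings, which join the top of the external box to the
top of box `0`, the bottom of box `0` to the top of box `1`, and the bottom of box `1` to the bottom
of the external box. -/
def mult (c : Col) : Tangle c :=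
  ofCode c 2 (fun _ => c) (3 * c.size) (3 * c.size - 2 + 1)
    (fun o a => match o with
      | none => if a < c.size then a else 2 * c.size + (2 * c.size - 1 - a)
      | some 0 => if a < c.size then a else c.size + (2 * c.size - 1 - a)
      | some 1 => if a < c.size then c.size + a else 2 * c.size + (2 * c.size - 1 - a))
    (fun o a => match o with
      | none => if a ≤ c.size then multReg c.size 0 a
          else multReg c.size (2 * (c.size - 1)) (2 * c.size - a)
      | some 0 => if a ≤ c.size then multReg c.size 0 a
          else multReg c.size (c.size - 1) (2 * c.size - a)
      | some 1 => if a ≤ c.size then multReg c.size (c.size - 1) a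
          else multReg c.size (2 * (c.size - 1)) (2 * c.size - a))
    (fun s => if s < c.size then multReg c.size 0 s
      else if s < 2 * c.size then multReg c.size (c.size - 1) (s - c.size)
      else multReg c.size (2 * (c.size - 1)) (s - 2 * c.size))
    (fun s => if s < c.size then multReg c.size 0 (s + 1)
      else if s < 2 * c.size then multReg c.size (c.size - 1) (s - c.size + 1)
      else multReg c.size (2 * (c.size - 1)) (s - 2 * c.size + 1))
    (multParity c.size)
    c.shaded
    (by rintro (_ | i) a h
        · dsimp only [allCol] at *; grind
        · fin_cases i <;> dsimp only [allCol] at * <;> grind)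
    (by rintro (_ | i) a h
        · dsimp only [allCol] at *; grind [multReg]
        · fin_cases i <;> dsimp only [allCol] at * <;> grind [multReg])
    (by grind [multReg]) (by grind [multReg])
    (fun h => c.white_of_pos (by omega))
    (by rintro (_ | i) <;> rfl)
    (by rintro (_ | i) a h
        · dsimp only [allCol] at *
          by_cases ha : a < c.size
          · refine ⟨some 0, a, h, by grind, ?_⟩
            simp [direction]; omega
          · refine ⟨some 1, a, h, by simp [ha], ?_⟩
            simp [direction]; omega
        · fin_cases i <;> dsimp only [allCol] at *
          · by_cases ha : a < c.size
            · refine ⟨none, a, h, by grind, ?_⟩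
              simp [direction]; omega
            · refine ⟨some 1, 2 * c.size - 1 - a, by dsimp only; omega, by grind, ?_⟩
              simp [direction]; omega
          · by_cases ha : a < c.size
            · refine ⟨some 0, 2 * c.size - 1 - a, by dsimp only; omega, by grind, ?_⟩
              simp [direction]; omega
            · refine ⟨none, a, h, by simp [ha], ?_⟩
              simp [direction]; omega)
    (by rintro (_ | i) a (_ | i') a' h h' he hd
        · dsimp only [allCol] at *; simp only [direction] at hd; grind
        · fin_cases i' <;> dsimp only [allCol] at * <;> simp [direction] at hd <;> grind
        · fin_cases i <;> dsimp only [allCol] at * <;> simp [direction] at hd <;> grind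
        · fin_cases i <;> fin_cases i' <;> dsimp only [allCol] at * <;>
            simp [direction] at hd <;> grind)
    (by rintro (_ | i)
        · dsimp only [allCol] at *; grind [multReg]
        · fin_cases i <;> dsimp only [allCol] at * <;> grind [multReg])
    (by intro x h; grind [multParity_multReg])
    (by rintro (_ | i) a h
        · dsimp only [allCol] at *; grind [multParity_multReg]
        · fin_cases i <;> dsimp only [allCol] at * <;> grind [multParity_multReg])
    (by rintro (_ | i) a h
        · dsimp only [allCol] at *
          by_cases ha : a < c.size
          · left; grind
          · right
            by_cases ha' : a = c.size
            · subst ha'; grind [multReg]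
            · grind
        · fin_cases i <;> dsimp only [allCol] at * <;> by_cases ha : a < c.size
          · left; grind
          · right
            by_cases ha' : a = c.size
            · subst ha'; grind [multReg]
            · grind
          · left; grind
          · right
            by_cases ha' : a = c.size
            · subst ha'; grind [multReg]
            · grind)
    (by intro x h h'
        by_cases h1 : x = 3 * c.size - 2
        · refine ⟨c.size - 1, by omega, .inr ?_⟩
          dsimp only [multReg]
          constructor <;> grind
        · by_cases h2 : x ≤ c.size - 1
          · refine ⟨x - 1, by omega, .inr ?_⟩
            dsimp only [multReg]
            constructor <;> grind
          · by_cases h3 : x ≤ 2 * (c.size - 1)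
            · refine ⟨c.size + (x - (c.size - 1)) - 1, by omega, .inr ?_⟩
              dsimp only [multReg]
              constructor <;> grind
            · refine ⟨2 * c.size + (x - 2 * (c.size - 1)) - 1, by omega, .inr ?_⟩
              dsimp only [multReg]
              constructor <;> grind)
    (by rcases Nat.eq_zero_or_pos c.size with h | h
        · refine .inr ⟨by omega, ?_⟩
          rintro (_ | i) o' a a' ha <;> dsimp only [allCol] at ha <;> omega
        · refine .inl ⟨by omega, fun i => ?_⟩
          fin_cases i
          · exact ⟨0, 0, by omega, by omega, by grind⟩
          · exact ⟨2 * c.size - 1, 2 * c.size - 1, by omega, by omega, by grind⟩)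

/-- Auxiliary for `incl` and `ER`: the string at the marked point `a` of the larger box. The
strings which end at the smaller box are numbered like the marked points of the smaller box, and
the strings to the right of it are `2 n, 2 n + 1, …`. -/
def inclStr (n k a : ℕ) : ℕ :=
  if a < n then a else if a < k then n + a
  else if a < 2 * k - n then n + (2 * k - 1 - a) else a - 2 * (k - n)

/-- Auxiliary for `incl` and `ER`: the region with `p` strings on its left (at the level of the
upper half of the smaller box). The regions at the smaller box are numbered like its boundary
intervals. -/
def inclVert (n p : ℕ) : ℕ := if p ≤ n then p else 2 * n - 1 + 1 + (p - n - 1)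

/-- Auxiliary for `incl` and `ER`: the region at the boundary interval `a` of the larger box. -/
def inclGap (n k a : ℕ) : ℕ :=
  if a ≤ k then inclVert n a else if a ≤ 2 * k - n then inclVert n (2 * k - a)
  else if a = 2 * k then 0 else a - 2 * (k - n)

/-- Auxiliary for `incl` and `ER`: the region on the left of a string. -/
def inclLeft (n s : ℕ) : ℕ := if s < 2 * n then s else inclVert n (s - n)

/-- Auxiliary for `incl` and `ER`: the region on the right of a string. -/
def inclRight (n s : ℕ) : ℕ :=
  if s < 2 * n then (if s + 1 = 2 * n then 0 else s + 1) else inclVert n (s - n + 1)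

/-- Auxiliary for `incl` and `ER`: the shading of a region. -/
def inclParity (n r : ℕ) : ℕ := if r < 2 * n - 1 + 1 then r else r - (2 * n - 1 + 1) + n + 1

theorem inclParity_inclVert (n p : ℕ) : inclParity n (inclVert n p) = p := by
  unfold inclParity inclVert
  split_ifs <;> omega

theorem incl_side (n k a : ℕ) (hnk : n ≤ k) (ha : a < 2 * k) :
    (inclLeft n (inclStr n k a) = inclGap n k a ∧
      inclRight n (inclStr n k a) = inclGap n k (a + 1)) ∨
    (inclLeft n (inclStr n k a) = inclGap n k (a + 1) ∧
      inclRight n (inclStr n k a) = inclGap n k a) := by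
  by_cases h1 : a < n
  · left
    simp only [inclStr, inclGap, inclLeft, inclRight, inclVert, h1, if_true]
    grind
  · by_cases h2 : a < k
    · left
      have e : inclStr n k a = n + a := by grind [inclStr]
      have e1 : inclGap n k a = inclVert n a := by grind [inclGap]
      have e2 : inclGap n k (a + 1) = inclVert n (a + 1) := by grind [inclGap]
      rw [e, e1, e2]
      constructor
      · rw [inclLeft, if_neg (by omega), Nat.add_sub_cancel_left]
      · rw [inclRight, if_neg (by omega), Nat.add_sub_cancel_left]
    · by_cases h3 : a < 2 * k - n
      · right
        have e : inclStr n k a = n + (2 * k - 1 - a) := by grind [inclStr]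
        have e1 : inclGap n k a = inclVert n (2 * k - 1 - a + 1) := by
          unfold inclGap
          split_ifs
          · congr 1; omega
          · congr 1; omega
          · omega
          · omega
        have e2 : inclGap n k (a + 1) = inclVert n (2 * k - 1 - a) := by
          unfold inclGap
          split_ifs
          · congr 1; omega
          · congr 1; omega
          · omega
          · omega
        rw [e, e1, e2]
        constructor
        · rw [inclLeft, if_neg (by omega), Nat.add_sub_cancel_left]
        · rw [inclRight, if_neg (by omega), Nat.add_sub_cancel_left]
      · left
        have e : inclStr n k a = a - 2 * (k - n) := by grind [inclStr]
        rw [e, inclLeft, inclRight, if_pos (by omega), if_pos (by omega)]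
        unfold inclGap inclVert
        constructor <;> split_ifs <;> omega

/-- The inclusion tangle `I_n^k` for `n ≤ k`: the `n` left-most marked points on the top and on the
bottom of the external box are joined to the internal box, and `k - n` vertical strings to the right
of the internal box join the top of the external box to its bottom. -/
def incl (n k : ℕ) (hnk : n ≤ k) : Tangle (Col.ofNat k) :=
  ofCode (Col.ofNat k) 1 (fun _ => Col.ofNat n) (n + k) (2 * n - 1 + 1 + (k - n))
    (fun o a => match o with
      | none => inclStr n k a
      | some _ => a)
    (fun o a => match o with
      | none => inclGap n k a
      | some _ => if a = 2 * n then 0 else a)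
    (inclLeft n) (inclRight n) (inclParity n) false
    (by rintro (_ | i) a h <;> dsimp only [allCol, Col.ofNat] at * <;> grind [inclStr])
    (by rintro (_ | i) a h <;> dsimp only [allCol, Col.ofNat] at * <;> grind [inclGap, inclVert])
    (by grind [inclLeft, inclVert]) (by grind [inclRight, inclVert])
    (fun _ => rfl)
    (by rintro (_ | i) <;> rfl)
    (by rintro (_ | i) a h
        · dsimp only [allCol, Col.ofNat] at *
          by_cases h1 : a < n
          · refine ⟨some 0, a, by dsimp only; omega, by grind [inclStr], ?_⟩
            simp [direction]; omega
          · by_cases h2 : a < 2 * k - n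
            · refine ⟨none, 2 * k - 1 - a, by dsimp only; omega, by grind [inclStr], ?_⟩
              simp [direction]; omega
            · refine ⟨some 0, a - 2 * (k - n), by dsimp only; omega, by grind [inclStr], ?_⟩
              simp [direction]; omega
        · dsimp only [allCol, Col.ofNat] at *
          by_cases h1 : a < n
          · refine ⟨none, a, by dsimp only; omega, by grind [inclStr], ?_⟩
            simp [direction]; omega
          · refine ⟨none, a + 2 * (k - n), by dsimp only; omega, by grind [inclStr], ?_⟩
            simp [direction]; omega)
    (by rintro (_ | i) a (_ | i') a' h h' he hd <;> dsimp only [allCol, Col.ofNat] at * <;>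
          simp [direction] at hd
        · grind [inclStr]
        · grind [inclStr]
        · grind [inclStr]
        · exact ⟨by rw [Subsingleton.elim i i'], he⟩)
    (by rintro (_ | i) <;> dsimp only [allCol, Col.ofNat] at * <;> grind [inclGap, inclVert])
    (by grind [inclLeft, inclRight, inclParity_inclVert, inclParity])
    (by rintro (_ | i) a h <;> dsimp only [allCol, Col.ofNat] at * <;>
          grind [inclGap, inclParity_inclVert, inclParity])
    (by rintro (_ | i) a h <;> dsimp only [allCol, Col.ofNat] at * <;>
          first | exact incl_side n k a hnk h | (left; grind [inclLeft, inclRight]))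
    (by intro x h h'
        refine ⟨if x < 2 * n - 1 + 1 then x - 1 else 2 * n + (x - (2 * n - 1 + 1)), ?_⟩
        grind [inclVert, inclLeft, inclRight])
    (by rcases Nat.eq_zero_or_pos n with h | h
        · refine .inr ⟨by omega, ?_⟩
          rintro (_ | i) (_ | i') a a' ha ha' <;> dsimp only [allCol, Col.ofNat] at ha ha' <;>
            first | (intro _; rfl) | omega
        · refine .inl ⟨by omega, fun i => ⟨0, 0, ?_⟩⟩
          dsimp only [Col.ofNat]
          grind [inclStr])

/-- The right expectation tangle `ER_k^n` for `n ≤ k`: the `n` left-most marked points on the top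
and on the bottom of the internal box are joined to the external box, and its remaining `k - n`
marked points on the top are joined to those on the bottom by strings around its right side. -/
def ER (k n : ℕ) (hnk : n ≤ k) : Tangle (Col.ofNat n) :=
  ofCode (Col.ofNat n) 1 (fun _ => Col.ofNat k) (n + k) (2 * n - 1 + 1 + (k - n))
    (fun o a => match o with
      | none => a
      | some _ => inclStr n k a)
    (fun o a => match o with
      | none => if a = 2 * n then 0 else a
      | some _ => inclGap n k a)
    (inclLeft n) (inclRight n) (inclParity n) false
    (by rintro (_ | i) a h <;> dsimp only [allCol, Col.ofNat] at * <;> grind [inclStr])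
    (by rintro (_ | i) a h <;> dsimp only [allCol, Col.ofNat] at * <;> grind [inclGap, inclVert])
    (by grind [inclLeft, inclVert]) (by grind [inclRight, inclVert])
    (fun _ => rfl)
    (by rintro (_ | i) <;> rfl)
    (by rintro (_ | i) a h
        · dsimp only [allCol, Col.ofNat] at *
          by_cases h1 : a < n
          · refine ⟨some 0, a, by dsimp only; omega, by grind [inclStr], ?_⟩
            simp [direction]; omega
          · refine ⟨some 0, a + 2 * (k - n), by dsimp only; omega, by grind [inclStr], ?_⟩
            simp [direction]; omega
        · dsimp only [allCol, Col.ofNat] at *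
          by_cases h1 : a < n
          · refine ⟨none, a, by dsimp only; omega, by grind [inclStr], ?_⟩
            simp [direction]; omega
          · by_cases h2 : a < 2 * k - n
            · refine ⟨some 0, 2 * k - 1 - a, by dsimp only; omega, by grind [inclStr], ?_⟩
              simp [direction]; omega
            · refine ⟨none, a - 2 * (k - n), by dsimp only; omega, by grind [inclStr], ?_⟩
              simp [direction]; omega)
    (by rintro (_ | i) a (_ | i') a' h h' he hd <;> dsimp only [allCol, Col.ofNat] at * <;>
          simp [direction] at hd
        · exact ⟨rfl, he⟩
        · grind [inclStr]
        · grind [inclStr]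
        · refine ⟨by rw [Subsingleton.elim i i'], ?_⟩
          grind [inclStr])
    (by rintro (_ | i) <;> dsimp only [allCol, Col.ofNat] at * <;> grind [inclGap, inclVert])
    (by grind [inclLeft, inclRight, inclParity_inclVert, inclParity])
    (by rintro (_ | i) a h <;> dsimp only [allCol, Col.ofNat] at * <;>
          grind [inclGap, inclParity_inclVert, inclParity])
    (by rintro (_ | i) a h <;> dsimp only [allCol, Col.ofNat] at * <;>
          first | exact incl_side n k a hnk h | (left; grind [inclLeft, inclRight]))
    (by intro x h h'
        refine ⟨if x < 2 * n - 1 + 1 then x - 1 else 2 * n + (x - (2 * n - 1 + 1)), ?_⟩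
        grind [inclVert, inclLeft, inclRight])
    (by rcases Nat.eq_zero_or_pos n with h | h
        · refine .inr ⟨by omega, ?_⟩
          rintro (_ | i) (_ | i') a a' ha ha' <;> dsimp only [allCol, Col.ofNat] at ha ha' <;>
            first | omega | (intro _; rfl) | (intro _; rw [Subsingleton.elim i i'])
        · refine .inl ⟨by omega, fun i => ⟨0, 0, ?_⟩⟩
          dsimp only [Col.ofNat]
          grind [inclStr])

/-- The Jones projection tangle `E^n` for `n ≥ 2`: there is no internal box, `n - 2` vertical
strings on the left join the top of the external box to its bottom, the two right-most marked points
on the top are joined to each other, and so are the two right-most marked points on the bottom. -/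
def jones (n : ℕ) (hn : 2 ≤ n) : Tangle (Col.ofNat n) :=
  ofCode (Col.ofNat n) 0 (fun i => i.elim0) n (n + 1)
    (fun _ a => if a < n - 2 then a else if a < n then n - 2 else if a < n + 2 then n - 1
      else 2 * n - 1 - a)
    (fun _ a => if a < n then a else if a = n then n - 2 else if a = n + 1 then n else 2 * n - a)
    (fun s => if s < n - 2 then s else n - 2)
    (fun s => s + 1) (fun r => if r < n then r else n - 1) false
    (by rintro (_ | i) a h
        · dsimp only [allCol, Col.ofNat] at *; grind
        · exact i.elim0)
    (by rintro (_ | i) a h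
        · dsimp only [allCol, Col.ofNat] at *; grind
        · exact i.elim0)
    (by grind) (by grind) (fun _ => rfl)
    (by rintro (_ | i)
        · rfl
        · exact i.elim0)
    (by rintro (_ | i) a h
        · dsimp only [allCol, Col.ofNat] at *
          refine ⟨none, if a = n - 2 then n - 1 else if a = n - 1 then n - 2 else
            if a = n then n + 1 else if a = n + 1 then n else 2 * n - 1 - a, ?_⟩
          dsimp only [allCol, direction]
          grind
        · exact i.elim0)
    (by rintro (_ | i) a (_ | i') a' h h' he hd
        · refine ⟨rfl, ?_⟩
          dsimp only [allCol, direction, Col.ofNat] at *; grind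
        all_goals first | exact i.elim0 | exact i'.elim0)
    (by rintro (_ | i)
        · dsimp only [allCol, Col.ofNat]; grind
        · exact i.elim0)
    (by grind)
    (by rintro (_ | i) a h
        · dsimp only [allCol, Col.ofNat] at *; grind
        · exact i.elim0)
    (by rintro (_ | i) a h
        · dsimp only [allCol, Col.ofNat] at *; grind
        · exact i.elim0)
    (fun x h h' => ⟨x - 1, by grind⟩)
    (.inl ⟨by omega, fun i => i.elim0⟩)

/-- The shift tangle `SH_k^{k+2}`: two vertical strings on the left join the top of the external
box to its bottom, and its other marked points are joined to the internal box on the right of these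
strings. -/
def shift (k : ℕ) : Tangle (Col.ofNat (k + 2)) :=
  ofCode (Col.ofNat (k + 2)) 1 (fun _ => Col.ofNat k) (2 + 2 * k) (2 + (2 * k - 1 + 1))
    (fun o a => match o with
      | none => if a < 2 * k + 2 then a else 2 * k + 3 - a
      | some _ => 2 + a)
    (fun o a => match o with
      | none => if a < 2 * k + 2 then a else 2 * k + 4 - a
      | some _ => if a = 2 * k then 2 else 2 + a)
    (fun s => s) (fun s => if s = 2 * k + 1 ∧ 2 ≤ s then 2 else s + 1) (fun r => r) false
    (by rintro (_ | i) a h <;> dsimp only [allCol, Col.ofNat] at * <;> grind)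
    (by rintro (_ | i) a h <;> dsimp only [allCol, Col.ofNat] at * <;> grind)
    (by grind) (by grind) (fun _ => rfl)
    (by rintro (_ | i) <;> rfl)
    (by rintro (_ | i) a h
        · dsimp only [allCol, Col.ofNat] at *
          by_cases h1 : 2 ≤ a ∧ a < 2 * k + 2
          · refine ⟨some 0, a - 2, by dsimp only; omega, by grind, ?_⟩
            simp [direction]; omega
          · refine ⟨none, 2 * k + 3 - a, by dsimp only; omega, by grind, ?_⟩
            simp [direction]; omega
        · dsimp only [allCol, Col.ofNat] at *
          refine ⟨none, a + 2, by dsimp only; omega, by grind, ?_⟩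
          simp [direction]; omega)
    (by rintro (_ | i) a (_ | i') a' h h' he hd <;> dsimp only [allCol, Col.ofNat] at * <;>
          simp [direction] at hd
        · grind
        · grind
        · grind
        · exact ⟨by rw [Subsingleton.elim i i'], by omega⟩)
    (by rintro (_ | i) <;> dsimp only [allCol, Col.ofNat] at * <;> grind)
    (by grind)
    (by rintro (_ | i) a h <;> dsimp only [allCol, Col.ofNat] at * <;> grind)
    (by rintro (_ | i) a h <;> dsimp only [allCol, Col.ofNat] at * <;> grind)
    (fun x h h' => ⟨x - 1, by grind⟩)
    (by rcases Nat.eq_zero_or_pos k with h | h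
        · refine .inr ⟨by omega, ?_⟩
          rintro (_ | i) (_ | i') a a' ha ha' <;> dsimp only [allCol, Col.ofNat] at ha ha' <;>
            first | (intro _; rfl) | omega
        · refine .inl ⟨by omega, fun i => ⟨0, 2, ?_⟩⟩
          dsimp only [Col.ofNat]
          grind)

/-- Auxiliary for `stack`: the region with `t ≤ m` vertical strings on its left, at level `l`. The
level `l = 0, …, b` is the part between the boxes `l - 1` and `l`. The left-most region (`t = 0`) is
the same on all levels. -/
def stackReg (m b : ℕ) (l : Fin (b + 1)) (t : ℕ) (ht : t ≤ m) :
    Unit ⊕ (Fin (b + 1) × Fin m) ⊕ Fin b :=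
  if h : t = 0 then .inl () else .inr (.inl (l, ⟨t - 1, by omega⟩))

theorem stackReg_congr {m b : ℕ} {l l' : Fin (b + 1)} {t t' : ℕ} (ht : t ≤ m) (ht' : t' ≤ m)
    (hl : l.val = l'.val) (h : t = t') : stackReg m b l t ht = stackReg m b l' t' ht' := by
  obtain rfl := Fin.ext hl
  subst h
  rfl

/-- Auxiliary for `T`: the tangle `T^n` with `b` internal boxes, for `k = m + 1` and `n = m + b`. Its strings
are the `m` vertical strings on each level `0, …, b`, and `2 b` strings which join the right-most
marked points of the internal boxes to the external box. Its regions are those between the vertical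
strings (see `stackReg`), and for each internal box the one between its two right-most strings. -/
def stack (k n m b : ℕ) (hk : k = m + 1) (hn : n = m + b) (hb : 0 < b) : Tangle (Col.ofNat n) where
  Box := Fin b
  col := fun _ => Col.ofNat k
  Str := (Fin (b + 1) × Fin m) ⊕ Fin (2 * b)
  Reg := Unit ⊕ (Fin (b + 1) × Fin m) ⊕ Fin b
  finite_box := inferInstance
  finite_str := inferInstance
  finite_reg := inferInstance
  str
    | none, a =>
      have ha : a.val < 2 * n := a.2
      if h : a.val < m then .inl (0, ⟨a.val, h⟩)
      else if h' : a.val < m + 2 * b then .inr ⟨a.val - m, by omega⟩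
      else .inl (Fin.last b, ⟨2 * n - 1 - a.val, by omega⟩)
    | some i, a =>
      have ha : a.val < 2 * k := a.2
      if h : a.val < m then .inl (i.castSucc, ⟨a.val, h⟩)
      else if h' : a.val < m + 2 then .inr ⟨2 * i.val + (a.val - m), by omega⟩
      else .inl (i.succ, ⟨2 * k - 1 - a.val, by omega⟩)
  gap
    | none, a =>
      have ha : a.val < 2 * n + 1 := a.2
      if h : a.val ≤ m then stackReg m b 0 a.val h
      else if h' : a.val < m + 2 * b then
        if (a.val - m) % 2 = 0 then stackReg m b ⟨(a.val - m) / 2, by omega⟩ m le_rfl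
        else .inr (.inr ⟨(a.val - m) / 2, by omega⟩)
      else stackReg m b (Fin.last b) (2 * n - a.val) (by omega)
    | some i, a =>
      have ha : a.val < 2 * k + 1 := a.2
      if h : a.val ≤ m then stackReg m b i.castSucc a.val h
      else if h' : a.val = m + 1 then .inr (.inr i)
      else stackReg m b i.succ (2 * k - a.val) (by omega)
  white
    | .inl (l, t) => if t.val % 2 = 0 then stackReg m b l t.val t.2.le
        else stackReg m b l (t.val + 1) t.2
    | .inr q => if m % 2 = 0 then stackReg m b ⟨(q.val + 1) / 2, by omega⟩ m le_rfl
        else .inr (.inr ⟨q.val / 2, by omega⟩)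
  black
    | .inl (l, t) => if t.val % 2 = 0 then stackReg m b l (t.val + 1) t.2
        else stackReg m b l t.val t.2.le
    | .inr q => if m % 2 = 0 then .inr (.inr ⟨q.val / 2, by omega⟩)
        else stackReg m b ⟨(q.val + 1) / 2, by omega⟩ m le_rfl
  shade
    | .inl _ => false
    | .inr (.inl (_, t)) => decide (t.val % 2 = 0)
    | .inr (.inr _) => decide (m % 2 = 0)
  exists_end o a := by
    match o, a with
    | none, ⟨a, ha⟩ =>
      have ha' : a < 2 * n := ha
      by_cases h : a < m
      · refine ⟨some ⟨0, by omega⟩, ⟨a, show _ < 2 * k by omega⟩, ?_, ?_⟩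
        · simp only [h, dite_true]
          rfl
        · simp [direction]; omega
      · by_cases h' : a < m + 2 * b
        · refine ⟨some ⟨(a - m) / 2, by omega⟩, ⟨m + (a - m) % 2, show _ < 2 * k by omega⟩,
            ?_, ?_⟩
          · have h1 : ¬ (m + (a - m) % 2 < m) := by omega
            have h2 : m + (a - m) % 2 < m + 2 := by omega
            simp only [h, h', h1, h2, dite_true, dite_false]
            congr 2
            omega
          · simp [direction]; omega
        · refine ⟨some ⟨b - 1, by omega⟩, ⟨a + 2 - 2 * b, show _ < 2 * k by omega⟩,
              ?_, ?_⟩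
          · have h1 : ¬ (a + 2 - 2 * b < m) := by omega
            have h2 : ¬ (a + 2 - 2 * b < m + 2) := by omega
            simp only [h, h', h1, h2, dite_false]
            congr 2
            · apply Fin.ext; simp; omega
            · apply Fin.ext; simp; omega
          · simp [direction]; omega
    | some i, ⟨a, ha⟩ =>
      have ha' : a < 2 * k := ha
      by_cases h : a < m
      · by_cases hi : i.val = 0
        · refine ⟨none, ⟨a, show _ < 2 * n by have := i.2; omega⟩, ?_, ?_⟩
          · simp only [h, dite_true]
            congr 2
            apply Fin.ext; simp [hi]
          · simp [direction]; omega
        · refine ⟨some ⟨i.val - 1, by omega⟩, ⟨2 * m + 1 - a, show _ < 2 * k by omega⟩,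
            ?_, ?_⟩
          · have h1 : ¬ (2 * m + 1 - a < m) := by omega
            have h2 : ¬ (2 * m + 1 - a < m + 2) := by omega
            simp only [h, h1, h2, dite_true, dite_false]
            congr 2
            · apply Fin.ext; simp; omega
            · apply Fin.ext; simp; omega
          · simp [direction]; omega
      · by_cases h' : a < m + 2
        · refine ⟨none, ⟨m + (2 * i.val + (a - m)), show _ < 2 * n by omega⟩, ?_, ?_⟩
          · have h1 : ¬ (m + (2 * i.val + (a - m)) < m) := by omega
            have h2 : m + (2 * i.val + (a - m)) < m + 2 * b := by omega
            simp only [h, h', h1, h2, dite_true, dite_false]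
            congr 2
            omega
          · simp [direction]; omega
        · by_cases hi : i.val + 1 = b
          · refine ⟨none, ⟨a + 2 * b - 2, show _ < 2 * n by omega⟩, ?_, ?_⟩
            · have h1 : ¬ (a + 2 * b - 2 < m) := by omega
              have h2 : ¬ (a + 2 * b - 2 < m + 2 * b) := by omega
              simp only [h, h', h1, h2, dite_false]
              congr 2
              · apply Fin.ext; simp [hi]
              · apply Fin.ext; simp; omega
            · simp [direction]; omega
          · refine ⟨some ⟨i.val + 1, by omega⟩, ⟨2 * m + 1 - a, show _ < 2 * k by omega⟩,
              ?_, ?_⟩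
            · have h1 : 2 * m + 1 - a < m := by omega
              simp only [h, h', h1, dite_true, dite_false]
              congr 2
              apply Fin.ext; dsimp only; omega
            · simp [direction]; omega
  end_unique o a o' a' h hd := by
    match o, a, o', a' with
    | none, ⟨a, ha⟩, none, ⟨a', ha'⟩ =>
      have h1 : a < 2 * n := ha
      have h2 : a' < 2 * n := ha'
      have : a = a' := by
        simp [direction] at hd
        dsimp only at h
        split_ifs at h <;> simp at h <;> omega
      subst this
      rfl
    | none, ⟨a, ha⟩, some i, ⟨a', ha'⟩ =>
      exfalso
      have h1 : a < 2 * n := ha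
      have h2 : a' < 2 * k := ha'
      simp [direction] at hd
      dsimp only at h
      split_ifs at h <;> simp [Fin.ext_iff] at h <;> omega
    | some i, ⟨a, ha⟩, none, ⟨a', ha'⟩ =>
      exfalso
      have h1 : a' < 2 * n := ha'
      have h2 : a < 2 * k := ha
      simp [direction] at hd
      dsimp only at h
      split_ifs at h <;> simp [Fin.ext_iff] at h <;> omega
    | some i, ⟨a, ha⟩, some i', ⟨a', ha'⟩ =>
      have h1 : a < 2 * k := ha
      have h2 : a' < 2 * k := ha'
      have : i = i' ∧ a = a' := by
        simp [direction] at hd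
        dsimp only at h
        rw [Fin.ext_iff]
        split_ifs at h <;> simp [Fin.ext_iff] at h <;> omega
      obtain ⟨rfl, rfl⟩ := this
      rfl
  gap_last o := by
    match o with
    | none =>
      simp only [Fin.val_last, Fin.val_zero, allCol, Col.ofNat, stackReg]
      grind
    | some i =>
      simp only [Fin.val_last, Fin.val_zero, allCol, Col.ofNat, stackReg]
      grind
  shade_white s := by
    match s with
    | .inl (l, t) =>
      simp only [stackReg]
      grind
    | .inr q =>
      simp only [stackReg]
      grind
  shade_black s := by
    match s with
    | .inl (l, t) =>
      simp only [stackReg]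
      grind
    | .inr q =>
      simp only [stackReg]
      grind
  shade_gap o a := by
    match o, a with
    | none, ⟨a, ha⟩ =>
      have h1 : a < 2 * n + 1 := ha
      simp only [stackReg, allCol, Col.ofNat, Bool.false_xor]
      split_ifs <;> simp <;> omega
    | some i, ⟨a, ha⟩ =>
      have h1 : a < 2 * k + 1 := ha
      simp only [stackReg, allCol, Col.ofNat, Bool.false_xor]
      split_ifs <;> simp <;> omega
  side_even o a hp := by
    match o, a with
    | none, ⟨a, ha⟩ =>
      have h1 : a < 2 * n := ha
      simp only [Fin.castSucc_mk, Fin.succ_mk] at hp ⊢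
      by_cases h : a < m
      · simp only [h, dite_true, hp]
        constructor <;> split_ifs <;> first
          | omega
          | (apply stackReg_congr <;> (try simp) <;> omega)
      · by_cases h' : a < m + 2 * b
        · simp only [h, h', dite_true, dite_false]
          constructor <;> split_ifs <;> first
            | omega
            | (apply stackReg_congr <;> (try simp) <;> omega)
            | (congr 3 <;> omega)
        · simp only [h, h', dite_false]
          constructor <;> split_ifs <;> first
            | omega
            | (apply stackReg_congr <;> (try simp) <;> omega)
    | some i, ⟨a, ha⟩ =>
      have h1 : a < 2 * k := ha
      simp only [Fin.castSucc_mk, Fin.succ_mk] at hp ⊢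
      by_cases h : a < m
      · simp only [h, dite_true, hp]
        constructor <;> split_ifs <;> first
          | omega
          | (apply stackReg_congr <;> (try simp) <;> omega)
      · by_cases h' : a < m + 2
        · simp only [h, h', dite_true, dite_false]
          constructor <;> split_ifs <;> first
            | omega
            | (apply stackReg_congr <;> (try simp) <;> omega)
            | (congr 2; apply Fin.ext; dsimp only; omega)
        · simp only [h, h', dite_false]
          constructor <;> split_ifs <;> first
            | omega
            | (apply stackReg_congr <;> (try simp) <;> omega)
  side_odd o a hp := by
    match o, a with
    | none, ⟨a, ha⟩ =>
      have h1 : a < 2 * n := ha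
      simp only [Fin.castSucc_mk, Fin.succ_mk] at hp ⊢
      by_cases h : a < m
      · simp only [h, dite_true]
        constructor <;> split_ifs <;> first
          | omega
          | (apply stackReg_congr <;> (try simp) <;> omega)
      · by_cases h' : a < m + 2 * b
        · simp only [h, h', dite_true, dite_false]
          constructor <;> split_ifs <;> first
            | omega
            | (apply stackReg_congr <;> (try simp) <;> omega)
            | (congr 3 <;> omega)
        · simp only [h, h', dite_false]
          constructor <;> split_ifs <;> first
            | omega
            | (apply stackReg_congr <;> (try simp) <;> omega)
    | some i, ⟨a, ha⟩ =>
      have h1 : a < 2 * k := ha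
      simp only [Fin.castSucc_mk, Fin.succ_mk] at hp ⊢
      by_cases h : a < m
      · simp only [h, dite_true]
        constructor <;> split_ifs <;> first
          | omega
          | (apply stackReg_congr <;> (try simp) <;> omega)
      · by_cases h' : a < m + 2
        · simp only [h, h', dite_true, dite_false]
          constructor <;> split_ifs <;> first
            | omega
            | (apply stackReg_congr <;> (try simp) <;> omega)
            | (congr 2; apply Fin.ext; dsimp only; omega)
        · simp only [h, h', dite_false]
          constructor <;> split_ifs <;> first
            | omega
            | (apply stackReg_congr <;> (try simp) <;> omega)
  connected := by
    refine connected_of_descent (fun r => match r with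
      | .inl _ => 0
      | .inr (.inl (_, t)) => t.val + 1
      | .inr (.inr _) => m + 1) (.inl ()) fun r hr => ?_
    match r with
    | .inl _ => exact absurd rfl hr
    | .inr (.inl (l, t)) =>
      refine ⟨stackReg m b l t.val t.2.le, ?_, ?_⟩
      · unfold stackReg
        split_ifs
        · simp
        · simp only
          omega
      · have e : stackReg m b l (t.val + 1) t.2 = .inr (.inl (l, t)) := by simp [stackReg]
        by_cases ht : t.val % 2 = 0
        · exact .inr ⟨.inl (l, t), by simp only [ht, if_true], by simp only [ht, if_true, e]⟩
        · exact .inl ⟨.inl (l, t), by simp only [ht, if_false, e], by simp only [ht, if_false]⟩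
    | .inr (.inr i) =>
      refine ⟨stackReg m b i.castSucc m le_rfl, ?_, ?_⟩
      · unfold stackReg
        split_ifs
        · simp
        · simp only
          omega
      · have e1 : (⟨2 * i.val / 2, by omega⟩ : Fin b) = i := by
          apply Fin.ext; dsimp only; omega
        have e2 : (⟨(2 * i.val + 1) / 2, by omega⟩ : Fin (b + 1)) = i.castSucc := by
          apply Fin.ext; simp; omega
        by_cases ht : m % 2 = 0
        · exact .inr ⟨.inr ⟨2 * i.val, by omega⟩, by simp only [ht, if_true, e2],
            by simp only [ht, if_true, e1]⟩
        · exact .inl ⟨.inr ⟨2 * i.val, by omega⟩, by simp only [ht, if_false, e1],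
            by simp only [ht, if_false, e2]⟩
  euler := by
    rw [card_quot_eq_one]
    · simp [Nat.card_eq_fintype_card]
      ring
    · intro i
      refine ⟨⟨m, show _ < 2 * k by omega⟩, ⟨m + 2 * i.val, show _ < 2 * n by omega⟩, ?_⟩
      simp

/-- The tangle `T^n` for `n ≥ k ≥ 1`: its `n - k + 1` internal boxes have colour `k` and are stacked
on top of each other. The `k - 1` left-most marked points on the bottom of each of these boxes are
joined to those on the top of the next one, the `k - 1` left-most ones on the top of the external
box to those on the top of the first box, and the `k - 1` left-most ones on the bottom of the last
box to those on the bottom of the external box. The right-most marked points on top and bottom of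
each internal box are joined to the external box. -/
def T (k n : ℕ) (hk : 1 ≤ k) (hkn : k ≤ n) : Tangle (Col.ofNat n) :=
  stack k n (k - 1) (n - k + 1) (by omega) (by omega) (by omega)

/-- The `0_±`-tangle `C^{0_±}` (`0₊` for `s = false`, `0₋` for `s = true`): a single closed loop. -/
def circle (s : Bool) : Tangle (Col.zero s) :=
  (unit (Col.zero s)).addLoop (show Fin ((Col.zero s).size + 1) from 0)

end Tangle

open Tangle

/-! ### Planar algebras -/

/-- A (complex) planar algebra: an algebra over the coloured operad of planar tangles. -/
structure PlanarAlgebra where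
  /-- the vector spaces `P_c` -/
  space : Col → Type u
  [addCommGroup : ∀ c, AddCommGroup (space c)]
  [module : ∀ c, Module ℂ (space c)]
  /-- the action of tangles -/
  Z : ∀ {c : Col} (T : Tangle c), MultilinearMap ℂ (fun i : T.Box => space (T.col i)) (space c)
  /-- invariance under planar isotopy, and compatibility with renumbering of internal boxes -/
  Z_iso : ∀ {c : Col} {T T' : Tangle c} (e : Iso T T') (x : ∀ i, space (T'.col i)),
    Z T' x = Z T fun i => cast (congrArg space (e.col_eq i)) (x (e.box i))
  Z_identity : ∀ (c : Col) (x : space c), Z (identity c) (fun _ => x) = x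
  /-- compatibility with substitution of tangles -/
  Z_composite : ∀ {c : Col} {T : Tangle c} {S : ∀ i, Tangle (T.col i)} {U : Tangle c}
    (e : Composite T S U) (x : ∀ j, space (U.col j)),
    Z U x = Z T fun i => Z (S i) fun j => cast (congrArg space (e.col_eq ⟨i, j⟩)) (x (e.box ⟨i, j⟩))

attribute [instance] PlanarAlgebra.addCommGroup PlanarAlgebra.module

namespace PlanarAlgebra

variable (P : PlanarAlgebra.{u})

/-- The multiplication of `P_c`, given by the tangle `M_{c,c}^c`. -/
def mul {c : Col} (x y : P.space c) : P.space c :=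
  P.Z (mult c) (show Fin 2 → P.space c from ![x, y])

/-- The unit `1_c` of `P_c`. -/
def one (c : Col) : P.space c := P.Z (unit c) fun i => i.elim0

/-- The inclusion `P_n → P_k` for `n ≤ k`. -/
def inclusion {n k : ℕ} (h : n ≤ k) (x : P.space (Col.ofNat n)) : P.space (Col.ofNat k) :=
  P.Z (incl n k h) fun _ => x

/-- The non-normalised Jones projection `E_n ∈ P_n`. -/
def jonesE (n : ℕ) (hn : 2 ≤ n) : P.space (Col.ofNat n) := P.Z (jones n hn) fun i => i.elim0

/-- The subspace `P_k E_{k+1} P_k` of `P_{k+1}`, the span of all products `x E_{k+1} y` with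
`x, y ∈ P_k`. -/
def depthSpan (k : ℕ) (hk : 1 ≤ k) : Submodule ℂ (P.space (Col.ofNat (k + 1))) :=
  Submodule.span ℂ {z | ∃ x y : P.space (Col.ofNat k),
    z = P.mul (P.mul (P.inclusion (Nat.le_succ k) x) (P.jonesE (k + 1) (Nat.succ_le_succ hk)))
      (P.inclusion (Nat.le_succ k) y)}

/-- The positive integers `k` with `P_{k+1} = P_k E_{k+1} P_k`. -/
def depthSet : Set ℕ := {k | ∃ hk : 1 ≤ k, P.depthSpan k hk = ⊤}

/-- `P` is of finite depth. -/
def FiniteDepth : Prop := P.depthSet.Nonempty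

/-- The depth of `P` (of interest only if `P` is of finite depth). -/
noncomputable def depth : ℕ := sInf P.depthSet

/-- The subspace `R_{(P,B)}(T)` which is spanned by the values of the tangle `T` on labels from
`B ⊆ ∐ P_c`. -/
def range (B : Set (Σ c, P.space c)) {c : Col} (T : Tangle c) : Submodule ℂ (P.space c) :=
  Submodule.span ℂ {z | ∃ x : ∀ i, P.space (T.col i),
    (∀ i, (⟨T.col i, x i⟩ : Σ c, P.space c) ∈ B) ∧ z = P.Z T x}

/-- The template `S ⇒ T` holds for the pair `(P, B)`. -/
def TemplateHolds (B : Set (Σ c, P.space c)) {c : Col} (S T : Tangle c) : Prop :=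
  P.range B S ≤ P.range B T

end PlanarAlgebra

/-- Subfactor planar algebras. -/
structure SubfactorPlanarAlgebra extends PlanarAlgebra.{u} where
  finiteDimensional : ∀ c, FiniteDimensional ℂ (space c)
  finrank_zero : ∀ s, Module.finrank ℂ (space (Col.zero s)) = 1
  /-- the modulus -/
  δ : ℝ
  δ_pos : 0 < δ
  /-- closed loops contribute a factor of `δ` -/
  modulus : ∀ {c : Col} (T : Tangle c) (r : T.Reg) (x : ∀ i, space (T.col i)),
    Z (T.addLoop r) x = (δ : ℂ) • Z T x
  /-- the value of a `0`-tangle, as a multiple of the unit of the one-dimensional algebra `P_{0_±}`,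
  depends only on the tangle on the two-sphere -/
  spherical : ∀ {s : Bool} (T : Tangle (Col.zero s)) (r : T.Reg) (x : ∀ i, space (T.col i)) (z : ℂ),
    Z T x = z • toPlanarAlgebra.one (Col.zero s) →
      Z (T.moveExt r) x = z • toPlanarAlgebra.one (Col.zero (T.shade r))
  /-- the involution -/
  star : ∀ {c : Col}, space c → space c
  star_star : ∀ {c : Col} (x : space c), star (star x) = x
  star_add : ∀ {c : Col} (x y : space c), star (x + y) = star x + star y
  star_smul : ∀ {c : Col} (z : ℂ) (x : space c), star (z • x) = conj z • star x
  star_mul : ∀ {c : Col} (x y : space c),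
    star (toPlanarAlgebra.mul x y) = toPlanarAlgebra.mul (star y) (star x)
  star_Z : ∀ {c : Col} (T : Tangle c) (x : ∀ i, space (T.col i)),
    star (Z T x) = Z T.adj fun i => star (x i)
  /-- each `P_c` has a norm which makes it a C*-algebra (completeness is automatic) -/
  exists_cstar_norm : ∀ c : Col, ∃ N : Seminorm ℂ (space c),
    (∀ x, N x = 0 → x = 0) ∧ (∀ x y, N (toPlanarAlgebra.mul x y) ≤ N x * N y) ∧
      ∀ x, N (toPlanarAlgebra.mul (star x) x) = N x ^ 2
  /-- the normalised trace `τ(x) = δ⁻ⁿ Z_{TR_n^0}(x)` is positive and faithful -/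
  trace_pos : ∀ (n : ℕ) (x : space (Col.ofNat n)), x ≠ 0 → ∃ t : ℝ, 0 < t ∧
    ((δ : ℂ) ^ n)⁻¹ • Z (ER n 0 n.zero_le) (fun _ => toPlanarAlgebra.mul (star x) x) =
      (t : ℂ) • toPlanarAlgebra.one (Col.ofNat 0)

/-! ### The basic templates -/

/-- `BasicTemplate k hk S T` says that `S ⇒ T` is one of the basic templates for the positive
integer `k`. A tangle `U` with `IsComposite _ _ U` is the composite of the given tangles. -/
inductive BasicTemplate (k : ℕ) (hk : 1 ≤ k) : ∀ {c : Col}, Tangle c → Tangle c → Prop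
  /-- modulus: `C^{0_±} ⇒ 1^{0_±}` -/
  | modulus (s : Bool) : BasicTemplate k hk (circle s) (unit (Col.zero s))
  /-- modulus: `1^{0_±} ⇒ C^{0_±}` -/
  | modulus' (s : Bool) : BasicTemplate k hk (unit (Col.zero s)) (circle s)
  /-- identity: `1^k ⇒ I_k^k` -/
  | unit : BasicTemplate k hk (unit (Col.ofNat k)) (identity (Col.ofNat k))
  /-- inclusion: `I_k^{k+1} ⇒ T^{k+1}` -/
  | inclusion : BasicTemplate k hk (incl k (k + 1) k.le_succ) (T k (k + 1) hk k.le_succ)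
  /-- Jones projections: `I_n^k ∘ E^n ⇒ I_k^k` for `2 ≤ n ≤ k` -/
  | jones (n : ℕ) (hn : 2 ≤ n) (hnk : n ≤ k) (U : Tangle (Col.ofNat k))
      (hU : IsComposite (incl n k hnk) (fun _ => jones n hn) U) :
      BasicTemplate k hk U (identity (Col.ofNat k))
  /-- multiplication: `M_{k,k}^k ⇒ I_k^k` -/
  | multiplication : BasicTemplate k hk (mult (Col.ofNat k)) (identity (Col.ofNat k))
  /-- conditional expectation: `I_{k-1}^k ∘ ER_k^{k-1} ⇒ I_k^k` -/
  | expectation (U : Tangle (Col.ofNat k))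
      (hU : IsComposite (incl (k - 1) k (k.sub_le 1)) (fun _ => ER k (k - 1) (k.sub_le 1)) U) :
      BasicTemplate k hk U (identity (Col.ofNat k))
  /-- depth: `1^{k+1} ⇒ T^{k+1}` -/
  | depth : BasicTemplate k hk (unit (Col.ofNat (k + 1))) (T k (k + 1) hk k.le_succ)
  /-- shift: `SH_k^{k+2} ⇒ T^{k+2}` -/
  | shift : BasicTemplate k hk (shift k) (T k (k + 2) hk (k.le_add_right 2))

end PlanarAlg

/-! Apart from the modulus templates, every basic template has `I_k^k`, `T^{k+1}` or `T^{k+2}` on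
its right, and each of these tangles has full range. The tangle on the left is then irrelevant. For
the modulus templates, the circle acts as `δ ≠ 0` times the unit (`range_circle`).

If all internal boxes have colour `k`, multilinearity identifies the range on a basis of `P_k` with
the span of all values (`range_eq_valueSpan`). For `I_k^k` this span is clearly `P_k`. It remains to
show that the values of `T^{k+1}` span `P_{k+1}` and those of `T^{k+2}` span `P_{k+2}`.

Let `d` be the depth. The product `x E_{d+1} y` is the value of `T^{d+1}` at `(x, y)`, so the claim
on `T^{k+1}` holds for `k = d`. Now suppose that it holds for `d`, and let `z ∈ P_{d+2}`. Expand the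
unit of `P_{d+1}` as a sum of products `x E_{d+1} y`; then `z = z · 1` is a sum of diagrams `z x
E_{d+1} y`. Since `E_{d+1} = E_{d+1} E_{d+2} E_{d+1}`, each of them equals `u E_{d+2} (E_{d+1} y)`,
where `u ∈ P_{d+1}` is obtained from `z` and `x` by bending strings (`span_stackSucc_cap`). This has
two consequences. The claim holds for `d + 1`, hence for all `k ≥ d` by induction. Moreover,
expanding `u` once more as a sum of `w E_{d+1} x` gives sums of `w E_{d+1} x E_{d+2} E_{d+1} y`,
which are values of `T^{d+2}` for three boxes of colour `d` (`valueSpan_stack_three`).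

The remaining work is to verify the identities of diagrams. A `Composite` requires the strings and
the regions of the result to be the glued ones. Only the strings are traced by hand;
`exists_composite` derives the regions from planarity. It uses Euler's inequality
`Tight.card_add_card_le`, whose proof is the orthogonality of differences across strings and
differences along strings. -/

namespace PlanarAlg

/-! ### Tight tangles and Euler's inequality -/

namespace Tangle

variable {n₀ : Col}

/-- The marked points on the boxes of a tangle. -/
abbrev Point (T : Tangle n₀) : Type := Σ o : Option T.Box, Fin (2 * (T.boxCol o).size)

/-- A tangle is tight if its diagram is connected and none of its strings is a closed loop. -/
structure Tight (T : Tangle n₀) : Prop where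
  cluster : Nat.card (Quot fun o o' : Option T.Box => ∃ a a', T.str o a = T.str o' a') = 1
  card_point : Nat.card T.Point = 2 * Nat.card T.Str

theorem direction_lt {Box : Type} (o : Option Box) (a : ℕ) : direction o a < 2 :=
  Nat.mod_lt _ two_pos

instance (T : Tangle n₀) : Finite T.Box := T.finite_box
instance (T : Tangle n₀) : Finite T.Str := T.finite_str
instance (T : Tangle n₀) : Finite T.Reg := T.finite_reg

/-- By `end_unique` a marked point is determined by its string and its direction, and `card_point`
makes this injection a bijection. So each string has exactly one end of each direction, and closed
loops are excluded. -/
theorem Tight.bijective {T : Tangle n₀} (hT : T.Tight) :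
    Function.Bijective fun p : T.Point =>
      (T.str p.1 p.2, (⟨direction p.1 p.2, direction_lt _ _⟩ : Fin 2)) := by
  refine Function.Injective.bijective_of_nat_card_le ?_ ?_
  · rintro ⟨o, a⟩ ⟨o', a'⟩ h
    simp only [Prod.mk.injEq, Fin.mk.injEq] at h
    exact T.end_unique o a o' a' h.1 h.2
  · rw [hT.card_point, Nat.card_prod, Nat.card_fin, mul_comm]

/-- The marked points of a tight tangle correspond to the ends of its strings. -/
noncomputable def Tight.pointEquiv {T : Tangle n₀} (hT : T.Tight) : T.Point ≃ T.Str × Fin 2 :=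
  Equiv.ofBijective _ hT.bijective

theorem Tight.pointEquiv_apply {T : Tangle n₀} (hT : T.Tight) (p : T.Point) :
    hT.pointEquiv p = (T.str p.1 p.2, (⟨direction p.1 p.2, direction_lt _ _⟩ : Fin 2)) := rfl

theorem Tight.exists_point {T : Tangle n₀} (hT : T.Tight) (s : T.Str) :
    ∃ o a, T.str o a = s := by
  obtain ⟨p, hp⟩ := hT.bijective.2 (s, 0)
  exact ⟨p.1, p.2, congrArg Prod.fst hp⟩

theorem Tight.eq_of_cluster {T : Tangle n₀} (hT : T.Tight) {α : Type*} (f : Option T.Box → α)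
    (h : ∀ o o' a a', T.str o a = T.str o' a' → f o = f o') (o o' : Option T.Box) :
    f o = f o' := by
  have : Subsingleton (Quot fun o o' : Option T.Box => ∃ a a', T.str o a = T.str o' a') :=
    (Nat.card_eq_one_iff_unique.1 hT.cluster).1
  have h' : ∀ o o' : Option T.Box, (∃ a a', T.str o a = T.str o' a') → f o = f o' :=
    fun o o' ⟨a, a', e⟩ => h o o' a a' e
  exact congrArg (Quot.lift f h') (Subsingleton.elim (Quot.mk _ o) (Quot.mk _ o'))

theorem sum_castSucc_sub_succ (n : ℕ) (g : Fin (n + 1) → ℝ) :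
    ∑ a : Fin n, (g a.castSucc - g a.succ) = g 0 - g (Fin.last n) := by
  have h1 := Fin.sum_univ_succ g
  have h2 := Fin.sum_univ_castSucc g
  rw [Finset.sum_sub_distrib]
  linarith

/-- The kernel lies in the line of constant functions, so at most one dimension is lost. `D` need
not kill the constants and `X` may be empty; the inequality covers these cases too. -/
theorem finrank_range_of_ker_const {X Y : Type*} [Finite X] [Finite Y]
    (D : (X → ℝ) →ₗ[ℝ] (Y → ℝ)) (h : ∀ f, D f = 0 → ∀ x x', f x = f x') :
    Nat.card X ≤ Module.finrank ℝ (LinearMap.range D) + 1 := by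
  have := Fintype.ofFinite X
  have h1 := LinearMap.finrank_range_add_finrank_ker D
  rw [Module.finrank_fintype_fun_eq_card, ← Nat.card_eq_fintype_card] at h1
  have h2 : Module.finrank ℝ (LinearMap.ker D) ≤ 1 := by
    rcases isEmpty_or_nonempty X with hX | ⟨⟨x⟩⟩
    · have : Subsingleton (LinearMap.ker D) := inferInstance
      rw [Module.finrank_zero_of_subsingleton]
      exact zero_le_one
    · by_cases h0 : D (fun _ => 1) = 0
      · refine finrank_le_one ⟨fun _ => 1, h0⟩ fun ⟨f, hf⟩ => ⟨f x, ?_⟩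
        ext y
        simpa using h f hf x y
      · refine finrank_le_one 0 fun ⟨f, hf⟩ => ⟨0, ?_⟩
        have hc : f = f x • fun _ => (1 : ℝ) := by
          ext y
          simpa using h f hf y x
        have : f x = 0 := by
          rw [LinearMap.mem_ker, hc, map_smul] at hf
          exact (smul_eq_zero.1 hf).resolve_right h0
        rw [this, zero_smul] at hc
        ext y
        simp [hc]
  omega

/-- Euler's inequality: a family `F` of regions which is compatible with the strings of a tight
tangle has at most as many members as the tangle has regions. -/
theorem Tight.card_add_card_le {T : Tangle n₀} (hT : T.Tight) {F : Type*} [Finite F]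
    (φ : ∀ o, Fin (2 * (T.boxCol o).size + 1) → F) (w b : T.Str → F)
    (last : ∀ o, φ o (Fin.last _) = φ o 0)
    (even : ∀ o a, a.val % 2 = 0 → w (T.str o a) = φ o a.castSucc ∧ b (T.str o a) = φ o a.succ)
    (odd : ∀ o a, a.val % 2 = 1 → b (T.str o a) = φ o a.castSucc ∧ w (T.str o a) = φ o a.succ)
    (surj : ∀ f, ∃ o a, φ o a = f) :
    Nat.card T.Box + Nat.card F ≤ Nat.card T.Str + 1 := by
  classical
  have := Fintype.ofFinite T.Box
  have := Fintype.ofFinite T.Str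
  have := Fintype.ofFinite F
  let e := hT.pointEquiv
  -- `D` measures the jump of a function of regions across a string, `B` the difference of a
  -- function of boxes between the two ends of a string. Their ranges in the functions on strings
  -- are orthogonal and have dimensions at least `|F| - 1` and `|Box|`, which gives the inequality.
  let D : (F → ℝ) →ₗ[ℝ] (T.Str → ℝ) :=
    { toFun := fun f s => f (w s) - f (b s)
      map_add' := fun f g => by ext s; simp only [Pi.add_apply]; ring
      map_smul' := fun c f => by ext s; simp only [Pi.smul_apply, smul_eq_mul, RingHom.id_apply]; ring }
  let B : (Option T.Box → ℝ) →ₗ[ℝ] (T.Str → ℝ) :=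
    { toFun := fun f s => f (e.symm (s, 0)).1 - f (e.symm (s, 1)).1
      map_add' := fun f g => by ext s; simp only [Pi.add_apply]; ring
      map_smul' := fun c f => by ext s; simp only [Pi.smul_apply, smul_eq_mul, RingHom.id_apply]; ring }
  have hD := finrank_range_of_ker_const D (by
    intro f hf
    have h1 : ∀ s, f (w s) = f (b s) := fun s => sub_eq_zero.1 (congrFun hf s)
    -- A function without jumps is constant around each box, and boxes which share a string see a
    -- common region.
    have h2 : ∀ o a, f (φ o a) = f (φ o 0) := by
      intro o a
      induction a using Fin.induction with
      | zero => rfl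
      | succ a ih =>
        rw [← ih]
        rcases Nat.mod_two_eq_zero_or_one a.val with h | h
        · rw [← (even o a h).1, ← (even o a h).2, h1]
        · rw [← (odd o a h).1, ← (odd o a h).2, h1]
    have h3 : ∀ o a, f (w (T.str o a)) = f (φ o 0) := by
      intro o a
      rcases Nat.mod_two_eq_zero_or_one a.val with h | h
      · rw [(even o a h).1, h2]
      · rw [(odd o a h).2, h2]
    have h4 := hT.eq_of_cluster (fun o => f (φ o 0)) (by
      intro o o' a a' h
      rw [← h3 o a, ← h3 o' a', h])
    intro x x'
    obtain ⟨o, a, rfl⟩ := surj x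
    obtain ⟨o', a', rfl⟩ := surj x'
    rw [h2, h2 o', h4 o o'])
  have hB := finrank_range_of_ker_const B (by
    intro f hf
    refine hT.eq_of_cluster f ?_
    have h1 : ∀ s, f (e.symm (s, 0)).1 = f (e.symm (s, 1)).1 :=
      fun s => sub_eq_zero.1 (congrFun hf s)
    have h2 : ∀ o a, f o = f (e.symm (T.str o a, 0)).1 := by
      intro o a
      have h3 : e.symm (e ⟨o, a⟩) = ⟨o, a⟩ := e.symm_apply_apply _
      rw [show e ⟨o, a⟩ = _ from hT.pointEquiv_apply _] at h3
      generalize (⟨direction (⟨o, a⟩ : T.Point).1 (⟨o, a⟩ : T.Point).2, direction_lt _ _⟩ : Fin 2) =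
        d at h3
      have h4 : d = 0 ∨ d = 1 := by fin_cases d <;> simp
      rcases h4 with rfl | rfl
      · rw [h3]
      · rw [h1, h3]
    intro o o' a a' h
    rw [h2 o a, h2 o' a', h])
  -- The sum over string ends is rearranged box by box. At a fixed box `h` is a constant factor, and
  -- the jumps of `f` telescope around the boundary to zero because the first and the last interval
  -- touch the same region.
  have orth : ∀ f h, ∑ s, D f s * B h s = 0 := by
    intro f h
    have h1 : ∑ s, D f s * B h s =
        ∑ p : T.Str × Fin 2, D f p.1 * ((if p.2 = 0 then 1 else -1) * h (e.symm p).1) := by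
      rw [Fintype.sum_prod_type]
      refine Finset.sum_congr rfl fun s _ => ?_
      rw [Fin.sum_univ_two]
      simp only [B, LinearMap.coe_mk, AddHom.coe_mk]
      simp
      ring
    rw [h1, ← e.sum_comp, Fintype.sum_sigma]
    refine Finset.sum_eq_zero fun o _ => ?_
    -- Along the boundary of a box the direction of the string and the side on which its white
    -- region lies alternate together. The two signs cancel, and only a sign depending on whether
    -- the box is external is left.
    have h2 : ∀ a : Fin (2 * (T.boxCol o).size),
        D f (e ⟨o, a⟩).1 * ((if (e ⟨o, a⟩).2 = 0 then 1 else -1) * h (e.symm (e ⟨o, a⟩)).1) =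
        ((if o.isSome then -1 else 1) * h o) * (f (φ o a.castSucc) - f (φ o a.succ)) := by
      intro a
      rw [e.symm_apply_apply, show e ⟨o, a⟩ = _ from hT.pointEquiv_apply _]
      simp only [D, LinearMap.coe_mk, AddHom.coe_mk, Fin.ext_iff, direction, Fin.val_zero]
      rcases Nat.mod_two_eq_zero_or_one a.val with ha | ha
      · rw [(even o a ha).1, (even o a ha).2]
        cases o with
        | none => simp [ha]; ring
        | some i =>
          have : (1 + a.val) % 2 = 1 := by omega
          simp [this]; ring
      · rw [(odd o a ha).1, (odd o a ha).2]
        cases o with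
        | none => simp [ha]; ring
        | some i =>
          have : (1 + a.val) % 2 = 0 := by omega
          simp [this]; ring
    rw [Finset.sum_congr rfl fun a _ => h2 a, ← Finset.mul_sum,
      sum_castSucc_sub_succ _ fun a => f (φ o a), last, sub_self, mul_zero]
  -- A vector in both ranges is orthogonal to itself.
  have hdisj : Disjoint (LinearMap.range D) (LinearMap.range B) := by
    rw [Submodule.disjoint_def]
    rintro x ⟨f, rfl⟩ ⟨h, hx⟩
    have h1 := orth f h
    rw [hx] at h1
    ext s
    have h2 := (Finset.sum_eq_zero_iff_of_nonneg fun s _ => mul_self_nonneg (D f s)).1 h1 s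
      (Finset.mem_univ s)
    exact mul_self_eq_zero.1 h2
  have h5 := Submodule.finrank_add_finrank_le_of_disjoint hdisj
  rw [Module.finrank_fintype_fun_eq_card, ← Nat.card_eq_fintype_card] at h5
  rw [Finite.card_option] at hB
  omega

/-- Gluing a finite set along `Y` pairs leaves at least `|X| - |Y|` classes. -/
theorem card_le_card_quot_add {X Y : Type*} [Finite X] [Finite Y] (e₁ e₂ : Y → X)
    (R : X → X → Prop)
    (h : ∀ f : X → ℝ, (∀ y, f (e₁ y) = f (e₂ y)) → ∀ x x', R x x' → f x = f x') :
    Nat.card X ≤ Nat.card (Quot R) + Nat.card Y := by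
  have := Fintype.ofFinite X
  have := Fintype.ofFinite Y
  have : Finite (Quot R) := Finite.of_surjective (Quot.mk R) Quot.mk_surjective
  have := Fintype.ofFinite (Quot R)
  -- The kernel of `L` is cut out by `|Y|` linear equations, so it has dimension at least `|X| -
  -- |Y|`. By `h` its members descend to the quotient.
  let L : (X → ℝ) →ₗ[ℝ] (Y → ℝ) := LinearMap.funLeft ℝ ℝ e₁ - LinearMap.funLeft ℝ ℝ e₂
  have h1 := LinearMap.finrank_range_add_finrank_ker L
  have h2 : LinearMap.ker L ≤ LinearMap.range (LinearMap.funLeft ℝ ℝ (Quot.mk R)) := by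
    intro f hf
    exact ⟨Quot.lift f (h f fun y => sub_eq_zero.1 (congrFun hf y)), rfl⟩
  have h3 := (Submodule.finrank_mono h2).trans (LinearMap.finrank_range_le _)
  have h4 := Submodule.finrank_le (LinearMap.range L)
  rw [Module.finrank_fintype_fun_eq_card] at h1 h3 h4
  simp only [Nat.card_eq_fintype_card]
  omega

theorem eq_or_exists_of_eqvGen {α : Type*} {R : α → α → Prop} {x y : α}
    (h : Relation.EqvGen R x y) : x = y ∨ ((∃ z, R x z ∨ R z x) ∧ ∃ z, R y z ∨ R z y) := by
  induction h with
  | rel x y h => exact .inr ⟨⟨y, .inl h⟩, ⟨x, .inr h⟩⟩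
  | refl x => exact .inl rfl
  | symm x y _ ih => exact ih.imp Eq.symm And.symm
  | trans x y z _ _ ih1 ih2 =>
    rcases ih1 with rfl | ⟨h1, h2⟩
    · exact ih2
    · rcases ih2 with rfl | ⟨h3, h4⟩
      · exact .inr ⟨h1, h2⟩
      · exact .inr ⟨h1, h4⟩

/-- A positive external colour provides a string. By connectedness of the dual graph, a region is
either its white side or an end point of some edge of that graph, and the edges are strings. -/
theorem exists_side (T : Tangle n₀) (h : 0 < n₀.size) (r : T.Reg) :
    ∃ s, T.white s = r ∨ T.black s = r := by
  let s := T.str none ⟨0, show 0 < 2 * n₀.size by omega⟩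
  rcases eq_or_exists_of_eqvGen (T.connected r (T.white s)) with rfl | ⟨⟨z, h | h⟩, _⟩
  · exact ⟨s, .inl rfl⟩
  · obtain ⟨s, h, _⟩ := h
    exact ⟨s, .inl h⟩
  · obtain ⟨s, _, h⟩ := h
    exact ⟨s, .inr h⟩

end Tangle
end PlanarAlg

/-! ### Composites of tight tangles: the strings determine the regions -/

namespace PlanarAlg

namespace Tangle

variable {n₀ : Col}

theorem Tight.two_mul_card_str {T : Tangle n₀} (hT : T.Tight) [Fintype T.Box] :
    2 * Nat.card T.Str = 2 * n₀.size + ∑ i, 2 * (T.col i).size := by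
  rw [← hT.card_point, Nat.card_sigma, Fintype.sum_option]
  simp [allCol]

theorem Tight.card_box_add {T : Tangle n₀} (hT : T.Tight) :
    Nat.card T.Box + Nat.card T.Reg = Nat.card T.Str + 1 := by
  rw [T.euler, hT.cluster]

/-- The string at a marked point which is given by a natural number, if there is such a point. -/
def arc (T : Tangle n₀) (o : Option T.Box) (a : ℕ) : Option T.Str :=
  if h : a < 2 * (T.boxCol o).size then some (T.str o ⟨a, h⟩) else none

theorem arc_of_lt (T : Tangle n₀) (o : Option T.Box) {a : ℕ} (h : a < 2 * (T.boxCol o).size) :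
    T.arc o a = some (T.str o ⟨a, h⟩) := dif_pos h

theorem arc_val (T : Tangle n₀) (o : Option T.Box) (a : Fin (2 * (T.boxCol o).size)) :
    T.arc o a = some (T.str o a) := dif_pos a.2

theorem lt_of_arc_eq_some {T : Tangle n₀} {o : Option T.Box} {a : ℕ} {s : T.Str}
    (h : T.arc o a = some s) : a < 2 * (T.boxCol o).size := by
  by_contra h'
  rw [arc, dif_neg h'] at h
  cases h

variable (T : Tangle n₀) (S : ∀ i, Tangle (T.col i))

/-- The glued string at a marked point of a box of `T` (`none` for a point out of range). -/
def hostArc (o : Option T.Box) (a : ℕ) : Option (Quot (GlueStr T S)) :=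
  (T.arc o a).map fun s => Quot.mk _ (Sum.inl s)

/-- The glued string at a marked point of a box of the tangle `S i`. -/
def guestArc (i : T.Box) (o : Option (S i).Box) (a : ℕ) : Option (Quot (GlueStr T S)) :=
  ((S i).arc o a).map fun s => Quot.mk _ (Sum.inr ⟨i, s⟩)

/-- The glued string at a marked point of a box which remains after substitution. -/
def outerArc : Option (Σ i, (S i).Box) → ℕ → Option (Quot (GlueStr T S))
  | none => hostArc T S none
  | some ⟨i, j⟩ => guestArc T S i (some j)

variable {T S}

theorem hostArc_congr {o o' : Option T.Box} {a a' : ℕ} (h : T.arc o a = T.arc o' a') :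
    hostArc T S o a = hostArc T S o' a' := by
  rw [hostArc, h, hostArc]

theorem guestArc_congr {i : T.Box} {o o' : Option (S i).Box} {a a' : ℕ}
    (h : (S i).arc o a = (S i).arc o' a') : guestArc T S i o a = guestArc T S i o' a' := by
  rw [guestArc, h, guestArc]

/-- This is the gluing relation itself. Out of range both sides are `none`, so no bound on `a` is
needed. -/
theorem hostArc_some (i : T.Box) (a : ℕ) : hostArc T S (some i) a = guestArc T S i none a := by
  unfold hostArc guestArc arc
  by_cases h : a < 2 * (T.col i).size
  · rw [dif_pos (show a < 2 * (T.boxCol (some i)).size from h),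
      dif_pos (show a < 2 * ((S i).boxCol none).size from h)]
    exact congrArg some (Quot.sound (GlueStr.mk i ⟨a, h⟩))
  · rw [dif_neg (show ¬ a < 2 * (T.boxCol (some i)).size from h),
      dif_neg (show ¬ a < 2 * ((S i).boxCol none).size from h)]
    rfl

/-- If the strings of `U` are those which arise from substituting the tangles `S i` into `T`, and
all these tangles are tight, then `U` is the composite: planarity takes care of the regions. -/
theorem exists_composite {U : Tangle n₀} (hT : T.Tight) (hS : ∀ i, (S i).Tight) (hU : U.Tight)
    (h₀ : 0 < n₀.size) (hcol : ∀ i, 0 < (T.col i).size)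
    (box : (Σ i, (S i).Box) ≃ U.Box) (col_eq : ∀ j, U.col (box j) = (S j.1).col j.2)
    (trace : ∀ o a, a < 2 * (U.boxCol (o.map box)).size → ∃ o' a',
      direction o a ≠ direction o' a' ∧ U.arc (o.map box) a = U.arc (o'.map box) a' ∧
        outerArc T S o a = outerArc T S o' a')
    (reach : ∀ i a, a < 2 * (T.col i).size → ∃ o a',
      hostArc T S (some i) a = outerArc T S o a') :
    ∃ e : Composite T S U, e.box = box := by
  classical
  have := Fintype.ofFinite T.Box
  have := fun i => Fintype.ofFinite (S i).Box
  have := Fintype.ofFinite U.Box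
  have fX : Finite (T.Str ⊕ Σ i, (S i).Str) := inferInstance
  have fQ : Finite (Quot (GlueStr T S)) := Finite.of_surjective (Quot.mk _) Quot.mk_surjective
  have fR : Finite (Quot (GlueReg T S)) := Finite.of_surjective (Quot.mk _) Quot.mk_surjective
  have cT := hT.two_mul_card_str
  have cU := hU.two_mul_card_str
  have cS : ∑ i, 2 * Nat.card (S i).Str =
      ∑ i, 2 * (T.col i).size + ∑ i, ∑ j, 2 * ((S i).col j).size := by
    rw [← Finset.sum_add_distrib]
    exact Finset.sum_congr rfl fun i _ => (hS i).two_mul_card_str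
  have cU' : ∑ u, 2 * (U.col u).size = ∑ i, ∑ j, 2 * ((S i).col j).size := by
    rw [← box.sum_comp, Fintype.sum_sigma]
    simp only [col_eq]
  have cY : Nat.card (Σ i, Fin (2 * (T.col i).size)) = ∑ i, 2 * (T.col i).size := by
    rw [Nat.card_sigma]
    simp
  -- Each marked point of an internal box of `T` glues one pair of strings. The resulting lower
  -- bound for the number of glued strings is exactly the number of strings of `U`, by the count of
  -- marked points in `cstr`.
  have cQ := card_le_card_quot_add
    (fun y : Σ i, Fin (2 * (T.col i).size) => (Sum.inl (T.str (some y.1) y.2) :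
      T.Str ⊕ Σ i, (S i).Str))
    (fun y => Sum.inr ⟨y.1, (S y.1).str none y.2⟩) (GlueStr T S) (by
      rintro f h _ _ ⟨i, a⟩
      exact h ⟨i, a⟩)
  rw [Nat.card_sum, Nat.card_sigma, cY] at cQ
  rw [← Finset.mul_sum] at cS
  have cstr : Nat.card U.Str = Nat.card T.Str + ∑ i, Nat.card (S i).Str -
      ∑ i, 2 * (T.col i).size := by omega
  -- A box with `2 n` marked points has `2 n + 1` intervals, but the first and the last coincide, so
  -- `2 n` gluings of regions suffice. This uses `n > 0`. By Euler's formula the lower bound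
  -- obtained is the number of regions of `U`.
  have cR := card_le_card_quot_add
    (fun y : Σ i, Fin (2 * (T.col i).size) => (Sum.inl (T.gap (some y.1) y.2.castSucc) :
      T.Reg ⊕ Σ i, (S i).Reg))
    (fun y => Sum.inr ⟨y.1, (S y.1).gap none y.2.castSucc⟩) (GlueReg T S) (by
      rintro f h _ _ ⟨i, a⟩
      induction a using Fin.lastCases with
      | cast a => exact h ⟨i, a⟩
      | last =>
        have e1 := T.gap_last (some i)
        have e2 := (S i).gap_last none
        have h' := h ⟨i, ⟨0, by have := hcol i; omega⟩⟩
        exact (congrArg (fun r => f (Sum.inl r)) e1).trans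
          (h'.trans (congrArg (fun r => f (Sum.inr ⟨i, r⟩)) e2.symm)))
  rw [Nat.card_sum, Nat.card_sigma, cY] at cR
  have cS' : ∑ i, Nat.card (S i).Box + ∑ i, Nat.card (S i).Reg =
      ∑ i, Nat.card (S i).Str + Nat.card T.Box := by
    rw [← Finset.sum_add_distrib, Finset.sum_congr rfl fun i _ => (hS i).card_box_add,
      Finset.sum_add_distrib]
    simp
  have cB : Nat.card U.Box = ∑ i, Nat.card (S i).Box := by
    rw [← Nat.card_congr box, Nat.card_sigma]
  have eT := hT.card_box_add
  have eU := hU.card_box_add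
  have some_outer : ∀ (o : Option (Σ i, (S i).Box)) a, a < 2 * (U.boxCol (o.map box)).size →
      ∃ x, outerArc T S o a = some x := by
    intro o a ha
    match o with
    | none => exact ⟨_, congrArg (Option.map _) (arc_of_lt T none ha)⟩
    | some ⟨i, j⟩ =>
      have h1 : U.col (box ⟨i, j⟩) = (S i).col j := col_eq ⟨i, j⟩
      have h2 : a < 2 * ((S i).col j).size := by
        rw [← h1]; exact ha
      exact ⟨_, congrArg (Option.map _) (arc_of_lt (S i) (some j) h2)⟩
  have dir_box : ∀ (o : Option (Σ i, (S i).Box)) a, direction (o.map box) a = direction o a := by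
    rintro (_ | _) a <;> rfl
  -- Two points on one string of `U` lie on the same glued string. With equal directions they are
  -- the same point. Otherwise the mate given by `trace` lies on this string and has the direction
  -- of the second point, hence is the second point.
  have outer_congr : ∀ (o o' : Option (Σ i, (S i).Box)) a a',
      a < 2 * (U.boxCol (o.map box)).size →
      U.arc (o.map box) a = U.arc (o'.map box) a' → outerArc T S o a = outerArc T S o' a' := by
    intro o o' a a' ha h
    have unique : ∀ (o₁ o₂ : Option (Σ i, (S i).Box)) a₁ a₂ s,
        U.arc (o₁.map box) a₁ = some s → U.arc (o₂.map box) a₂ = some s →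
        direction o₁ a₁ = direction o₂ a₂ → outerArc T S o₁ a₁ = outerArc T S o₂ a₂ := by
      intro o₁ o₂ a₁ a₂ s h₁ h₂ hd
      have l₁ := lt_of_arc_eq_some h₁
      have l₂ := lt_of_arc_eq_some h₂
      rw [arc_of_lt U _ l₁, Option.some.injEq] at h₁
      rw [arc_of_lt U _ l₂, Option.some.injEq] at h₂
      have h3 := U.end_unique _ _ _ _ (h₁.trans h₂.symm) (by rw [dir_box, dir_box]; exact hd)
      obtain ⟨h4, h5⟩ := Sigma.mk.inj_iff.1 h3
      obtain rfl := Option.map_injective box.injective h4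
      have h6 := Fin.mk.inj_iff.1 (eq_of_heq h5)
      rw [h6]
    have hs := arc_of_lt U _ ha
    by_cases hd : direction o a = direction o' a'
    · exact unique o o' a a' _ hs (h ▸ hs) hd
    · obtain ⟨o'', a'', hd', h1, h2⟩ := trace o a ha
      rw [h2]
      refine unique o'' o' a'' a' _ (h1 ▸ hs) (h ▸ hs) ?_
      have := direction_lt o a
      have := direction_lt o' a'
      have := direction_lt o'' a''
      omega
  have exists_outer : ∀ s : U.Str, ∃ o a, U.arc (Option.map box o) a = some s := by
    intro s
    obtain ⟨o, a, rfl⟩ := hU.exists_point s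
    refine ⟨o.map box.symm, a, ?_⟩
    have : (o.map box.symm).map box = o := by cases o <;> simp
    rw [this]
    exact arc_val U o a
  have exists_class : ∀ s : U.Str, ∃ x : Quot (GlueStr T S), ∀ o a,
      U.arc (Option.map box o) a = some s → outerArc T S o a = some x := by
    intro s
    obtain ⟨o, a, h⟩ := exists_outer s
    have ha := lt_of_arc_eq_some h
    obtain ⟨x, hx⟩ := some_outer o a ha
    refine ⟨x, fun o' a' h' => ?_⟩
    rw [← hx]
    exact (outer_congr o o' a a' ha (h.trans h'.symm)).symm
  choose ψ hψ using exists_class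
  have of_outer : ∀ o a x, outerArc T S o a = some x → ∃ s,
      U.arc (Option.map box o) a = some s ∧ ψ s = x := by
    intro o a x h
    have ha : a < 2 * (U.boxCol (o.map box)).size := by
      match o with
      | none =>
        have h' : ∃ s, T.arc none a = some s ∧ _ = x := Option.map_eq_some_iff.1 h
        obtain ⟨s, h', _⟩ := h'
        have h2 : a < 2 * n₀.size := lt_of_arc_eq_some h'
        exact h2
      | some ⟨i, j⟩ =>
        have h' : ∃ s, (S i).arc (some j) a = some s ∧ _ = x := Option.map_eq_some_iff.1 h
        obtain ⟨s, h', _⟩ := h'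
        have h2 : a < 2 * ((S i).col j).size := lt_of_arc_eq_some h'
        have h1 : U.col (box ⟨i, j⟩) = (S i).col j := col_eq ⟨i, j⟩
        rw [← h1] at h2
        exact h2
    refine ⟨_, arc_of_lt U _ ha, Option.some.inj ?_⟩
    rw [← h]
    exact (hψ _ o a (arc_of_lt U _ ha)).symm
  have of_host : ∀ o a x, hostArc T S o a = some x → ∃ o a, outerArc T S o a = some x := by
    intro o a x h
    match o with
    | none => exact ⟨none, a, h⟩
    | some i =>
      have h' : ∃ s, T.arc (some i) a = some s ∧ _ = x := Option.map_eq_some_iff.1 h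
      obtain ⟨s, h', _⟩ := h'
      obtain ⟨o, a', h2⟩ := reach i a (lt_of_arc_eq_some h')
      exact ⟨o, a', h2.symm.trans h⟩
  -- Every string of `T` and of the `S i` has a marked point. If that point disappears in the
  -- gluing, `reach` moves along the glued string to one that remains; so no closed loop is created.
  have ψ_surj : Function.Surjective ψ := by
    intro x
    have key : ∃ o a, outerArc T S o a = some x := by
      induction x using Quot.ind with
      | mk x =>
        match x with
        | Sum.inl s =>
          obtain ⟨o, a, rfl⟩ := hT.exists_point s
          exact of_host o a _ (by rw [hostArc, arc_val]; rfl)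
        | Sum.inr ⟨i, s⟩ =>
          obtain ⟨o, a, rfl⟩ := (hS i).exists_point s
          match o, a with
          | some j, a =>
            exact ⟨some ⟨i, j⟩, a, by rw [outerArc, guestArc, arc_val]; rfl⟩
          | none, a =>
            refine of_host (some i) a _ ?_
            rw [hostArc_some, guestArc, arc_val]
            rfl
    obtain ⟨o, a, h⟩ := key
    obtain ⟨s, _, h⟩ := of_outer o a x h
    exact ⟨s, h⟩
  -- `cQ` and `cstr` say that there are at least as many glued strings as strings of `U`.
  have ψ_bij : Function.Bijective ψ := ψ_surj.bijective_of_nat_card_le (by omega)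
  let sideW : T.Str ⊕ (Σ i, (S i).Str) → Quot (GlueReg T S)
    | Sum.inl s => Quot.mk _ (Sum.inl (T.white s))
    | Sum.inr ⟨i, s⟩ => Quot.mk _ (Sum.inr ⟨i, (S i).white s⟩)
  let sideB : T.Str ⊕ (Σ i, (S i).Str) → Quot (GlueReg T S)
    | Sum.inl s => Quot.mk _ (Sum.inl (T.black s))
    | Sum.inr ⟨i, s⟩ => Quot.mk _ (Sum.inr ⟨i, (S i).black s⟩)
  have glue_gap : ∀ i (a : Fin (2 * (T.col i).size + 1)),
      (Quot.mk (GlueReg T S) (Sum.inl (T.gap (some i) a))) =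
        Quot.mk (GlueReg T S) (Sum.inr ⟨i, (S i).gap none a⟩) :=
    fun i a => Quot.sound (GlueReg.mk i a)
  have sideW_glue : ∀ x y, GlueStr T S x y → sideW x = sideW y := by
    rintro _ _ ⟨i, a⟩
    change Quot.mk (GlueReg T S) (Sum.inl (T.white _)) = Quot.mk (GlueReg T S) (Sum.inr ⟨i, (S i).white _⟩)
    rcases Nat.mod_two_eq_zero_or_one a.val with h | h
    · rw [(T.side_even (some i) a h).1, ((S i).side_even none a h).1]
      exact glue_gap i _
    · rw [(T.side_odd (some i) a h).2, ((S i).side_odd none a h).2]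
      exact glue_gap i _
  have sideB_glue : ∀ x y, GlueStr T S x y → sideB x = sideB y := by
    rintro _ _ ⟨i, a⟩
    change Quot.mk (GlueReg T S) (Sum.inl (T.black _)) = Quot.mk (GlueReg T S) (Sum.inr ⟨i, (S i).black _⟩)
    rcases Nat.mod_two_eq_zero_or_one a.val with h | h
    · rw [(T.side_even (some i) a h).2, ((S i).side_even none a h).2]
      exact glue_gap i _
    · rw [(T.side_odd (some i) a h).1, ((S i).side_odd none a h).1]
      exact glue_gap i _
  -- The two sides of a glued string are well defined as glued regions, because gluing at a marked
  -- point also glues the intervals before and after it.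
  let wQ : U.Str → Quot (GlueReg T S) := fun s => Quot.lift sideW sideW_glue (ψ s)
  let bQ : U.Str → Quot (GlueReg T S) := fun s => Quot.lift sideB sideB_glue (ψ s)
  have size_box : ∀ u, (U.col u).size = ((S (box.symm u).1).col (box.symm u).2).size := by
    intro u
    rw [← col_eq, box.apply_symm_apply]
  let φ : ∀ o, Fin (2 * (U.boxCol o).size + 1) → Quot (GlueReg T S)
    | none, a => Quot.mk _ (Sum.inl (T.gap none a))
    | some u, a => Quot.mk _ (Sum.inr ⟨(box.symm u).1, (S (box.symm u).1).gap
        (some (box.symm u).2) (a.cast (by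
          change 2 * (U.col u).size + 1 = 2 * ((S (box.symm u).1).col (box.symm u).2).size + 1
          rw [size_box]))⟩)
  have ψ_none : ∀ a, ψ (U.str none a) = Quot.mk _ (Sum.inl (T.str none a)) := by
    intro a
    have h := hψ (U.str none a) none a (arc_val U none a)
    have h' : outerArc T S none a = some (Quot.mk _ (Sum.inl (T.str none a))) :=
      congrArg (Option.map _) (arc_val T none a)
    exact (Option.some.inj (h'.symm.trans h)).symm
  have ψ_some : ∀ i j (a : Fin (2 * (U.boxCol (some (box ⟨i, j⟩))).size))
      (a' : Fin (2 * ((S i).col j).size)), a.val = a'.val →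
      ψ (U.str (some (box ⟨i, j⟩)) a) = Quot.mk _ (Sum.inr ⟨i, (S i).str (some j) a'⟩) := by
    intro i j a a' e
    have h := hψ (U.str (some (box ⟨i, j⟩)) a) (some ⟨i, j⟩) a (arc_val U (some (box ⟨i, j⟩)) a)
    have h' : outerArc T S (some ⟨i, j⟩) a' =
        some (Quot.mk _ (Sum.inr ⟨i, (S i).str (some j) a'⟩)) :=
      congrArg (Option.map _) (arc_val (S i) (some j) a')
    rw [e] at h
    exact (Option.some.inj (h'.symm.trans h)).symm
  have ψ_some' : ∀ u (a : Fin (2 * (U.boxCol (some u)).size))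
      (a' : Fin (2 * ((S (box.symm u).1).col (box.symm u).2).size)), a.val = a'.val →
      ψ (U.str (some u) a) = Quot.mk _ (Sum.inr ⟨(box.symm u).1,
        (S (box.symm u).1).str (some (box.symm u).2) a'⟩) := by
    intro u
    obtain ⟨v, rfl⟩ := box.surjective u
    rw [box.symm_apply_apply]
    exact ψ_some v.1 v.2
  have φ_some : ∀ i j (a : Fin (2 * (U.boxCol (some (box ⟨i, j⟩))).size + 1))
      (a' : Fin (2 * ((S i).col j).size + 1)), a.val = a'.val →
      φ (some (box ⟨i, j⟩)) a = Quot.mk _ (Sum.inr ⟨i, (S i).gap (some j) a'⟩) := by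
    intro i j a a' e
    -- `box.symm (box ⟨i, j⟩)` is only propositionally `⟨i, j⟩`, and the type of the interval
    -- depends on it. The claim is therefore proved for every index equal to `⟨i, j⟩`.
    have key : ∀ (v : Σ i, (S i).Box) (a'' : Fin (2 * ((S v.1).col v.2).size + 1)),
        v = ⟨i, j⟩ → a''.val = a'.val → (Quot.mk (GlueReg T S) (Sum.inr ⟨v.1,
          (S v.1).gap (some v.2) a''⟩)) = Quot.mk _ (Sum.inr ⟨i, (S i).gap (some j) a'⟩) := by
      rintro v a'' rfl h
      rw [Fin.ext h]
    exact key _ _ (box.symm_apply_apply _) e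
  have φ_last : ∀ o, φ o (Fin.last _) = φ o 0 := by
    intro o
    match o with
    | none => exact congrArg (fun r => Quot.mk (GlueReg T S) (Sum.inl r)) (T.gap_last none)
    | some u =>
      obtain ⟨⟨i, j⟩, rfl⟩ := box.surjective u
      rw [φ_some i j _ (Fin.last _) (by
          change 2 * (U.col (box ⟨i, j⟩)).size = 2 * ((S i).col j).size
          rw [col_eq]),
        φ_some i j _ 0 rfl]
      exact congrArg (fun r => Quot.mk (GlueReg T S) (Sum.inr ⟨i, r⟩)) ((S i).gap_last (some j))
  have φ_even : ∀ o a, a.val % 2 = 0 →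
      wQ (U.str o a) = φ o a.castSucc ∧ bQ (U.str o a) = φ o a.succ := by
    intro o a ha
    match o, a with
    | none, a =>
      simp only [wQ, bQ, ψ_none]
      exact ⟨congrArg (fun r => Quot.mk (GlueReg T S) (Sum.inl r)) (T.side_even none a ha).1,
        congrArg (fun r => Quot.mk (GlueReg T S) (Sum.inl r)) (T.side_even none a ha).2⟩
    | some u, a =>
      obtain ⟨⟨i, j⟩, rfl⟩ := box.surjective u
      have hlt : a.val < 2 * ((S i).col j).size := by
        have h : a.val < 2 * (U.col (box ⟨i, j⟩)).size := a.2
        rwa [col_eq] at h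
      simp only [wQ, bQ]
      rw [ψ_some i j a ⟨a, hlt⟩ rfl, φ_some i j _ (Fin.castSucc ⟨a, hlt⟩) rfl,
        φ_some i j _ (Fin.succ ⟨a, hlt⟩) rfl]
      have h := (S i).side_even (some j) ⟨a, hlt⟩ ha
      exact ⟨congrArg (fun r => Quot.mk (GlueReg T S) (Sum.inr ⟨i, r⟩)) h.1,
        congrArg (fun r => Quot.mk (GlueReg T S) (Sum.inr ⟨i, r⟩)) h.2⟩
  have φ_odd : ∀ o a, a.val % 2 = 1 →
      bQ (U.str o a) = φ o a.castSucc ∧ wQ (U.str o a) = φ o a.succ := by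
    intro o a ha
    match o, a with
    | none, a =>
      simp only [wQ, bQ, ψ_none]
      exact ⟨congrArg (fun r => Quot.mk (GlueReg T S) (Sum.inl r)) (T.side_odd none a ha).1,
        congrArg (fun r => Quot.mk (GlueReg T S) (Sum.inl r)) (T.side_odd none a ha).2⟩
    | some u, a =>
      obtain ⟨⟨i, j⟩, rfl⟩ := box.surjective u
      have hlt : a.val < 2 * ((S i).col j).size := by
        have h : a.val < 2 * (U.col (box ⟨i, j⟩)).size := a.2
        rwa [col_eq] at h
      simp only [wQ, bQ]
      rw [ψ_some i j a ⟨a, hlt⟩ rfl, φ_some i j _ (Fin.castSucc ⟨a, hlt⟩) rfl,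
        φ_some i j _ (Fin.succ ⟨a, hlt⟩) rfl]
      have h := (S i).side_odd (some j) ⟨a, hlt⟩ ha
      exact ⟨congrArg (fun r => Quot.mk (GlueReg T S) (Sum.inr ⟨i, r⟩)) h.1,
        congrArg (fun r => Quot.mk (GlueReg T S) (Sum.inr ⟨i, r⟩)) h.2⟩
  have exists_wb : ∀ x : Quot (GlueReg T S), ∃ s, wQ s = x ∨ bQ s = x := by
    intro x
    induction x using Quot.ind with
    | mk x =>
      match x with
      | Sum.inl r =>
        obtain ⟨s, h⟩ := exists_side T h₀ r
        obtain ⟨t, ht⟩ := ψ_surj (Quot.mk _ (Sum.inl s))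
        refine ⟨t, ?_⟩
        simp only [wQ, bQ, ht]
        exact h.imp (congrArg fun r => Quot.mk (GlueReg T S) (Sum.inl r))
          (congrArg fun r => Quot.mk (GlueReg T S) (Sum.inl r))
      | Sum.inr ⟨i, r⟩ =>
        obtain ⟨s, h⟩ := exists_side (S i) (hcol i) r
        obtain ⟨t, ht⟩ := ψ_surj (Quot.mk _ (Sum.inr ⟨i, s⟩))
        refine ⟨t, ?_⟩
        simp only [wQ, bQ, ht]
        exact h.imp (congrArg fun r => Quot.mk (GlueReg T S) (Sum.inr ⟨i, r⟩))
          (congrArg fun r => Quot.mk (GlueReg T S) (Sum.inr ⟨i, r⟩))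
  have side_gap : ∀ s : U.Str, ∃ o a a', (U.white s = U.gap o a ∧ wQ s = φ o a) ∧
      (U.black s = U.gap o a' ∧ bQ s = φ o a') := by
    intro s
    obtain ⟨o, a, rfl⟩ := hU.exists_point s
    rcases Nat.mod_two_eq_zero_or_one a.val with h | h
    · exact ⟨o, a.castSucc, a.succ, ⟨(U.side_even o a h).1, (φ_even o a h).1⟩,
        (U.side_even o a h).2, (φ_even o a h).2⟩
    · exact ⟨o, a.succ, a.castSucc, ⟨(U.side_odd o a h).2, (φ_odd o a h).2⟩,
        (U.side_odd o a h).1, (φ_odd o a h).1⟩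
  -- `F` is the common refinement of the regions of `U` and the glued regions: the pairs which occur
  -- at a common boundary interval. It is compatible with the strings of `U`, so Euler's inequality
  -- gives `|F| ≤ |U.Reg|`, while `cR` gives `|U.Reg| ≤ |Quot (GlueReg T S)|`. Both projections of
  -- `F` are onto, hence bijective.
  let F := {x : U.Reg × Quot (GlueReg T S) // ∃ o a, x = (U.gap o a, φ o a)}
  have hF := hU.card_add_card_le (F := F) (fun o a => ⟨(U.gap o a, φ o a), o, a, rfl⟩)
    (fun s => ⟨(U.white s, wQ s), by
      obtain ⟨o, a, _, h, _⟩ := side_gap s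
      exact ⟨o, a, Prod.ext h.1 h.2⟩⟩)
    (fun s => ⟨(U.black s, bQ s), by
      obtain ⟨o, _, a, _, h⟩ := side_gap s
      exact ⟨o, a, Prod.ext h.1 h.2⟩⟩)
    (fun o => Subtype.ext (Prod.ext (U.gap_last o) (φ_last o)))
    (fun o a h => ⟨Subtype.ext (Prod.ext (U.side_even o a h).1 (φ_even o a h).1),
      Subtype.ext (Prod.ext (U.side_even o a h).2 (φ_even o a h).2)⟩)
    (fun o a h => ⟨Subtype.ext (Prod.ext (U.side_odd o a h).1 (φ_odd o a h).1),
      Subtype.ext (Prod.ext (U.side_odd o a h).2 (φ_odd o a h).2)⟩)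
    (by
      rintro ⟨_, o, a, rfl⟩
      exact ⟨o, a, rfl⟩)
  have p1 : Function.Bijective fun x : F => x.1.1 := by
    refine Function.Surjective.bijective_of_nat_card_le ?_ (by omega)
    intro r
    obtain ⟨s, rfl | rfl⟩ := exists_side U h₀ r
    · obtain ⟨o, a, _, h, _⟩ := side_gap s
      exact ⟨⟨_, o, a, rfl⟩, h.1.symm⟩
    · obtain ⟨o, _, a, _, h⟩ := side_gap s
      exact ⟨⟨_, o, a, rfl⟩, h.1.symm⟩
  have p2 : Function.Bijective fun x : F => x.1.2 := by
    refine Function.Surjective.bijective_of_nat_card_le ?_ (by omega)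
    intro r
    obtain ⟨s, rfl | rfl⟩ := exists_wb r
    · obtain ⟨o, a, _, h, _⟩ := side_gap s
      exact ⟨⟨_, o, a, rfl⟩, h.2.symm⟩
    · obtain ⟨o, _, a, _, h⟩ := side_gap s
      exact ⟨⟨_, o, a, rfl⟩, h.2.symm⟩
  -- `F` is thus the graph of a bijection between glued regions and regions of `U`, which respects
  -- intervals and sides of strings.
  let θ : Quot (GlueReg T S) ≃ U.Reg :=
    (Equiv.ofBijective _ p2).symm.trans (Equiv.ofBijective _ p1)
  have θ_φ : ∀ o a, θ (φ o a) = U.gap o a := by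
    intro o a
    have : (Equiv.ofBijective _ p2).symm (φ o a) = (⟨(U.gap o a, φ o a), o, a, rfl⟩ : F) := by
      rw [Equiv.symm_apply_eq]
      rfl
    simp only [θ, Equiv.trans_apply, this]
    rfl
  have θ_w : ∀ s, θ (wQ s) = U.white s := by
    intro s
    obtain ⟨o, a, _, h, _⟩ := side_gap s
    rw [h.1, h.2, θ_φ]
  have θ_b : ∀ s, θ (bQ s) = U.black s := by
    intro s
    obtain ⟨o, _, a, _, h⟩ := side_gap s
    rw [h.1, h.2, θ_φ]
  let ψe := Equiv.ofBijective ψ ψ_bij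
  have ψe_symm : ∀ s x, ψ s = x → ψe.symm x = s := by
    rintro s _ rfl
    exact ψe.symm_apply_apply s
  have white_on : ∀ x, U.white (ψe.symm (Quot.mk _ x)) = θ (sideW x) := by
    intro x
    rw [← θ_w]
    simp only [wQ]
    rw [show ψ (ψe.symm (Quot.mk _ x)) = Quot.mk _ x from ψe.apply_symm_apply _]
  have black_on : ∀ x, U.black (ψe.symm (Quot.mk _ x)) = θ (sideB x) := by
    intro x
    rw [← θ_b]
    simp only [bQ]
    rw [show ψ (ψe.symm (Quot.mk _ x)) = Quot.mk _ x from ψe.apply_symm_apply _]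
  refine ⟨{
    box := box
    onStr := fun x => ψe.symm (Quot.mk _ x)
    onReg := fun x => θ (Quot.mk _ x)
    col_eq := col_eq
    onStr_surj := ψe.symm.surjective.comp Quot.mk_surjective
    onStr_eq_iff := fun s s' => by rw [ψe.symm.injective.eq_iff, Quot.eq]
    onReg_surj := θ.surjective.comp Quot.mk_surjective
    onReg_eq_iff := fun s s' => by rw [θ.injective.eq_iff, Quot.eq]
    str_ext := fun a => (ψe_symm _ _ (ψ_none a)).symm
    gap_ext := fun a => (θ_φ none a).symm
    str_int := fun j a a' h => (ψe_symm _ _ (ψ_some j.1 j.2 a' a h)).symm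
    gap_int := fun j a a' h => by rw [← φ_some j.1 j.2 a' a h]; exact (θ_φ _ _).symm
    white_inl := fun s => white_on _
    black_inl := fun s => black_on _
    white_inr := fun i s => white_on _
    black_inr := fun i s => black_on _
    -- The shading of a region can be read off from any string on its boundary.
    shade_inl := fun r => by
      obtain ⟨s, rfl | rfl⟩ := exists_side T h₀ r
      · rw [T.shade_white, ← U.shade_white]
        exact congrArg U.shade (white_on (Sum.inl s)).symm
      · rw [T.shade_black, ← U.shade_black]
        exact congrArg U.shade (black_on (Sum.inl s)).symm
    shade_inr := fun i r => by
      obtain ⟨s, rfl | rfl⟩ := exists_side (S i) (hcol i) r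
      · rw [(S i).shade_white, ← U.shade_white]
        exact congrArg U.shade (white_on (Sum.inr ⟨i, s⟩)).symm
      · rw [(S i).shade_black, ← U.shade_black]
        exact congrArg U.shade (black_on (Sum.inr ⟨i, s⟩)).symm }, rfl⟩

end Tangle
end PlanarAlg

/-! ### A counting criterion for tightness, and the strings of the standard tangles -/

namespace PlanarAlg

namespace Tangle

variable {n₀ : Col}

/-- The field `euler` contains the number of clusters where `h` has a `1`, so `h` forces a single
cluster. In `h'` the right-hand side is half the number of marked points. -/
theorem Tight.of_card {T : Tangle n₀} (_ : Fintype T.Box)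
    (h : Nat.card T.Box + Nat.card T.Reg = Nat.card T.Str + 1)
    (h' : Nat.card T.Str = n₀.size + ∑ i, (T.col i).size) : T.Tight := by
  refine ⟨by have := T.euler; omega, ?_⟩
  rw [Nat.card_sigma, Fintype.sum_option, h', mul_add, Finset.mul_sum]
  simp [allCol]

theorem arc_eq {T : Tangle n₀} {o o' : Option T.Box} {a a' : ℕ}
    (h : a < 2 * (T.boxCol o).size) (h' : a' < 2 * (T.boxCol o').size)
    (e : T.str o ⟨a, h⟩ = T.str o' ⟨a', h'⟩) : T.arc o a = T.arc o' a' := by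
  rw [arc_of_lt T o h, arc_of_lt T o' h', e]

/-! ### The standard tangles -/

theorem unit_tight (n : ℕ) : (unit (Col.ofNat n)).Tight := by
  refine Tight.of_card (inferInstanceAs (Fintype (Fin 0))) ?_ ?_
  · change Nat.card (Fin 0) + Nat.card (Fin (n + 1)) = Nat.card (Fin n) + 1
    simp
  · change Nat.card (Fin n) = n + ∑ i : Fin 0, (i.elim0 : Col).size
    simp

/-- Marked points are numbered clockwise, so the top point `a` lies above the bottom point `2 n - 1
- a`. The condition `a + a' + 1 = 2 n` expresses a vertical string here and in the lemmas below. -/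
theorem unit_arc (n : ℕ) {a a' : ℕ} (h : a + a' + 1 = 2 * n) :
    (unit (Col.ofNat n)).arc none a = (unit (Col.ofNat n)).arc none a' := by
  refine arc_eq (show a < 2 * n by omega) (show a' < 2 * n by omega) (Fin.ext ?_)
  change (if a < n then a else 2 * n - 1 - a) = (if a' < n then a' else 2 * n - 1 - a')
  split_ifs <;> omega

theorem identity_tight (n : ℕ) (hn : 0 < n) : (identity (Col.ofNat n)).Tight := by
  refine Tight.of_card (inferInstanceAs (Fintype (Fin 1))) ?_ ?_
  · change Nat.card (Fin 1) + Nat.card (Fin (2 * n - 1 + 1)) = Nat.card (Fin (2 * n)) + 1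
    simp only [Nat.card_eq_fintype_card, Fintype.card_fin]
    omega
  · change Nat.card (Fin (2 * n)) = n + ∑ i : Fin 1, n
    simp
    omega

theorem identity_arc (n : ℕ) {a : ℕ} (h : a < 2 * n) :
    (identity (Col.ofNat n)).arc none a = (identity (Col.ofNat n)).arc (some (0 : Fin 1)) a :=
  arc_eq (show a < 2 * n from h) (show a < 2 * n from h) rfl

theorem mult_tight (n : ℕ) (hn : 0 < n) : (mult (Col.ofNat n)).Tight := by
  refine Tight.of_card (inferInstanceAs (Fintype (Fin 2))) ?_ ?_
  · change Nat.card (Fin 2) + Nat.card (Fin (3 * n - 2 + 1)) = Nat.card (Fin (3 * n)) + 1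
    simp only [Nat.card_eq_fintype_card, Fintype.card_fin]
    omega
  · change Nat.card (Fin (3 * n)) = n + ∑ i : Fin 2, n
    simp
    omega

theorem mult_arc_top (n : ℕ) {a : ℕ} (h : a < n) :
    (mult (Col.ofNat n)).arc none a = (mult (Col.ofNat n)).arc (some (0 : Fin 2)) a := by
  refine arc_eq (show a < 2 * n by omega) (show a < 2 * n by omega) (Fin.ext ?_)
  change (if a < n then a else 2 * n + (2 * n - 1 - a)) =
    (if a < n then a else n + (2 * n - 1 - a))
  split_ifs; omega

theorem mult_arc_mid (n : ℕ) {a a' : ℕ} (h : a' < n) (h' : a + a' + 1 = 2 * n) :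
    (mult (Col.ofNat n)).arc (some (0 : Fin 2)) a =
      (mult (Col.ofNat n)).arc (some (1 : Fin 2)) a' := by
  refine arc_eq (show a < 2 * n by omega) (show a' < 2 * n by omega) (Fin.ext ?_)
  change (if a < n then a else n + (2 * n - 1 - a)) =
    (if a' < n then n + a' else 2 * n + (2 * n - 1 - a'))
  split_ifs <;> omega

theorem mult_arc_bot (n : ℕ) {a : ℕ} (h : n ≤ a) (h' : a < 2 * n) :
    (mult (Col.ofNat n)).arc (some (1 : Fin 2)) a = (mult (Col.ofNat n)).arc none a := by
  refine arc_eq (show a < 2 * n by omega) (show a < 2 * n by omega) (Fin.ext ?_)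
  change (if a < n then n + a else 2 * n + (2 * n - 1 - a)) =
    (if a < n then a else 2 * n + (2 * n - 1 - a))
  split_ifs <;> omega

theorem incl_tight (n k : ℕ) (hnk : n ≤ k) (hn : 0 < n) : (incl n k hnk).Tight := by
  refine Tight.of_card (inferInstanceAs (Fintype (Fin 1))) ?_ ?_
  · change Nat.card (Fin 1) + Nat.card (Fin (2 * n - 1 + 1 + (k - n))) =
      Nat.card (Fin (n + k)) + 1
    simp only [Nat.card_eq_fintype_card, Fintype.card_fin]
    omega
  · change Nat.card (Fin (n + k)) = k + ∑ i : Fin 1, n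
    simp
    omega

theorem incl_arc_left (n k : ℕ) (hnk : n ≤ k) {a : ℕ} (h : a < n) :
    (incl n k hnk).arc none a = (incl n k hnk).arc (some (0 : Fin 1)) a := by
  refine arc_eq (show a < 2 * k by omega) (show a < 2 * n by omega) (Fin.ext ?_)
  change inclStr n k a = a
  grind [inclStr]

theorem incl_arc_right (n k : ℕ) (hnk : n ≤ k) {a a' : ℕ} (h : n ≤ a) (h' : n ≤ a')
    (e : a + a' + 1 = 2 * k) : (incl n k hnk).arc none a = (incl n k hnk).arc none a' := by
  refine arc_eq (show a < 2 * k by omega) (show a' < 2 * k by omega) (Fin.ext ?_)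
  change inclStr n k a = inclStr n k a'
  grind [inclStr]

/-- In clockwise order the `2 (k - n)` ends of the vertical strings on the right come before the
bottom points on the left; they cause the shift. -/
theorem incl_arc_bot (n k : ℕ) (hnk : n ≤ k) {a a' : ℕ} (h : n ≤ a) (h' : a < 2 * n)
    (e : a' = a + 2 * (k - n)) :
    (incl n k hnk).arc none a' = (incl n k hnk).arc (some (0 : Fin 1)) a := by
  refine arc_eq (show a' < 2 * k by omega) (show a < 2 * n by omega) (Fin.ext ?_)
  change inclStr n k a' = a
  grind [inclStr]

theorem jones_tight (n : ℕ) (hn : 2 ≤ n) : (jones n hn).Tight := by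
  refine Tight.of_card (inferInstanceAs (Fintype (Fin 0))) ?_ ?_
  · change Nat.card (Fin 0) + Nat.card (Fin (n + 1)) = Nat.card (Fin n) + 1
    simp
  · change Nat.card (Fin n) = n + ∑ i : Fin 0, (i.elim0 : Col).size
    simp

theorem jones_arc (n : ℕ) (hn : 2 ≤ n) {a a' : ℕ}
    (h : (a < n - 2 ∧ a + a' + 1 = 2 * n) ∨ (a + 2 = n ∧ a' + 1 = n) ∨ (a = n ∧ a' = n + 1)) :
    (jones n hn).arc none a = (jones n hn).arc none a' := by
  refine arc_eq (show a < 2 * n by omega) (show a' < 2 * n by omega) (Fin.ext ?_)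
  change (if a < n - 2 then a else if a < n then n - 2 else if a < n + 2 then n - 1
      else 2 * n - 1 - a) = (if a' < n - 2 then a' else if a' < n then n - 2 else
      if a' < n + 2 then n - 1 else 2 * n - 1 - a')
  split_ifs <;> omega

theorem stack_tight (k n m b : ℕ) (hk : k = m + 1) (hn : n = m + b) (hb : 0 < b) :
    (stack k n m b hk hn hb).Tight := by
  refine Tight.of_card (inferInstanceAs (Fintype (Fin b))) ?_ ?_
  · change Nat.card (Fin b) + Nat.card (Unit ⊕ (Fin (b + 1) × Fin m) ⊕ Fin b) =
      Nat.card ((Fin (b + 1) × Fin m) ⊕ Fin (2 * b)) + 1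
    simp [Nat.card_eq_fintype_card]
    ring
  · change Nat.card ((Fin (b + 1) × Fin m) ⊕ Fin (2 * b)) = n + ∑ i : Fin b, k
    simp [Nat.card_eq_fintype_card, hk, hn]
    ring

section stack

variable (k n m b : ℕ) (hk : k = m + 1) (hn : n = m + b) (hb : 0 < b)

theorem stack_str_none (a : ℕ) (h : a < 2 * n) : (stack k n m b hk hn hb).str none ⟨a, h⟩ =
    (if h : a < m then .inl (0, ⟨a, h⟩)
      else if h' : a < m + 2 * b then .inr ⟨a - m, by omega⟩
      else .inl (Fin.last b, ⟨2 * n - 1 - a, by omega⟩) :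
        (Fin (b + 1) × Fin m) ⊕ Fin (2 * b)) := rfl

theorem stack_str_some (i : Fin b) (a : ℕ) (h : a < 2 * k) :
    (stack k n m b hk hn hb).str (some i) ⟨a, h⟩ =
    (if h : a < m then .inl (i.castSucc, ⟨a, h⟩)
      else if h' : a < m + 2 then .inr ⟨2 * i.val + (a - m), by omega⟩
      else .inl (i.succ, ⟨2 * k - 1 - a, by omega⟩) :
        (Fin (b + 1) × Fin m) ⊕ Fin (2 * b)) := rfl

theorem stack_arc_top (i : Fin b) {a : ℕ} (hi : i.val = 0) (h : a < m) :
    (stack k n m b hk hn hb).arc none a = (stack k n m b hk hn hb).arc (some i) a := by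
  refine arc_eq (show a < 2 * n by omega) (show a < 2 * k by omega) ?_
  rw [stack_str_none, stack_str_some]
  change @Eq ((Fin (b + 1) × Fin m) ⊕ Fin (2 * b)) _ _
  rw [dif_pos h, dif_pos h]
  congr 2
  exact Fin.ext hi.symm

/-- After the first `m` points of the external box come consecutive pairs of points, one pair for
each internal box from top to bottom. This places the box `i` at offset `2 i`. -/
theorem stack_arc_right (i : Fin b) {a a' : ℕ} (h : m ≤ a) (h' : a < m + 2)
    (e : a' = a + 2 * i.val) :
    (stack k n m b hk hn hb).arc none a' = (stack k n m b hk hn hb).arc (some i) a := by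
  have := i.2
  refine arc_eq (show a' < 2 * n by omega) (show a < 2 * k by omega) ?_
  rw [stack_str_none, stack_str_some]
  change @Eq ((Fin (b + 1) × Fin m) ⊕ Fin (2 * b)) _ _
  rw [dif_neg (by omega), dif_pos (by omega), dif_neg (by omega), dif_pos h']
  congr 2
  omega

theorem stack_arc_mid (i j : Fin b) {a a' : ℕ} (hij : i.val + 1 = j.val) (h : a' < m)
    (e : a + a' + 1 = 2 * k) :
    (stack k n m b hk hn hb).arc (some i) a = (stack k n m b hk hn hb).arc (some j) a' := by
  refine arc_eq (show a < 2 * k by omega) (show a' < 2 * k by omega) ?_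
  rw [stack_str_some, stack_str_some]
  change @Eq ((Fin (b + 1) × Fin m) ⊕ Fin (2 * b)) _ _
  rw [dif_neg (by omega), dif_neg (by omega), dif_pos h]
  congr 2
  · exact Fin.ext hij
  · exact Fin.ext (by dsimp only; omega)

theorem stack_arc_bot (i : Fin b) {a a' : ℕ} (hi : i.val + 1 = b) (h : m + 2 ≤ a) (h' : a < 2 * k)
    (e : a' = a + 2 * i.val) :
    (stack k n m b hk hn hb).arc none a' = (stack k n m b hk hn hb).arc (some i) a := by
  refine arc_eq (show a' < 2 * n by omega) (show a < 2 * k by omega) ?_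
  rw [stack_str_none, stack_str_some]
  change @Eq ((Fin (b + 1) × Fin m) ⊕ Fin (2 * b)) _ _
  rw [dif_neg (by omega), dif_neg (by omega), dif_neg (by omega),
    dif_neg (by omega)]
  congr 2
  · exact Fin.ext hi.symm
  · exact Fin.ext (by dsimp only; omega)

end stack

end Tangle
end PlanarAlg

namespace PlanarAlg

namespace Tangle

/-! ### A tangle with one box and a cap -/

/-- The tangle with one internal box of colour `n`, in which the marked points `c` and `c + 1` of
the external box are joined to each other, and the other ones to those of the internal box. -/
def cap (n c : ℕ) (hn : 0 < n) (hc : c ≤ 2 * n) : Tangle (Col.ofNat (n + 1)) :=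
  ofCode (Col.ofNat (n + 1)) 1 (fun _ => Col.ofNat n) (2 * n + 1) (2 * n + 1)
    (fun o a => match o with
      | none => if a < c then a else if a < c + 2 then 2 * n else a - 2
      | some _ => a)
    (fun o a => match o with
      | none => if a ≤ c then (if a = 2 * n then 0 else a) else if a = c + 1 then 2 * n
          else if a = 2 * n + 2 then 0 else a - 2
      | some _ => if a = 2 * n then 0 else a)
    (fun s => if s < 2 * n then s else if c = 2 * n then 0 else c)
    (fun s => if s + 1 = 2 * n then 0 else if s < 2 * n then s + 1 else 2 * n)
    -- The numbers below `2 n` are inherited from the internal box. The string `2 n` is the cap and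
    -- the region `2 n` is the one which it cuts off; this region is seen only at the interval `c +
    -- 1` of the external box, whence its parity.
    (fun r => if r < 2 * n then r else c + 1) false
    (by rintro (_ | i) a h <;> dsimp only [allCol, Col.ofNat] at * <;> grind)
    (by rintro (_ | i) a h <;> dsimp only [allCol, Col.ofNat] at * <;> grind)
    (by grind) (by grind)
    (fun _ => rfl)
    (by rintro (_ | i) <;> rfl)
    (by rintro (_ | i) a h
        · dsimp only [allCol, Col.ofNat] at *
          by_cases h1 : a < c
          · refine ⟨some 0, a, by dsimp only; omega, by grind, ?_⟩
            simp [direction]; omega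
          · by_cases h2 : a < c + 2
            · refine ⟨none, 2 * c + 1 - a, by dsimp only; omega, by grind, ?_⟩
              simp [direction]; omega
            · refine ⟨some 0, a - 2, by dsimp only; omega, by grind, ?_⟩
              simp [direction]; omega
        · dsimp only [allCol, Col.ofNat] at *
          by_cases h1 : a < c
          · refine ⟨none, a, by dsimp only; omega, by grind, ?_⟩
            simp [direction]; omega
          · refine ⟨none, a + 2, by dsimp only; omega, by grind, ?_⟩
            simp [direction]; omega)
    (by rintro (_ | i) a (_ | i') a' h h' he hd <;> dsimp only [allCol, Col.ofNat] at * <;>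
          simp [direction] at hd
        · exact ⟨rfl, by grind⟩
        · grind
        · grind
        · exact ⟨by rw [Subsingleton.elim i i'], he⟩)
    (by rintro (_ | i) <;> dsimp only [allCol, Col.ofNat] at * <;> grind)
    (by grind)
    (by rintro (_ | i) a h <;> dsimp only [allCol, Col.ofNat] at * <;> grind)
    (by rintro (_ | i) a h <;> dsimp only [allCol, Col.ofNat] at * <;> grind)
    (by intro x h h'
        refine ⟨if x < 2 * n then x - 1 else x, ?_⟩
        grind)
    (.inl ⟨by omega, fun i => by
        dsimp only [Col.ofNat]
        by_cases hc0 : c = 0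
        · exact ⟨0, 2, by omega, by omega, by grind⟩
        · exact ⟨0, 0, by omega, by omega, by grind⟩⟩)

section cap

variable (n c : ℕ) (hn : 0 < n) (hc : c ≤ 2 * n)

theorem cap_tight : (cap n c hn hc).Tight := by
  refine Tight.of_card (inferInstanceAs (Fintype (Fin 1))) ?_ ?_
  · change Nat.card (Fin 1) + Nat.card (Fin (2 * n + 1)) = Nat.card (Fin (2 * n + 1)) + 1
    simp only [Nat.card_eq_fintype_card, Fintype.card_fin]
    omega
  · change Nat.card (Fin (2 * n + 1)) = n + 1 + ∑ i : Fin 1, n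
    simp
    omega

theorem cap_arc {a a' : ℕ} (h : a < 2 * n) (h' : (a < c ∧ a' = a) ∨ (c ≤ a ∧ a' = a + 2)) :
    (cap n c hn hc).arc none a' = (cap n c hn hc).arc (some (0 : Fin 1)) a := by
  refine arc_eq (show a' < 2 * (n + 1) by omega) (show a < 2 * n by omega) (Fin.ext ?_)
  change (if a' < c then a' else if a' < c + 2 then 2 * n else a' - 2) = a
  split_ifs <;> omega

theorem cap_arc_cap : (cap n c hn hc).arc none c = (cap n c hn hc).arc none (c + 1) := by
  refine arc_eq (show c < 2 * (n + 1) by omega) (show c + 1 < 2 * (n + 1) by omega) (Fin.ext ?_)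
  change (if c < c then c else if c < c + 2 then 2 * n else c - 2) =
    (if c + 1 < c then c + 1 else if c + 1 < c + 2 then 2 * n else c + 1 - 2)
  split_ifs <;> omega

end cap

/-! ### Tangles with several boxes -/

/-- A box in the middle of a chain may have no string to the external box. Passing to earlier boxes
repeatedly still ends at the external one. -/
theorem card_quot_eq_one_of_descent {b : ℕ} {R : Option (Fin b) → Option (Fin b) → Prop}
    (h : ∀ i, R (some i) none ∨ ∃ j < i, R (some i) (some j)) : Nat.card (Quot R) = 1 := by
  have key : ∀ n (i : Fin b), i.val = n → Quot.mk R (some i) = Quot.mk R none := by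
    intro n
    induction n using Nat.strong_induction_on with
    | _ n ih =>
      rintro i rfl
      rcases h i with h | ⟨j, hj, h⟩
      · exact Quot.sound h
      · exact (Quot.sound h).trans (ih j.val hj j rfl)
  have all : ∀ q : Quot R, q = Quot.mk R none := by
    intro q
    induction q using Quot.ind with
    | mk o =>
      cases o with
      | none => rfl
      | some i => exact key _ i rfl
  rw [Nat.card_eq_one_iff_unique]
  exact ⟨⟨fun x y => (all x).trans (all y).symm⟩, ⟨Quot.mk R none⟩⟩

/-- A variant of `ofCode` for tangles of positive colours without closed strings, in which each
internal box shares a string with the external box or with a previous box. -/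
def ofLinkedCode (N b : ℕ) (col : Fin b → ℕ) (s r : ℕ) (str gap : Option (Fin b) → ℕ → ℕ)
    (left right parity : ℕ → ℕ)
    (str_lt : ∀ o a, a < 2 * (o.elim N col) → str o a < s)
    (gap_lt : ∀ o a, a ≤ 2 * (o.elim N col) → gap o a < r)
    (left_lt : ∀ x, x < s → left x < r) (right_lt : ∀ x, x < s → right x < r)
    (exists_end : ∀ o a, a < 2 * (o.elim N col) → ∃ o' a',
      a' < 2 * (o'.elim N col) ∧ str o' a' = str o a ∧ direction o' a' ≠ direction o a)
    (end_unique : ∀ o a o' a', a < 2 * (o.elim N col) → a' < 2 * (o'.elim N col) →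
      str o a = str o' a' → direction o a = direction o' a' → o = o' ∧ a = a')
    (ends : ∀ x, x < s → ∃ o a, a < 2 * (o.elim N col) ∧ str o a = x)
    (gap_last : ∀ o, gap o (2 * (o.elim N col)) = gap o 0)
    (parity_gap : ∀ o a, a ≤ 2 * (o.elim N col) → parity (gap o a) % 2 = a % 2)
    (side : ∀ o a, a < 2 * (o.elim N col) →
      (left (str o a) = gap o a ∧ right (str o a) = gap o (a + 1)) ∨
      (left (str o a) = gap o (a + 1) ∧ right (str o a) = gap o a))
    (gap_zero : ∀ o, gap o 0 = 0)
    (gap_surj : ∀ x, x < r → ∃ o a, a ≤ 2 * (o.elim N col) ∧ gap o a = x)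
    (euler : b + r = s + 1)
    (link : ∀ i, ∃ a, a < 2 * col i ∧ ((∃ a' < 2 * N, str (some i) a = str none a') ∨
      ∃ j < i, ∃ a' < 2 * col j, str (some i) a = str (some j) a')) :
    Tangle (Col.ofNat N) :=
  have size_eq : ∀ o : Option (Fin b),
      (allCol (Col.ofNat N) (fun i => Col.ofNat (col i)) o).size = o.elim N col := by
    rintro (_ | i) <;> rfl
  -- Since every string ends somewhere, its two sides are consecutive intervals of some box, and
  -- these have opposite parities.
  have parity_side : ∀ x, x < s → parity (left x) % 2 ≠ parity (right x) % 2 := by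
    intro x hx
    obtain ⟨o, a, ha, rfl⟩ := ends x hx
    have h2 := parity_gap o a ha.le
    have h3 := parity_gap o (a + 1) ha
    rcases side o a ha with ⟨h4, h5⟩ | ⟨h4, h5⟩ <;> rw [h4, h5] <;> omega
  { Box := Fin b
    col := fun i => Col.ofNat (col i)
    Str := Fin s
    Reg := Fin r
    finite_box := inferInstance
    finite_str := inferInstance
    finite_reg := inferInstance
    str := fun o a => ⟨str o a, str_lt o a (size_eq o ▸ a.2)⟩
    gap := fun o a => ⟨gap o a, gap_lt o a (size_eq o ▸ Nat.le_of_lt_succ a.2)⟩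
    white := fun x => ⟨if parity (left x) % 2 = 0 then left x else right x, by
      have := left_lt x x.2
      have := right_lt x x.2
      split_ifs <;> assumption⟩
    black := fun x => ⟨if parity (left x) % 2 = 0 then right x else left x, by
      have := left_lt x x.2
      have := right_lt x x.2
      split_ifs <;> assumption⟩
    shade := fun x => decide (parity x % 2 = 1)
    exists_end := fun o a => by
      obtain ⟨o', a', h, h1, h2⟩ := exists_end o a (size_eq o ▸ a.2)
      exact ⟨o', ⟨a', by rw [size_eq]; exact h⟩, Fin.ext h1, h2⟩
    end_unique := fun o a o' a' h hd => by
      obtain ⟨h1, h2⟩ := end_unique o a o' a' (size_eq o ▸ a.2) (size_eq o' ▸ a'.2)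
        (congrArg Fin.val h) hd
      subst h1
      obtain rfl := Fin.ext h2
      rfl
    gap_last := fun o => Fin.ext (by
      have := gap_last o
      rw [← size_eq] at this
      exact this)
    shade_white := fun x => by
      have := parity_side x x.2
      rw [decide_eq_false_iff_not]
      dsimp only
      split_ifs <;> omega
    shade_black := fun x => by
      have := parity_side x x.2
      rw [decide_eq_true_iff]
      dsimp only
      split_ifs <;> omega
    shade_gap := fun o a => by
      have h : (allCol (Col.ofNat N) (fun i => Col.ofNat (col i)) o).shaded = false := by
        cases o <;> rfl
      rw [h, Bool.false_xor]
      dsimp only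
      rw [parity_gap o a (size_eq o ▸ Nat.le_of_lt_succ a.2)]
    side_even := fun o a ha => by
      have h0 : a.val < 2 * (o.elim N col) := size_eq o ▸ a.2
      have h1 := side o a h0
      have h2 := parity_gap o a h0.le
      have h3 := parity_gap o (a + 1) h0
      constructor <;> apply Fin.ext <;> dsimp only [Fin.val_castSucc, Fin.val_succ] <;>
        rcases h1 with ⟨h4, h5⟩ | ⟨h4, h5⟩ <;> rw [h4, h5] <;> split_ifs <;> first | rfl | omega
    side_odd := fun o a ha => by
      have h0 : a.val < 2 * (o.elim N col) := size_eq o ▸ a.2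
      have h1 := side o a h0
      have h2 := parity_gap o a h0.le
      have h3 := parity_gap o (a + 1) h0
      constructor <;> apply Fin.ext <;> dsimp only [Fin.val_castSucc, Fin.val_succ] <;>
        rcases h1 with ⟨h4, h5⟩ | ⟨h4, h5⟩ <;> rw [h4, h5] <;> split_ifs <;> first | rfl | omega
    connected := by
      -- Walking along the boundary of a box from the interval `a` back to the interval `0` crosses
      -- one string at each step and ends in the region `0`, which touches `*` of every box.
      have key : ∀ o a (ha : a ≤ 2 * (o.elim N col)) (h : 0 < r), Relation.EqvGen
          (fun q q' : Fin r => ∃ x : Fin s,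
            (⟨if parity (left x) % 2 = 0 then left x else right x, by
              have := left_lt x x.2
              have := right_lt x x.2
              split_ifs <;> assumption⟩ : Fin r) = q ∧
            (⟨if parity (left x) % 2 = 0 then right x else left x, by
              have := left_lt x x.2
              have := right_lt x x.2
              split_ifs <;> assumption⟩ : Fin r) = q')
          ⟨gap o a, gap_lt o a ha⟩ ⟨0, h⟩ := by
        intro o a ha h
        induction a with
        | zero => simp only [gap_zero]; exact .refl _
        | succ a ih =>
          refine .trans _ _ _ ?_ (ih (by omega))
          have hs := side o a ha
          have hp := parity_gap o a (by omega)
          have hp' := parity_gap o (a + 1) ha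
          by_cases h0 : a % 2 = 0
          · refine .symm _ _ (.rel _ _ ⟨⟨str o a, str_lt o a ha⟩, ?_⟩)
            simp only [Fin.mk.injEq]
            rcases hs with ⟨h1, h2⟩ | ⟨h1, h2⟩ <;> rw [h1, h2] <;> split_ifs <;> omega
          · refine .rel _ _ ⟨⟨str o a, str_lt o a ha⟩, ?_⟩
            simp only [Fin.mk.injEq]
            rcases hs with ⟨h1, h2⟩ | ⟨h1, h2⟩ <;> rw [h1, h2] <;> split_ifs <;> omega
      rintro ⟨x, hx⟩ ⟨x', hx'⟩
      obtain ⟨o, a, ha, rfl⟩ := gap_surj x hx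
      obtain ⟨o', a', ha', rfl⟩ := gap_surj x' hx'
      exact .trans _ _ _ (key o a ha (by omega)) (.symm _ _ (key o' a' ha' (by omega)))
    euler := by
      rw [card_quot_eq_one_of_descent]
      · simpa using euler
      · intro i
        obtain ⟨a, ha, ⟨a', ha', h⟩ | ⟨j, hj, a', ha', h⟩⟩ := link i
        · exact .inl ⟨⟨a, ha⟩, ⟨a', ha'⟩, Fin.ext h⟩
        · exact .inr ⟨j, hj, ⟨a, ha⟩, ⟨a', ha'⟩, Fin.ext h⟩ }

end Tangle
end PlanarAlg

namespace PlanarAlg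

namespace Tangle

/-! ### Chains of two and of three boxes -/

/-- Auxiliary for `pair` and `triple`: the region at the interval `a` of the first box, where `j`
is the region between its strings to the external box and those to the next box. -/
def firstGap (p r j a : ℕ) : ℕ :=
  if a < p then a else if a = p then j else if a < p + r then p - 1 + (p + r - a) else 0

/-- Auxiliary for `pair` and `triple`: the region at the interval `a` of a box whose first `r`
marked points are joined to a box with regions `prev` at the last `r` of its `N` marked points; the
regions at its remaining `q` marked points are numbered from `base + 1` on. -/
def nextGap (prev : ℕ → ℕ) (N r q base a : ℕ) : ℕ :=
  if a ≤ r then prev (N - a) else if a < r + q then base + (r + q - a) else 0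

/-- Auxiliary for `pair`: the regions at the first box. -/
def pairGap₀ (p q r : ℕ) : ℕ → ℕ := firstGap p r (if q = 0 then 0 else p + r + q - 2)

/-- Auxiliary for `pair`: the regions at the second box. -/
def pairGap₁ (p q r : ℕ) : ℕ → ℕ := nextGap (pairGap₀ p q r) (p + r) r q (p + r - 2)

/-- Auxiliary for `pair`: the shading of a region. -/
def pairParity (p q r x : ℕ) : ℕ :=
  if x < p then x else if x < p + r - 1 then p + r - (x - (p - 1))
    else if x < p + r + q - 2 then r + q - (x - (p + r - 2)) else p

section

variable {p q r : ℕ}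

theorem pairGap₀_lt (hp : 0 < p) (hr : 0 < r) (a : ℕ) : pairGap₀ p q r a < p + r + q - 1 := by
  unfold pairGap₀ firstGap
  split_ifs <;> omega

theorem pairGap₁_lt (hp : 0 < p) (hr : 0 < r) (a : ℕ) : pairGap₁ p q r a < p + r + q - 1 := by
  have := pairGap₀_lt (q := q) hp hr (p + r - a)
  unfold pairGap₁ nextGap
  split_ifs <;> omega

theorem pairGap₁_of_le {a : ℕ} (h : a ≤ r) : pairGap₁ p q r a = pairGap₀ p q r (p + r - a) :=
  if_pos h

theorem pairGap₀_zero (hp : 0 < p) : pairGap₀ p q r 0 = 0 := if_pos hp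

theorem pairGap₀_last (hr : 0 < r) : pairGap₀ p q r (p + r) = 0 := by
  unfold pairGap₀ firstGap
  split_ifs <;> omega

theorem pairGap₁_last : pairGap₁ p q r (r + q) = 0 := by
  unfold pairGap₁ nextGap pairGap₀ firstGap
  split_ifs <;> omega

/-- Along the strings between two boxes the intervals of one are numbered against those of the
other. The parities agree because the number of marked points of each box is even. -/
theorem pairParity_pairGap₀ (hp : 0 < p) (hr : 0 < r) (h₀ : (p + r) % 2 = 0)
    (h₁ : (r + q) % 2 = 0) {a : ℕ} (ha : a ≤ p + r) :
    pairParity p q r (pairGap₀ p q r a) % 2 = a % 2 := by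
  unfold pairGap₀ firstGap
  split_ifs <;> unfold pairParity <;> split_ifs <;> omega

theorem pairParity_pairGap₁ (hp : 0 < p) (hr : 0 < r) (h₀ : (p + r) % 2 = 0)
    (h₁ : (r + q) % 2 = 0) {a : ℕ} (ha : a ≤ r + q) :
    pairParity p q r (pairGap₁ p q r a) % 2 = a % 2 := by
  unfold pairGap₁ nextGap
  split_ifs
  · rw [pairParity_pairGap₀ hp hr h₀ h₁ (by omega)]
    omega
  · unfold pairParity
    split_ifs <;> omega
  · unfold pairParity
    split_ifs <;> omega

end

/-- The tangle with two internal boxes `0` and `1` and strings joining `p` marked points of the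
external box and the box `0`, `r` marked points of the boxes `0` and `1`, and `q` marked points of
the box `1` and the external box. -/
def pair (n n' N p q r : ℕ) (h₀ : p + r = 2 * n) (h₁ : r + q = 2 * n') (hN : p + q = 2 * N)
    (hp : 0 < p) (hr : 0 < r) : Tangle (Col.ofNat N) :=
  -- The regions `0, …, p - 1` lie at the strings to the first box, followed by the regions between
  -- the `r` and then between the `q` strings. The region to the right of everything comes last,
  -- unless `q = 0`, when it merges with the left-most region `0`.
  ofLinkedCode N 2 (fun i => if i = 0 then n else n') (p + r + q) (p + r + q - 1)
    (fun o a => match o with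
      | none => if a < p then a else a + r
      | some 0 => a
      | some 1 => if a < r then p + r - 1 - a else p + a)
    (fun o a => match o with
      | none => if a ≤ p then pairGap₀ p q r a else pairGap₁ p q r (r + a - p)
      | some 0 => pairGap₀ p q r a
      | some 1 => pairGap₁ p q r a)
    (fun s => if s < p + r then pairGap₀ p q r s else pairGap₁ p q r (s - p))
    (fun s => if s < p + r then pairGap₀ p q r (s + 1) else pairGap₁ p q r (s - p + 1))
    (pairParity p q r)
    (by rintro (_ | i) a h
        · dsimp only [Option.elim] at *; grind
        · fin_cases i <;> dsimp [Option.elim] at * <;> grind)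
    (by rintro (_ | i) a h
        · dsimp only
          split_ifs
          · exact pairGap₀_lt hp hr _
          · exact pairGap₁_lt hp hr _
        · fin_cases i
          · exact pairGap₀_lt hp hr _
          · exact pairGap₁_lt hp hr _)
    (by intro x _
        split_ifs
        · exact pairGap₀_lt hp hr _
        · exact pairGap₁_lt hp hr _)
    (by intro x _
        split_ifs
        · exact pairGap₀_lt hp hr _
        · exact pairGap₁_lt hp hr _)
    (by rintro (_ | i) a h
        · dsimp only [Option.elim] at *
          by_cases h1 : a < p
          · refine ⟨some 0, a, by simp; omega, by grind, ?_⟩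
            simp [direction]; omega
          · refine ⟨some 1, a + r - p, by simp; omega, by grind, ?_⟩
            simp [direction]; omega
        · fin_cases i <;> simp at h
          · by_cases h1 : a < p
            · refine ⟨none, a, by simp; omega, by grind, ?_⟩
              simp [direction]; omega
            · refine ⟨some 1, p + r - 1 - a, by simp; omega, by grind, ?_⟩
              simp [direction]; omega
          · by_cases h1 : a < r
            · refine ⟨some 0, p + r - 1 - a, by simp; omega, by grind, ?_⟩
              simp [direction]; omega
            · refine ⟨none, p + a - r, by simp; omega, by grind, ?_⟩
              simp [direction]; omega)
    (by rintro (_ | i) a (_ | i') a' h h' he hd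
        · dsimp only [Option.elim] at *; simp only [direction] at hd; grind
        · fin_cases i' <;> dsimp [Option.elim] at * <;> simp [direction] at hd <;> grind
        · fin_cases i <;> dsimp [Option.elim] at * <;> simp [direction] at hd <;> grind
        · fin_cases i <;> fin_cases i' <;> dsimp [Option.elim] at * <;>
            simp [direction] at hd <;> grind)
    (by intro x h
        by_cases h1 : x < p + r
        · exact ⟨some 0, x, by simp; omega, rfl⟩
        · exact ⟨some 1, x - p, by simp; omega, by grind⟩)
    (by rintro (_ | i)
        · dsimp only [Option.elim]
          simp only [← hN, if_pos (Nat.zero_le p), pairGap₀_zero hp]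
          split_ifs with h
          · rw [show q = 0 by omega]
            unfold pairGap₀ firstGap
            split_ifs <;> omega
          · rw [show r + (p + q) - p = r + q by omega, pairGap₁_last]
        · fin_cases i
          · change pairGap₀ p q r (2 * n) = pairGap₀ p q r 0
            rw [← h₀, pairGap₀_last hr, pairGap₀_zero hp]
          · change pairGap₁ p q r (2 * n') = pairGap₁ p q r 0
            rw [← h₁, pairGap₁_last, pairGap₁_of_le (Nat.zero_le _)]
            exact (pairGap₀_last hr).symm)
    (by rintro (_ | i) a h
        · dsimp only [Option.elim] at *
          split_ifs
          · exact pairParity_pairGap₀ hp hr (by omega) (by omega) (by omega)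
          · rw [pairParity_pairGap₁ hp hr (by omega) (by omega) (by omega)]
            omega
        · fin_cases i
          · change a ≤ 2 * n at h
            exact pairParity_pairGap₀ hp hr (by omega) (by omega) (by omega)
          · change a ≤ 2 * n' at h
            exact pairParity_pairGap₁ hp hr (by omega) (by omega) (by omega))
    (by rintro (_ | i) a h
        · dsimp only [Option.elim] at *
          left
          by_cases h1 : a < p
          · simp only [h1, if_true, show a < p + r by omega, h1.le, show a + 1 ≤ p by omega,
              and_self]
          · simp only [h1, if_false, show ¬ a + r < p + r by omega, show ¬ a + 1 ≤ p by omega]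
            refine ⟨?_, by congr 1; omega⟩
            split_ifs
            · rw [pairGap₁_of_le (by omega)]
              congr 1; omega
            · congr 1; omega
        · fin_cases i
          · change a < 2 * n at h
            left
            dsimp only
            simp only [show a < p + r by omega, if_true, and_self]
          · change a < 2 * n' at h
            dsimp only
            by_cases h1 : a < r
            · right
              simp only [h1, if_true, show p + r - 1 - a < p + r by omega]
              rw [pairGap₁_of_le (by omega), pairGap₁_of_le (by omega)]
              constructor <;> congr 1 <;> omega
            · left
              simp only [h1, if_false, show ¬ p + a < p + r by omega, Nat.add_sub_cancel_left,
                and_self])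
    (by rintro (_ | i)
        · exact pairGap₀_zero hp
        · fin_cases i
          · exact pairGap₀_zero hp
          · exact (pairGap₁_of_le (Nat.zero_le _)).trans (pairGap₀_last hr))
    (by intro x h
        by_cases h1 : x < p
        · refine ⟨some 0, x, by simp; omega, ?_⟩
          dsimp only [pairGap₀, firstGap]
          split_ifs; omega
        · by_cases h2 : x < p + r - 1
          · refine ⟨some 0, p + r - (x - (p - 1)), by simp; omega, ?_⟩
            dsimp only [pairGap₀, firstGap]
            split_ifs <;> omega
          · by_cases h3 : x < p + r + q - 2
            · refine ⟨some 1, r + q - (x - (p + r - 2)), by simp; omega, ?_⟩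
              dsimp only [pairGap₁, nextGap]
              split_ifs <;> omega
            · refine ⟨some 0, p, by simp; omega, ?_⟩
              dsimp only [pairGap₀, firstGap]
              split_ifs <;> omega)
    (by omega)
    (fun i => by
        fin_cases i <;> dsimp
        · exact ⟨0, by omega, .inl ⟨0, by omega, by grind⟩⟩
        · exact ⟨0, by omega, .inr ⟨0, by simp, p + r - 1, by simp; omega, by grind⟩⟩)

section pair

variable (n n' N p q r : ℕ) (h₀ : p + r = 2 * n) (h₁ : r + q = 2 * n') (hN : p + q = 2 * N)
    (hp : 0 < p) (hr : 0 < r)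

theorem pair_tight : (pair n n' N p q r h₀ h₁ hN hp hr).Tight := by
  refine Tight.of_card (inferInstanceAs (Fintype (Fin 2))) ?_ ?_
  · change Nat.card (Fin 2) + Nat.card (Fin (p + r + q - 1)) = Nat.card (Fin (p + r + q)) + 1
    simp only [Nat.card_eq_fintype_card, Fintype.card_fin]
    omega
  · change Nat.card (Fin (p + r + q)) = N + ∑ i : Fin 2, if i = 0 then n else n'
    simp
    omega

theorem pair_arc_first {a : ℕ} (h : a < p) : (pair n n' N p q r h₀ h₁ hN hp hr).arc none a =
    (pair n n' N p q r h₀ h₁ hN hp hr).arc (some (0 : Fin 2)) a := by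
  refine arc_eq (show a < 2 * N by omega) (show a < 2 * n by omega) (Fin.ext ?_)
  change (if a < p then a else a + r) = a
  exact if_pos h

theorem pair_arc_mid {a a' : ℕ} (h : a' < r) (e : a + a' + 1 = p + r) :
    (pair n n' N p q r h₀ h₁ hN hp hr).arc (some (0 : Fin 2)) a =
    (pair n n' N p q r h₀ h₁ hN hp hr).arc (some (1 : Fin 2)) a' := by
  refine arc_eq (show a < 2 * n by omega) (show a' < 2 * n' by omega) (Fin.ext ?_)
  change a = (if a' < r then p + r - 1 - a' else p + a')
  rw [if_pos h]
  omega

theorem pair_arc_last {a a' : ℕ} (h : p ≤ a) (h' : a < p + q) (e : a' + p = a + r) :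
    (pair n n' N p q r h₀ h₁ hN hp hr).arc none a =
    (pair n n' N p q r h₀ h₁ hN hp hr).arc (some (1 : Fin 2)) a' := by
  refine arc_eq (show a < 2 * N by omega) (show a' < 2 * n' by omega) (Fin.ext ?_)
  change (if a < p then a else a + r) = (if a' < r then p + r - 1 - a' else p + a')
  rw [if_neg (by omega), if_neg (by omega)]
  omega

end pair

end Tangle
end PlanarAlg

/-! ### Chains of three boxes -/

namespace PlanarAlg

namespace Tangle

/-- Auxiliary for `triple`: the regions at the first box. -/
def tripleGap₀ (p q r r' : ℕ) : ℕ → ℕ := firstGap p r (if r' = 0 then 0 else p + r + r' + q - 3)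

/-- Auxiliary for `triple`: the regions at the second box. -/
def tripleGap₁ (p q r r' : ℕ) : ℕ → ℕ := nextGap (tripleGap₀ p q r r') (p + r) r r' (p + r - 2)

/-- Auxiliary for `triple`: the regions at the third box. -/
def tripleGap₂ (p q r r' : ℕ) : ℕ → ℕ :=
  nextGap (tripleGap₁ p q r r') (r + r') r' q (p + r - 2 + (r' - 1))

/-- Auxiliary for `triple`: the shading of a region. -/
def tripleParity (p q r r' x : ℕ) : ℕ :=
  if x < p then x else if x < p + r - 1 then p + r - (x - (p - 1))
    else if x < p + r - 1 + (r' - 1) then r + r' - (x - (p + r - 2))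
    else if x < p + r - 2 + (r' - 1) + q then r' + q - (x - (p + r - 2 + (r' - 1))) else p

section

variable {p q r r' : ℕ}

theorem tripleGap₀_lt (hp : 0 < p) (hr : 0 < r) (hq : 0 < q) (a : ℕ) :
    tripleGap₀ p q r r' a < p + r + r' + q - 2 := by
  unfold tripleGap₀ firstGap
  split_ifs <;> omega

theorem tripleGap₁_lt (hp : 0 < p) (hr : 0 < r) (hq : 0 < q) (a : ℕ) :
    tripleGap₁ p q r r' a < p + r + r' + q - 2 := by
  have := tripleGap₀_lt (r' := r') hp hr hq (p + r - a)
  unfold tripleGap₁ nextGap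
  split_ifs <;> omega

theorem tripleGap₂_lt (hp : 0 < p) (hr : 0 < r) (hq : 0 < q) (a : ℕ) :
    tripleGap₂ p q r r' a < p + r + r' + q - 2 := by
  have := tripleGap₁_lt (r' := r') hp hr hq (r + r' - a)
  unfold tripleGap₂ nextGap
  split_ifs <;> omega

theorem tripleGap₁_of_le {a : ℕ} (h : a ≤ r) :
    tripleGap₁ p q r r' a = tripleGap₀ p q r r' (p + r - a) := if_pos h

theorem tripleGap₂_of_le {a : ℕ} (h : a ≤ r') :
    tripleGap₂ p q r r' a = tripleGap₁ p q r r' (r + r' - a) := if_pos h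

theorem tripleGap₀_zero (hp : 0 < p) : tripleGap₀ p q r r' 0 = 0 := if_pos hp

theorem tripleGap₀_last (hr : 0 < r) : tripleGap₀ p q r r' (p + r) = 0 := by
  unfold tripleGap₀ firstGap
  split_ifs <;> omega

theorem tripleGap₁_zero (hr : 0 < r) : tripleGap₁ p q r r' 0 = 0 :=
  (tripleGap₁_of_le (Nat.zero_le _)).trans (tripleGap₀_last hr)

theorem tripleGap₁_last : tripleGap₁ p q r r' (r + r') = 0 := by
  unfold tripleGap₁ nextGap tripleGap₀ firstGap
  split_ifs <;> omega

theorem tripleGap₂_zero : tripleGap₂ p q r r' 0 = 0 :=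
  (tripleGap₂_of_le (Nat.zero_le _)).trans tripleGap₁_last

theorem tripleGap₂_last (hq : 0 < q) : tripleGap₂ p q r r' (r' + q) = 0 := by
  unfold tripleGap₂ nextGap
  split_ifs <;> omega

theorem tripleParity_tripleGap₀ (hp : 0 < p) (hr : 0 < r) (hq : 0 < q) (h₀ : (p + r) % 2 = 0)
    (h₁ : (r + r') % 2 = 0) (h₂ : (r' + q) % 2 = 0) {a : ℕ} (ha : a ≤ p + r) :
    tripleParity p q r r' (tripleGap₀ p q r r' a) % 2 = a % 2 := by
  unfold tripleGap₀ firstGap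
  split_ifs <;> unfold tripleParity <;> split_ifs <;> omega

theorem tripleParity_tripleGap₁ (hp : 0 < p) (hr : 0 < r) (hq : 0 < q) (h₀ : (p + r) % 2 = 0)
    (h₁ : (r + r') % 2 = 0) (h₂ : (r' + q) % 2 = 0) {a : ℕ} (ha : a ≤ r + r') :
    tripleParity p q r r' (tripleGap₁ p q r r' a) % 2 = a % 2 := by
  unfold tripleGap₁ nextGap
  split_ifs
  · rw [tripleParity_tripleGap₀ hp hr hq h₀ h₁ h₂ (by omega)]
    omega
  · unfold tripleParity
    split_ifs <;> omega
  · unfold tripleParity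
    split_ifs <;> omega

theorem tripleParity_tripleGap₂ (hp : 0 < p) (hr : 0 < r) (hq : 0 < q) (h₀ : (p + r) % 2 = 0)
    (h₁ : (r + r') % 2 = 0) (h₂ : (r' + q) % 2 = 0) {a : ℕ} (ha : a ≤ r' + q) :
    tripleParity p q r r' (tripleGap₂ p q r r' a) % 2 = a % 2 := by
  unfold tripleGap₂ nextGap
  split_ifs
  · rw [tripleParity_tripleGap₁ hp hr hq h₀ h₁ h₂ (by omega)]
    omega
  · unfold tripleParity
    split_ifs <;> omega
  · unfold tripleParity
    split_ifs <;> omega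

end

/-- The tangle with three internal boxes `0`, `1`, `2` and strings joining `p` marked points of the
external box and the box `0`, `r` marked points of the boxes `0` and `1`, `r'` marked points of the
boxes `1` and `2`, and `q` marked points of the box `2` and the external box. -/
def triple (n n' n'' N p q r r' : ℕ) (h₀ : p + r = 2 * n) (h₁ : r + r' = 2 * n')
    (h₂ : r' + q = 2 * n'') (hN : p + q = 2 * N) (hp : 0 < p) (hr : 0 < r) (hq : 0 < q) :
    Tangle (Col.ofNat N) :=
  -- For `r' = 0` the third box is separated from the second one, and the right-most region passes
  -- between them and becomes the region `0`. The truncated `r' - 1` in the numbering is then `0`,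
  -- the correct number of regions between the `r'` strings.
  ofLinkedCode N 3 (fun i => if i = 0 then n else if i = 1 then n' else n'') (p + r + r' + q)
    (p + r + r' + q - 2)
    (fun o a => match o with
      | none => if a < p then a else a + r + r'
      | some 0 => a
      | some 1 => if a < r then p + r - 1 - a else p + a
      | some 2 => if a < r' then p + r + r' - 1 - a else p + r + a)
    (fun o a => match o with
      | none => if a ≤ p then tripleGap₀ p q r r' a else tripleGap₂ p q r r' (r' + a - p)
      | some 0 => tripleGap₀ p q r r' a
      | some 1 => tripleGap₁ p q r r' a
      | some 2 => tripleGap₂ p q r r' a)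
    (fun s => if s < p + r then tripleGap₀ p q r r' s else if s < p + r + r' then
      tripleGap₁ p q r r' (s - p) else tripleGap₂ p q r r' (s - (p + r)))
    (fun s => if s < p + r then tripleGap₀ p q r r' (s + 1) else if s < p + r + r' then
      tripleGap₁ p q r r' (s - p + 1) else tripleGap₂ p q r r' (s - (p + r) + 1))
    (tripleParity p q r r')
    (by rintro (_ | i) a h
        · dsimp only [Option.elim] at *; grind
        · fin_cases i <;> dsimp [Option.elim] at * <;> grind)
    (by rintro (_ | i) a h
        · dsimp only
          split_ifs
          · exact tripleGap₀_lt hp hr hq _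
          · exact tripleGap₂_lt hp hr hq _
        · fin_cases i
          · exact tripleGap₀_lt hp hr hq _
          · exact tripleGap₁_lt hp hr hq _
          · exact tripleGap₂_lt hp hr hq _)
    (by intro x _
        split_ifs
        · exact tripleGap₀_lt hp hr hq _
        · exact tripleGap₁_lt hp hr hq _
        · exact tripleGap₂_lt hp hr hq _)
    (by intro x _
        split_ifs
        · exact tripleGap₀_lt hp hr hq _
        · exact tripleGap₁_lt hp hr hq _
        · exact tripleGap₂_lt hp hr hq _)
    (by rintro (_ | i) a h
        · dsimp only [Option.elim] at *
          by_cases h1 : a < p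
          · refine ⟨some 0, a, by simp; omega, by grind, ?_⟩
            simp [direction]; omega
          · refine ⟨some 2, a + r' - p, by simp; omega, by grind, ?_⟩
            simp [direction]; omega
        · fin_cases i <;> simp at h
          · by_cases h1 : a < p
            · refine ⟨none, a, by simp; omega, by grind, ?_⟩
              simp [direction]; omega
            · refine ⟨some 1, p + r - 1 - a, by simp; omega, by grind, ?_⟩
              simp [direction]; omega
          · by_cases h1 : a < r
            · refine ⟨some 0, p + r - 1 - a, by simp; omega, by grind, ?_⟩
              simp [direction]; omega
            · refine ⟨some 2, r + r' - 1 - a, by simp; omega, by grind, ?_⟩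
              simp [direction]; omega
          · by_cases h1 : a < r'
            · refine ⟨some 1, r + r' - 1 - a, by simp; omega, by grind, ?_⟩
              simp [direction]; omega
            · refine ⟨none, p + a - r', by simp; omega, by grind, ?_⟩
              simp [direction]; omega)
    (by rintro (_ | i) a (_ | i') a' h h' he hd
        · dsimp only [Option.elim] at *; simp only [direction] at hd; grind
        · fin_cases i' <;> dsimp [Option.elim] at * <;> simp [direction] at hd <;> grind
        · fin_cases i <;> dsimp [Option.elim] at * <;> simp [direction] at hd <;> grind
        · fin_cases i <;> fin_cases i' <;> dsimp [Option.elim] at * <;>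
            simp [direction] at hd <;> grind)
    (by intro x h
        by_cases h1 : x < p + r
        · exact ⟨some 0, x, by simp; omega, rfl⟩
        · by_cases h2 : x < p + r + r'
          · exact ⟨some 1, x - p, by simp; omega, by grind⟩
          · exact ⟨some 2, x - (p + r), by simp; omega, by grind⟩)
    (by rintro (_ | i)
        · dsimp only [Option.elim]
          simp only [← hN, if_pos (Nat.zero_le p), tripleGap₀_zero hp]
          rw [if_neg (by omega), show r' + (p + q) - p = r' + q by omega, tripleGap₂_last hq]
        · fin_cases i
          · change tripleGap₀ p q r r' (2 * n) = tripleGap₀ p q r r' 0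
            rw [← h₀, tripleGap₀_last hr, tripleGap₀_zero hp]
          · change tripleGap₁ p q r r' (2 * n') = tripleGap₁ p q r r' 0
            rw [← h₁, tripleGap₁_last, tripleGap₁_zero hr]
          · change tripleGap₂ p q r r' (2 * n'') = tripleGap₂ p q r r' 0
            rw [← h₂, tripleGap₂_last hq, tripleGap₂_zero])
    (by rintro (_ | i) a h
        · dsimp only [Option.elim] at *
          split_ifs
          · exact tripleParity_tripleGap₀ hp hr hq (by omega) (by omega) (by omega) (by omega)
          · rw [tripleParity_tripleGap₂ hp hr hq (by omega) (by omega) (by omega) (by omega)]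
            omega
        · fin_cases i
          · change a ≤ 2 * n at h
            exact tripleParity_tripleGap₀ hp hr hq (by omega) (by omega) (by omega) (by omega)
          · change a ≤ 2 * n' at h
            exact tripleParity_tripleGap₁ hp hr hq (by omega) (by omega) (by omega) (by omega)
          · change a ≤ 2 * n'' at h
            exact tripleParity_tripleGap₂ hp hr hq (by omega) (by omega) (by omega) (by omega))
    (by rintro (_ | i) a h
        · dsimp only [Option.elim] at *
          left
          by_cases h1 : a < p
          · simp only [h1, if_true, show a < p + r by omega, h1.le, show a + 1 ≤ p by omega,
              and_self]
          · simp only [h1, if_false, show ¬ a + r + r' < p + r by omega,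
              show ¬ a + r + r' < p + r + r' by omega, show ¬ a + 1 ≤ p by omega]
            refine ⟨?_, by congr 1; omega⟩
            split_ifs
            · rw [tripleGap₂_of_le (by omega), tripleGap₁_of_le (by omega)]
              congr 1; omega
            · congr 1; omega
        · fin_cases i
          · change a < 2 * n at h
            left
            dsimp only
            simp only [show a < p + r by omega, if_true, and_self]
          · change a < 2 * n' at h
            dsimp only
            by_cases h1 : a < r
            · right
              simp only [h1, if_true, show p + r - 1 - a < p + r by omega]
              rw [tripleGap₁_of_le (by omega), tripleGap₁_of_le (by omega)]
              constructor <;> congr 1 <;> omega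
            · left
              simp only [h1, if_false, show ¬ p + a < p + r by omega,
                show p + a < p + r + r' by omega, if_true, Nat.add_sub_cancel_left, and_self]
          · change a < 2 * n'' at h
            dsimp only
            by_cases h1 : a < r'
            · right
              simp only [h1, if_true, if_false, show ¬ p + r + r' - 1 - a < p + r by omega,
                show p + r + r' - 1 - a < p + r + r' by omega]
              rw [tripleGap₂_of_le (by omega), tripleGap₂_of_le (by omega)]
              constructor <;> congr 1 <;> omega
            · left
              simp only [h1, if_false, show ¬ p + r + a < p + r by omega,
                show ¬ p + r + a < p + r + r' by omega, Nat.add_sub_cancel_left, and_self])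
    (by rintro (_ | i)
        · exact tripleGap₀_zero hp
        · fin_cases i
          · exact tripleGap₀_zero hp
          · exact tripleGap₁_zero hr
          · exact tripleGap₂_zero)
    (by intro x h
        by_cases h1 : x < p
        · refine ⟨some 0, x, by simp; omega, ?_⟩
          dsimp only [tripleGap₀, firstGap]
          split_ifs; omega
        · by_cases h2 : x < p + r - 1
          · refine ⟨some 0, p + r - (x - (p - 1)), by simp; omega, ?_⟩
            dsimp only [tripleGap₀, firstGap]
            split_ifs <;> omega
          · by_cases h3 : x < p + r - 1 + (r' - 1)
            · refine ⟨some 1, r + r' - (x - (p + r - 2)), by simp; omega, ?_⟩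
              dsimp only [tripleGap₁, nextGap]
              split_ifs <;> omega
            · by_cases h4 : x < p + r - 2 + (r' - 1) + q
              · refine ⟨some 2, r' + q - (x - (p + r - 2 + (r' - 1))), by simp; omega, ?_⟩
                dsimp only [tripleGap₂, nextGap]
                split_ifs <;> omega
              · refine ⟨some 0, p, by simp; omega, ?_⟩
                dsimp only [tripleGap₀, firstGap]
                split_ifs <;> omega)
    (by omega)
    (fun i => by
        fin_cases i <;> dsimp
        · exact ⟨0, by omega, .inl ⟨0, by omega, by grind⟩⟩
        · exact ⟨0, by omega, .inr ⟨0, by simp, p + r - 1, by simp; omega, by grind⟩⟩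
        -- The third box is linked directly to the external one, since it may have no string to the
        -- second; in `mulStack` this happens for `d = 1`.
        · exact ⟨r', by omega, .inl ⟨p, by omega, by grind⟩⟩)

section triple

variable (n n' n'' N p q r r' : ℕ) (h₀ : p + r = 2 * n) (h₁ : r + r' = 2 * n')
  (h₂ : r' + q = 2 * n'') (hN : p + q = 2 * N) (hp : 0 < p) (hr : 0 < r) (hq : 0 < q)

theorem triple_tight : (triple n n' n'' N p q r r' h₀ h₁ h₂ hN hp hr hq).Tight := by
  refine Tight.of_card (inferInstanceAs (Fintype (Fin 3))) ?_ ?_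
  · change Nat.card (Fin 3) + Nat.card (Fin (p + r + r' + q - 2)) =
      Nat.card (Fin (p + r + r' + q)) + 1
    simp only [Nat.card_eq_fintype_card, Fintype.card_fin]
    omega
  · change Nat.card (Fin (p + r + r' + q)) =
      N + ∑ i : Fin 3, if i = 0 then n else if i = 1 then n' else n''
    simp [Fin.sum_univ_three]
    omega

theorem triple_arc_first {a : ℕ} (h : a < p) :
    (triple n n' n'' N p q r r' h₀ h₁ h₂ hN hp hr hq).arc none a =
    (triple n n' n'' N p q r r' h₀ h₁ h₂ hN hp hr hq).arc (some (0 : Fin 3)) a := by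
  refine arc_eq (show a < 2 * N by omega) (show a < 2 * n by omega) (Fin.ext ?_)
  change (if a < p then a else a + r + r') = a
  exact if_pos h

theorem triple_arc_mid {a a' : ℕ} (h : a' < r) (e : a + a' + 1 = p + r) :
    (triple n n' n'' N p q r r' h₀ h₁ h₂ hN hp hr hq).arc (some (0 : Fin 3)) a =
    (triple n n' n'' N p q r r' h₀ h₁ h₂ hN hp hr hq).arc (some (1 : Fin 3)) a' := by
  refine arc_eq (show a < 2 * n by omega) (show a' < 2 * n' by omega) (Fin.ext ?_)
  change a = (if a' < r then p + r - 1 - a' else p + a')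
  rw [if_pos h]
  omega

theorem triple_arc_mid' {a a' : ℕ} (h : a' < r') (e : a + a' + 1 = r + r') :
    (triple n n' n'' N p q r r' h₀ h₁ h₂ hN hp hr hq).arc (some (1 : Fin 3)) a =
    (triple n n' n'' N p q r r' h₀ h₁ h₂ hN hp hr hq).arc (some (2 : Fin 3)) a' := by
  refine arc_eq (show a < 2 * n' by omega) (show a' < 2 * n'' by omega) (Fin.ext ?_)
  change (if a < r then p + r - 1 - a else p + a) =
    (if a' < r' then p + r + r' - 1 - a' else p + r + a')
  rw [if_neg (by omega), if_pos h]
  omega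

theorem triple_arc_last {a a' : ℕ} (h : p ≤ a) (h' : a < p + q) (e : a' + p = a + r') :
    (triple n n' n'' N p q r r' h₀ h₁ h₂ hN hp hr hq).arc none a =
    (triple n n' n'' N p q r r' h₀ h₁ h₂ hN hp hr hq).arc (some (2 : Fin 3)) a' := by
  refine arc_eq (show a < 2 * N by omega) (show a' < 2 * n'' by omega) (Fin.ext ?_)
  change (if a < p then a else a + r + r') = (if a' < r' then p + r + r' - 1 - a' else p + r + a')
  rw [if_neg (by omega), if_neg (by omega)]
  omega

end triple

end Tangle
end PlanarAlg

namespace PlanarAlg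

namespace Tangle

/-! ### Composites of tangles with two boxes -/

/-- The boxes of two substituted tangles, numbered consecutively. -/
def sigmaFinTwoEquiv (B : Fin 2 → Type) {m n l : ℕ} (e₀ : B 0 = Fin m) (e₁ : B 1 = Fin n)
    (h : m + n = l) : (Σ i, B i) ≃ Fin l where
  toFun
    | ⟨0, x⟩ => ((cast e₀ x).castAdd n).cast h
    | ⟨1, x⟩ => ((cast e₁ x).natAdd m).cast h
  invFun y := Fin.addCases (fun x => ⟨0, cast e₀.symm x⟩) (fun x => ⟨1, cast e₁.symm x⟩)
    (y.cast h.symm)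
  left_inv := by
    rintro ⟨i, x⟩
    match i, x with
    | 0, x => simp
    | 1, x => simp
  right_inv y := by
    subst h
    induction y using Fin.addCases with
    | left x => simp
    | right x => simp

theorem forall_option_sigma {B : Fin 2 → Type} {p : Option (Σ i, B i) → Prop} (h : p none)
    (h₀ : ∀ j, p (some ⟨0, j⟩)) (h₁ : ∀ j, p (some ⟨1, j⟩)) : ∀ o, p o := by
  rintro (_ | ⟨i, j⟩)
  · exact h
  · match i, j with
    | 0, j => exact h₀ j
    | 1, j => exact h₁ j

theorem forall_fin_two {p : Fin 2 → Prop} (h₀ : p 0) (h₁ : p 1) : ∀ i, p i := by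
  intro i
  match i with
  | 0 => exact h₀
  | 1 => exact h₁

/-- Two marked points which belong to the same string both of `U` and of the composite of `T` and
the `S i`. -/
structure Traced {n₀ : Col} (T : Tangle n₀) (S : ∀ i, Tangle (T.col i)) (U : Tangle n₀)
    (box : (Σ i, (S i).Box) ≃ U.Box) (o : Option (Σ i, (S i).Box)) (a : ℕ)
    (o' : Option (Σ i, (S i).Box)) (a' : ℕ) : Prop where
  direction_ne : direction o a ≠ direction o' a'
  arc_eq : U.arc (o.map box) a = U.arc (o'.map box) a'
  outerArc_eq : outerArc T S o a = outerArc T S o' a'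

namespace Traced

variable {n₀ : Col} {T : Tangle n₀} {S : ∀ i, Tangle (T.col i)} {U : Tangle n₀}
  {box : (Σ i, (S i).Box) ≃ U.Box}

theorem symm {o o' : Option (Σ i, (S i).Box)} {a a' : ℕ} (h : Traced T S U box o a o' a') :
    Traced T S U box o' a' o a :=
  ⟨h.1.symm, h.2.symm, h.3.symm⟩

theorem exists_mate {o o' : Option (Σ i, (S i).Box)} {a a' : ℕ}
    (h : Traced T S U box o a o' a') : ∃ o' a', direction o a ≠ direction o' a' ∧
      U.arc (o.map box) a = U.arc (o'.map box) a' ∧ outerArc T S o a = outerArc T S o' a' :=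
  ⟨o', a', h.1, h.2, h.3⟩

theorem ext_ext {a a' : ℕ} (h : (a + a') % 2 = 1) (h₁ : U.arc none a = U.arc none a')
    (h₂ : hostArc T S none a = hostArc T S none a') : Traced T S U box none a none a' :=
  ⟨by change (0 + a) % 2 ≠ (0 + a') % 2; omega, h₁, h₂⟩

theorem ext_int {a a' : ℕ} {i : T.Box} {j : (S i).Box} (h : (a + a') % 2 = 0)
    (h₁ : U.arc none a = U.arc (some (box ⟨i, j⟩)) a')
    (h₂ : hostArc T S none a = guestArc T S i (some j) a') :
    Traced T S U box none a (some ⟨i, j⟩) a' :=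
  ⟨by change (0 + a) % 2 ≠ (1 + a') % 2; omega, h₁, h₂⟩

theorem int_int {a a' : ℕ} {i i' : T.Box} {j : (S i).Box} {j' : (S i').Box}
    (h : (a + a') % 2 = 1)
    (h₁ : U.arc (some (box ⟨i, j⟩)) a = U.arc (some (box ⟨i', j'⟩)) a')
    (h₂ : guestArc T S i (some j) a = guestArc T S i' (some j') a') :
    Traced T S U box (some ⟨i, j⟩) a (some ⟨i', j'⟩) a' :=
  ⟨by change (1 + a) % 2 ≠ (1 + a') % 2; omega, h₁, h₂⟩

end Traced

theorem reach_of_guest {n₀ : Col} {T : Tangle n₀} {S : ∀ i, Tangle (T.col i)} {i : T.Box} {a : ℕ}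
    (o : Option (Σ i, (S i).Box)) (a' : ℕ) (h : guestArc T S i none a = outerArc T S o a') :
    ∃ o a', hostArc T S (some i) a = outerArc T S o a' :=
  ⟨o, a', (hostArc_some i a).trans h⟩

theorem stack_arc_first (k n m b : ℕ) (hk : k = m + 1) (hn : n = m + b) (hb : 0 < b) (i : Fin b)
    (hi : i.val = 0) {a : ℕ} (h : a < m + 2) :
    (stack k n m b hk hn hb).arc none a = (stack k n m b hk hn hb).arc (some i) a := by
  by_cases h' : a < m
  · exact stack_arc_top k n m b hk hn hb i hi h'
  · exact stack_arc_right k n m b hk hn hb i (by omega) h (by omega)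

/-- For the last box the points on the right and those on the bottom have the same offset `2 i`, so
both can be treated together. -/
theorem stack_arc_last (k n m b : ℕ) (hk : k = m + 1) (hn : n = m + b) (hb : 0 < b) (i : Fin b)
    (hi : i.val + 1 = b) {a : ℕ} (h : m ≤ a) (h' : a < 2 * k) :
    (stack k n m b hk hn hb).arc none (a + 2 * i.val) =
      (stack k n m b hk hn hb).arc (some i) a := by
  by_cases h1 : a < m + 2
  · exact stack_arc_right k n m b hk hn hb i h h1 rfl
  · exact stack_arc_bot k n m b hk hn hb i hi (by omega) h' rfl

section

variable (k : ℕ) (hk : 1 ≤ k)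

/-- The tangles whose product is `x E_{k+1}`. -/
abbrev inclJones : ∀ i, Tangle ((mult (Col.ofNat (k + 1))).col i) :=
  fun i : Fin 2 => match i with
    | 0 => incl k (k + 1) k.le_succ
    | 1 => jones (k + 1) (by omega)

/-- Only one string of `x E_{k+1}` has to be straightened: from the top right-most external point it
runs down beside `x`, turns at the upper arc of `E_{k+1}` and ends at the bottom right-most point of
`x`. The lower arc of `E_{k+1}` becomes the cap at the external points `k + 1` and `k + 2`. -/
theorem exists_composite_mult_incl_jones :
    ∃ e : Composite (mult (Col.ofNat (k + 1))) (inclJones k hk) (cap k (k + 1) hk (by omega)),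
      e.box = sigmaFinTwoEquiv _ (m := 1) (n := 0) rfl rfl rfl := by
  -- `E`, `m₀`, `m₁` and `x` give the glued string at the points of the external box, of the two
  -- boxes of the outer tangle and of the box that remains. The strings of the outer and inner
  -- tangles yield equations between them, which compose to those required of the result. The
  -- composites below are verified in the same way.
  let E := hostArc _ (inclJones k hk) none
  let m₀ := guestArc _ (inclJones k hk) (0 : Fin 2) none
  let m₁ := guestArc _ (inclJones k hk) (1 : Fin 2) none
  let x := guestArc _ (inclJones k hk) (0 : Fin 2) (some (0 : Fin 1))
  have top : ∀ a, a < k + 1 → E a = m₀ a := fun a h =>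
    (hostArc_congr (mult_arc_top (k + 1) h)).trans (hostArc_some _ _)
  have mid : ∀ a a', a' < k + 1 → a + a' + 1 = 2 * (k + 1) → m₀ a = m₁ a' := fun a a' h h' =>
    (hostArc_some _ _).symm.trans <|
      (hostArc_congr (mult_arc_mid (k + 1) h h')).trans (hostArc_some _ _)
  have bot : ∀ a, k + 1 ≤ a → a < 2 * (k + 1) → m₁ a = E a := fun a h h' =>
    (hostArc_some _ _).symm.trans (hostArc_congr (mult_arc_bot (k + 1) h h'))
  have il : ∀ a, a < k → m₀ a = x a := fun a h =>
    guestArc_congr (incl_arc_left k (k + 1) k.le_succ h)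
  have ir : m₀ k = m₀ (k + 1) :=
    guestArc_congr (incl_arc_right k (k + 1) k.le_succ le_rfl (by omega) (by omega))
  have ib : ∀ a, k ≤ a → a < 2 * k → m₀ (a + 2) = x a := fun a h h' =>
    guestArc_congr (incl_arc_bot k (k + 1) k.le_succ h h' (by omega))
  have j : ∀ a a', (a < k - 1 ∧ a + a' + 1 = 2 * (k + 1)) ∨ (a + 1 = k ∧ a' = k) ∨
      (a = k + 1 ∧ a' = k + 2) → m₁ a = m₁ a' := fun a a' h =>
    guestArc_congr (jones_arc (k + 1) (by omega) (by omega))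
  have t₁ : ∀ a, a ≤ k → E a = x a := by
    intro a h
    rw [top a (by omega)]
    by_cases h1 : a < k
    · exact il a h1
    · obtain rfl : a = k := by omega
      rw [ir, mid (a + 1) a (by omega) (by omega), ← j (a - 1) a (by omega),
        ← mid (a + 2) (a - 1) (by omega) (by omega), ib a le_rfl (by omega)]
  have t₂ : ∀ a, k + 1 ≤ a → a < 2 * k → E (a + 2) = x a := by
    intro a h h'
    rw [← bot (a + 2) (by omega) (by omega), ← j (2 * (k + 1) - 1 - (a + 2)) (a + 2) (by omega),
      ← mid (a + 2) _ (by omega) (by omega), ib a (by omega) h']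
  have t₃ : E (k + 1) = E (k + 2) := by
    rw [← bot (k + 1) (by omega) (by omega), j (k + 1) (k + 2) (by omega),
      bot (k + 2) (by omega) (by omega)]
  have mate₁ : ∀ a a', a' < 2 * k → (a' < k + 1 ∧ a = a') ∨ (k + 1 ≤ a' ∧ a = a' + 2) →
      Traced _ (inclJones k hk) (cap k (k + 1) hk (by omega))
        (sigmaFinTwoEquiv _ (m := 1) (n := 0) rfl rfl rfl) none a
        (some ⟨(0 : Fin 2), (0 : Fin 1)⟩) a' := fun a a' h h' =>
    .ext_int (by omega) (cap_arc k (k + 1) hk (by omega) h h') (by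
      rcases h' with ⟨h1, rfl⟩ | ⟨h1, rfl⟩
      · exact t₁ _ (by omega)
      · exact t₂ _ h1 h)
  have mate₂ : Traced _ (inclJones k hk) (cap k (k + 1) hk (by omega))
        (sigmaFinTwoEquiv _ (m := 1) (n := 0) rfl rfl rfl) none (k + 1) none (k + 2) :=
    .ext_ext (by omega) (cap_arc_cap k (k + 1) hk (by omega)) t₃
  refine exists_composite (mult_tight _ (by omega))
    (forall_fin_two (incl_tight k (k + 1) k.le_succ hk) (jones_tight (k + 1) (by omega)))
    (cap_tight k (k + 1) hk (by omega)) (Nat.succ_pos k) (fun _ => Nat.succ_pos k)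
    _ ?_ ?_ ?_
  · rintro ⟨i, j⟩
    match i, j with
    | (0 : Fin 2), _ => rfl
    | (1 : Fin 2), j => exact Fin.elim0 j
  · refine forall_option_sigma ?_ ?_ ?_
    · intro a (ha : a < 2 * (k + 1))
      by_cases h1 : a ≤ k
      · exact (mate₁ a a (by omega) (by omega)).exists_mate
      · by_cases h2 : a = k + 1
        · exact h2 ▸ mate₂.exists_mate
        · by_cases h3 : a = k + 2
          · exact h3 ▸ mate₂.symm.exists_mate
          · exact (mate₁ a (a - 2) (by omega) (by omega)).exists_mate
    · intro j
      obtain rfl : j = (0 : Fin 1) := Subsingleton.elim (α := Fin 1) _ _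
      intro a (ha : a < 2 * k)
      by_cases h1 : a ≤ k
      · exact (mate₁ a a (by omega) (by omega)).symm.exists_mate
      · exact (mate₁ (a + 2) a (by omega) (by omega)).symm.exists_mate
    · intro (j : Fin 0)
      exact j.elim0
  -- Each point of the glued boxes is followed to a box that remains. The two points on the upper
  -- arc of `E_{k+1}` lead to the bottom right-most point of `x`.
  · have r₁ : ∀ a, a < 2 * (k + 1) → ∃ o a', m₁ a = outerArc _ (inclJones k hk) o a' := by
      intro a ha
      by_cases h1 : k + 1 ≤ a
      · exact ⟨none, a, bot a h1 ha⟩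
      · by_cases h2 : a < k - 1
        · exact ⟨none, 2 * (k + 1) - 1 - a, (j a _ (by omega)).trans
            (bot _ (by omega) (by omega))⟩
        · refine ⟨some ⟨(0 : Fin 2), (0 : Fin 1)⟩, k, ?_⟩
          refine Eq.trans ?_ (ib k le_rfl (by omega))
          rw [mid (k + 2) (k - 1) (by omega) (by omega)]
          by_cases h3 : a = k
          · rw [h3, j (k - 1) k (by omega)]
          · rw [show a = k - 1 by omega]
    refine forall_fin_two ?_ ?_
    · intro a (ha : a < 2 * (k + 1))
      by_cases h1 : a < k + 1
      · exact reach_of_guest none a (top a h1).symm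
      · obtain ⟨o, a', h⟩ := r₁ (2 * (k + 1) - 1 - a) (by omega)
        exact reach_of_guest o a' ((mid a _ (by omega) (by omega)).trans h)
    · intro a (ha : a < 2 * (k + 1))
      obtain ⟨o, a', h⟩ := r₁ a ha
      exact reach_of_guest o a' h

end

end Tangle
end PlanarAlg

/-! ### Diagrams for `x E_{k+1} y` and for products with it -/

namespace PlanarAlg

namespace Tangle

section

variable (k : ℕ) (hk : 1 ≤ k)

/-- The tangles whose product is `x E_{k+1} y`. -/
abbrev capIncl : ∀ i, Tangle ((mult (Col.ofNat (k + 1))).col i) :=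
  fun i : Fin 2 => match i with
    | 0 => cap k (k + 1) hk (by omega)
    | 1 => incl k (k + 1) k.le_succ

/-- The only string that is not already straight starts at the bottom right-most external point,
runs up beside `y`, turns at the cap below `x` and ends at the top right-most point of `y`. With
this, the right-most points of `x` and of `y` all lead to the external box, as in `T^{k+1}`. -/
theorem exists_composite_mult_cap_incl :
    ∃ e : Composite (mult (Col.ofNat (k + 1))) (capIncl k hk)
        (stack k (k + 1) (k - 1) 2 (by omega) (by omega) two_pos),
      e.box = sigmaFinTwoEquiv _ (m := 1) (n := 1) rfl rfl rfl := by
  let E := hostArc _ (capIncl k hk) none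
  let m₀ := guestArc _ (capIncl k hk) (0 : Fin 2) none
  let m₁ := guestArc _ (capIncl k hk) (1 : Fin 2) none
  let x := guestArc _ (capIncl k hk) (0 : Fin 2) (some (0 : Fin 1))
  let y := guestArc _ (capIncl k hk) (1 : Fin 2) (some (0 : Fin 1))
  have top : ∀ a, a < k + 1 → E a = m₀ a := fun a h =>
    (hostArc_congr (mult_arc_top (k + 1) h)).trans (hostArc_some _ _)
  have mid : ∀ a a', a' < k + 1 → a + a' + 1 = 2 * (k + 1) → m₀ a = m₁ a' := fun a a' h h' =>
    (hostArc_some _ _).symm.trans <|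
      (hostArc_congr (mult_arc_mid (k + 1) h h')).trans (hostArc_some _ _)
  have bot : ∀ a, k + 1 ≤ a → a < 2 * (k + 1) → m₁ a = E a := fun a h h' =>
    (hostArc_some _ _).symm.trans (hostArc_congr (mult_arc_bot (k + 1) h h'))
  have c₁ : ∀ a a', a < 2 * k → (a < k + 1 ∧ a' = a) ∨ (k + 1 ≤ a ∧ a' = a + 2) → m₀ a' = x a :=
    fun a a' h h' => guestArc_congr (cap_arc k (k + 1) hk (by omega) h h')
  have c₂ : m₀ (k + 1) = m₀ (k + 2) := guestArc_congr (cap_arc_cap k (k + 1) hk (by omega))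
  have il : ∀ a, a < k → m₁ a = y a := fun a h =>
    guestArc_congr (incl_arc_left k (k + 1) k.le_succ h)
  have ir : m₁ k = m₁ (k + 1) :=
    guestArc_congr (incl_arc_right k (k + 1) k.le_succ le_rfl (by omega) (by omega))
  have ib : ∀ a, k ≤ a → a < 2 * k → m₁ (a + 2) = y a := fun a h h' =>
    guestArc_congr (incl_arc_bot k (k + 1) k.le_succ h h' (by omega))
  have t₁ : ∀ a, a < k + 1 → E a = x a := fun a h =>
    (top a h).trans (c₁ a a (by omega) (by omega))
  have t₂ : ∀ a, k - 1 ≤ a → a < 2 * k → E (a + 2) = y a := by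
    intro a h h'
    by_cases h1 : k ≤ a
    · rw [← bot (a + 2) (by omega) (by omega), ib a h1 h']
    · obtain rfl : k = a + 1 := by omega
      rw [← bot (a + 2) (by omega) (by omega), ← ir, ← mid (a + 2) (a + 1) (by omega) (by omega),
        c₂, mid _ a (by omega) (by omega), il a (by omega)]
  have t₃ : ∀ a a', a' < k - 1 → a + a' + 1 = 2 * k → x a = y a' := by
    intro a a' h h'
    rw [← il a' (by omega), ← mid (a + 2) a' (by omega) (by omega),
      c₁ a (a + 2) (by omega) (by omega)]
  have mate₁ : ∀ a, a < k + 1 → Traced _ (capIncl k hk)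
      (stack k (k + 1) (k - 1) 2 (by omega) (by omega) two_pos)
      (sigmaFinTwoEquiv _ (m := 1) (n := 1) rfl rfl rfl) none a
      (some ⟨(0 : Fin 2), (0 : Fin 1)⟩) a := fun a h =>
    .ext_int (by omega) (stack_arc_first k (k + 1) (k - 1) 2 (by omega) (by omega) two_pos
      (0 : Fin 2) rfl (by omega)) (t₁ a h)
  have mate₂ : ∀ a, k - 1 ≤ a → a < 2 * k → Traced _ (capIncl k hk)
      (stack k (k + 1) (k - 1) 2 (by omega) (by omega) two_pos)
      (sigmaFinTwoEquiv _ (m := 1) (n := 1) rfl rfl rfl) none (a + 2)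
      (some ⟨(1 : Fin 2), (0 : Fin 1)⟩) a := fun a h h' =>
    .ext_int (by omega) (stack_arc_last k (k + 1) (k - 1) 2 (by omega) (by omega) two_pos
      (1 : Fin 2) rfl h h') (t₂ a h h')
  have mate₃ : ∀ a a', a' < k - 1 → a + a' + 1 = 2 * k → Traced _ (capIncl k hk)
      (stack k (k + 1) (k - 1) 2 (by omega) (by omega) two_pos)
      (sigmaFinTwoEquiv _ (m := 1) (n := 1) rfl rfl rfl) (some ⟨(0 : Fin 2), (0 : Fin 1)⟩) a
      (some ⟨(1 : Fin 2), (0 : Fin 1)⟩) a' := fun a a' h h' =>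
    .int_int (by omega) (stack_arc_mid k (k + 1) (k - 1) 2 (by omega) (by omega) two_pos
      (0 : Fin 2) (1 : Fin 2) rfl h h') (t₃ a a' h h')
  refine exists_composite (mult_tight _ (by omega))
    (forall_fin_two (cap_tight k (k + 1) hk (by omega)) (incl_tight k (k + 1) k.le_succ hk))
    (stack_tight _ _ _ _ _ _ _) (Nat.succ_pos k) (fun _ => Nat.succ_pos k)
    _ ?_ ?_ ?_
  · rintro ⟨i, j⟩
    match i, j with
    | (0 : Fin 2), _ => rfl
    | (1 : Fin 2), _ => rfl
  · refine forall_option_sigma ?_ ?_ ?_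
    · intro a (ha : a < 2 * (k + 1))
      by_cases h1 : a < k + 1
      · exact (mate₁ a h1).exists_mate
      · obtain ⟨a, rfl⟩ : ∃ a', a = a' + 2 := ⟨a - 2, by omega⟩
        exact (mate₂ a (by omega) (by omega)).exists_mate
    · intro j
      obtain rfl : j = (0 : Fin 1) := Subsingleton.elim (α := Fin 1) _ _
      intro a (ha : a < 2 * k)
      by_cases h1 : a < k + 1
      · exact (mate₁ a h1).symm.exists_mate
      · exact (mate₃ a (2 * k - 1 - a) (by omega) (by omega)).exists_mate
    · intro j
      obtain rfl : j = (0 : Fin 1) := Subsingleton.elim (α := Fin 1) _ _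
      intro a (ha : a < 2 * k)
      by_cases h1 : a < k - 1
      · exact (mate₃ (2 * k - 1 - a) a h1 (by omega)).symm.exists_mate
      · exact (mate₂ a (by omega) ha).symm.exists_mate
  · have e : m₀ (k + 1) = E (k + 1) := by
      rw [mid (k + 1) k (by omega) (by omega), ir, bot (k + 1) le_rfl (by omega)]
    refine forall_fin_two ?_ ?_
    · intro a (ha : a < 2 * (k + 1))
      by_cases h1 : a < k + 1
      · exact reach_of_guest none a (top a h1).symm
      · by_cases h2 : a = k + 1
        · exact reach_of_guest none (k + 1) (by rw [h2]; exact e)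
        · by_cases h3 : a = k + 2
          · exact reach_of_guest none (k + 1) (by rw [h3]; exact c₂.symm.trans e)
          · exact reach_of_guest (some ⟨(0 : Fin 2), (0 : Fin 1)⟩) (a - 2)
              (c₁ (a - 2) a (by omega) (by omega))
    · intro a (ha : a < 2 * (k + 1))
      by_cases h1 : k + 1 ≤ a
      · exact reach_of_guest none a (bot a h1 ha)
      · by_cases h2 : a = k
        · exact reach_of_guest none (k + 1) (by
            rw [h2]
            exact ir.trans (bot (k + 1) le_rfl (by omega)))
        · exact reach_of_guest (some ⟨(1 : Fin 2), (0 : Fin 1)⟩) a (il a (by omega))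

end

section

variable (d : ℕ)

/-- The tangle which multiplies an element of `P_{d+2}` by one of `P_{d+1}`. -/
abbrev mulRight : Tangle (Col.ofNat (d + 2)) :=
  pair (d + 2) (d + 1) (d + 2) (d + 3) (d + 1) (d + 1) (by omega) (by omega) (by omega)
    (by omega) (by omega)

/-- The unit, substituted into `mulRight`. -/
abbrev identityUnit : ∀ i, Tangle ((mulRight d).col i) :=
  fun i : Fin 2 => match i with
    | 0 => identity (Col.ofNat (d + 2))
    | 1 => unit (Col.ofNat (d + 1))

/-- This is `z · 1 = z` for the unit of `P_{d+1}`. Expanding that unit in products `x E_{d+1} y` is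
how the hypothesis on `P_{d+1}` acts on `P_{d+2}`. -/
theorem exists_composite_mulRight_identity_unit :
    ∃ e : Composite (mulRight d) (identityUnit d) (identity (Col.ofNat (d + 2))),
      e.box = sigmaFinTwoEquiv _ (m := 1) (n := 0) rfl rfl rfl := by
  let E := hostArc _ (identityUnit d) none
  let m₀ := guestArc _ (identityUnit d) (0 : Fin 2) none
  let m₁ := guestArc _ (identityUnit d) (1 : Fin 2) none
  let x := guestArc _ (identityUnit d) (0 : Fin 2) (some (0 : Fin 1))
  have top : ∀ a, a < d + 3 → E a = m₀ a := fun a h =>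
    (hostArc_congr (pair_arc_first _ _ _ _ _ _ _ _ _ _ _ h)).trans (hostArc_some _ _)
  have mid : ∀ a a', a' < d + 1 → a + a' = 2 * d + 3 → m₀ a = m₁ a' := fun a a' h h' =>
    (hostArc_some _ _).symm.trans <|
      (hostArc_congr (pair_arc_mid _ _ _ _ _ _ _ _ _ _ _ h (by omega))).trans (hostArc_some _ _)
  have bot : ∀ a, d + 1 ≤ a → a < 2 * (d + 1) → E (a + 2) = m₁ a := fun a h h' =>
    (hostArc_congr (pair_arc_last _ _ _ _ _ _ _ _ _ _ _ (by omega) (by omega)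
      (by omega))).trans (hostArc_some _ _)
  have id : ∀ a, a < 2 * (d + 2) → m₀ a = x a := fun a h =>
    guestArc_congr (identity_arc (d + 2) h)
  have un : ∀ a a', a + a' + 1 = 2 * (d + 1) → m₁ a = m₁ a' := fun a a' h =>
    guestArc_congr (unit_arc (d + 1) h)
  have t : ∀ a, a < 2 * (d + 2) → E a = x a := by
    intro a h
    by_cases h1 : a < d + 3
    · exact (top a h1).trans (id a h)
    · obtain ⟨a, rfl⟩ : ∃ a', a = a' + 2 := ⟨a - 2, by omega⟩
      rw [bot a (by omega) (by omega), un a (2 * (d + 1) - 1 - a) (by omega),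
        ← mid (a + 2) _ (by omega) (by omega), id _ h]
  have mate : ∀ a, a < 2 * (d + 2) → Traced _ (identityUnit d) (identity (Col.ofNat (d + 2)))
      (sigmaFinTwoEquiv _ (m := 1) (n := 0) rfl rfl rfl) none a
      (some ⟨(0 : Fin 2), (0 : Fin 1)⟩) a := fun a h =>
    .ext_int (by omega) (identity_arc (d + 2) h) (t a h)
  refine exists_composite (pair_tight _ _ _ _ _ _ _ _ _ _ _)
    (forall_fin_two (identity_tight (d + 2) (by omega)) (unit_tight (d + 1)))
    (identity_tight (d + 2) (by omega)) (Nat.succ_pos _)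
    (forall_fin_two (Nat.succ_pos (d + 1)) (Nat.succ_pos d)) _ ?_ ?_ ?_
  · rintro ⟨i, j⟩
    match i, j with
    | (0 : Fin 2), _ => rfl
    | (1 : Fin 2), j => exact Fin.elim0 j
  · refine forall_option_sigma ?_ ?_ ?_
    · intro a (ha : a < 2 * (d + 2))
      exact (mate a ha).exists_mate
    · intro j
      obtain rfl : j = (0 : Fin 1) := Subsingleton.elim (α := Fin 1) _ _
      intro a (ha : a < 2 * (d + 2))
      exact (mate a ha).symm.exists_mate
    · intro (j : Fin 0)
      exact j.elim0
  · refine forall_fin_two ?_ ?_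
    · intro a (ha : a < 2 * (d + 2))
      exact reach_of_guest (some ⟨(0 : Fin 2), (0 : Fin 1)⟩) a (id a ha)
    · intro a (ha : a < 2 * (d + 1))
      by_cases h1 : d + 1 ≤ a
      · exact reach_of_guest none (a + 2) (bot a h1 ha).symm
      · exact reach_of_guest (some ⟨(0 : Fin 2), (0 : Fin 1)⟩) (2 * d + 3 - a)
          ((mid _ a (by omega) (by omega)).symm.trans (id _ (by omega)))

variable (hd : 1 ≤ d)

/-- A product `x E_{d+1} y`, substituted into `mulRight`. -/
abbrev identityStack : ∀ i, Tangle ((mulRight d).col i) :=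
  fun i : Fin 2 => match i with
    | 0 => identity (Col.ofNat (d + 2))
    | 1 => stack d (d + 1) (d - 1) 2 (by omega) (by omega) two_pos

/-- The product of an element of `P_{d+2}` and `x E_{d+1} y`. -/
abbrev mulStack : Tangle (Col.ofNat (d + 2)) :=
  triple (d + 2) d d (d + 2) (d + 3) (d + 1) (d + 1) (d - 1) (by omega) (by omega) (by omega)
    (by omega) (by omega) (by omega) (by omega)

/-- No string needs straightening, as `E_{d+1}` is already absorbed into the stack. The resulting
chain `z x E_{d+1} y` is factored in another way in `exists_composite_stack_pair_cap`. -/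
theorem exists_composite_mulRight_identity_stack :
    ∃ e : Composite (mulRight d) (identityStack d hd) (mulStack d hd),
      e.box = sigmaFinTwoEquiv _ (m := 1) (n := 2) rfl rfl rfl := by
  let E := hostArc _ (identityStack d hd) none
  let m₀ := guestArc _ (identityStack d hd) (0 : Fin 2) none
  let m₁ := guestArc _ (identityStack d hd) (1 : Fin 2) none
  let z := guestArc _ (identityStack d hd) (0 : Fin 2) (some (0 : Fin 1))
  let x := guestArc _ (identityStack d hd) (1 : Fin 2) (some (0 : Fin 2))
  let y := guestArc _ (identityStack d hd) (1 : Fin 2) (some (1 : Fin 2))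
  have top : ∀ a, a < d + 3 → E a = m₀ a := fun a h =>
    (hostArc_congr (pair_arc_first _ _ _ _ _ _ _ _ _ _ _ h)).trans (hostArc_some _ _)
  have mid : ∀ a a', a' < d + 1 → a + a' = 2 * d + 3 → m₀ a = m₁ a' := fun a a' h h' =>
    (hostArc_some _ _).symm.trans <|
      (hostArc_congr (pair_arc_mid _ _ _ _ _ _ _ _ _ _ _ h (by omega))).trans (hostArc_some _ _)
  have bot : ∀ a, d + 1 ≤ a → a < 2 * (d + 1) → E (a + 2) = m₁ a := fun a h h' =>
    (hostArc_congr (pair_arc_last _ _ _ _ _ _ _ _ _ _ _ (by omega) (by omega)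
      (by omega))).trans (hostArc_some _ _)
  have id : ∀ a, a < 2 * (d + 2) → m₀ a = z a := fun a h =>
    guestArc_congr (identity_arc (d + 2) h)
  have s₀ : ∀ a, a < d + 1 → m₁ a = x a := fun a h =>
    guestArc_congr (stack_arc_first d (d + 1) (d - 1) 2 _ _ _ (0 : Fin 2) rfl (by omega))
  have s₁ : ∀ a, d - 1 ≤ a → a < 2 * d → m₁ (a + 2) = y a := fun a h h' =>
    guestArc_congr (stack_arc_last d (d + 1) (d - 1) 2 _ _ _ (1 : Fin 2) rfl h h')
  have s₂ : ∀ a a', a' < d - 1 → a + a' + 1 = 2 * d → x a = y a' := fun a a' h h' =>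
    guestArc_congr (stack_arc_mid d (d + 1) (d - 1) 2 _ _ _ (0 : Fin 2) (1 : Fin 2) rfl h h')
  have mate₁ : ∀ a, a < d + 3 → Traced _ (identityStack d hd) (mulStack d hd)
      (sigmaFinTwoEquiv _ (m := 1) (n := 2) rfl rfl rfl) none a
      (some ⟨(0 : Fin 2), (0 : Fin 1)⟩) a := fun a h =>
    .ext_int (by omega) (triple_arc_first _ _ _ _ _ _ _ _ _ _ _ _ _ _ _ h)
      ((top a h).trans (id a (by omega)))
  have mate₂ : ∀ a a', a' < d + 1 → a + a' = 2 * d + 3 → Traced _ (identityStack d hd)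
      (mulStack d hd) (sigmaFinTwoEquiv _ (m := 1) (n := 2) rfl rfl rfl)
      (some ⟨(0 : Fin 2), (0 : Fin 1)⟩) a (some ⟨(1 : Fin 2), (0 : Fin 2)⟩) a' := fun a a' h h' =>
    .int_int (by omega) (triple_arc_mid _ _ _ _ _ _ _ _ _ _ _ _ _ _ _ h (by omega))
      ((id a (by omega)).symm.trans ((mid a a' h h').trans (s₀ a' h)))
  have mate₃ : ∀ a a', a' < d - 1 → a + a' + 1 = 2 * d → Traced _ (identityStack d hd)
      (mulStack d hd) (sigmaFinTwoEquiv _ (m := 1) (n := 2) rfl rfl rfl)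
      (some ⟨(1 : Fin 2), (0 : Fin 2)⟩) a (some ⟨(1 : Fin 2), (1 : Fin 2)⟩) a' := fun a a' h h' =>
    .int_int (by omega) (triple_arc_mid' _ _ _ _ _ _ _ _ _ _ _ _ _ _ _ h (by omega))
      (s₂ a a' h h')
  have mate₄ : ∀ a, d - 1 ≤ a → a < 2 * d → Traced _ (identityStack d hd)
      (mulStack d hd) (sigmaFinTwoEquiv _ (m := 1) (n := 2) rfl rfl rfl)
      none (a + 4) (some ⟨(1 : Fin 2), (1 : Fin 2)⟩) a := fun a h h' =>
    .ext_int (by omega) (triple_arc_last _ _ _ _ _ _ _ _ _ _ _ _ _ _ _ (by omega) (by omega)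
      (by omega)) ((bot (a + 2) (by omega) (by omega)).trans (s₁ a h h'))
  refine exists_composite (pair_tight _ _ _ _ _ _ _ _ _ _ _)
    (forall_fin_two (identity_tight (d + 2) (by omega)) (stack_tight _ _ _ _ _ _ _))
    (triple_tight _ _ _ _ _ _ _ _ _ _ _ _ _ _ _) (Nat.succ_pos _)
    (forall_fin_two (Nat.succ_pos (d + 1)) (Nat.succ_pos d)) _ ?_ ?_ ?_
  · rintro ⟨i, j⟩
    match i, j with
    | (0 : Fin 2), (0 : Fin 1) => rfl
    | (1 : Fin 2), (0 : Fin 2) => rfl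
    | (1 : Fin 2), (1 : Fin 2) => rfl
  · refine forall_option_sigma ?_ ?_ (forall_fin_two ?_ ?_)
    · intro a (ha : a < 2 * (d + 2))
      by_cases h1 : a < d + 3
      · exact (mate₁ a h1).exists_mate
      · obtain ⟨a, rfl⟩ : ∃ a', a = a' + 4 := ⟨a - 4, by omega⟩
        exact (mate₄ a (by omega) (by omega)).exists_mate
    · intro j
      obtain rfl : j = (0 : Fin 1) := Subsingleton.elim (α := Fin 1) _ _
      intro a (ha : a < 2 * (d + 2))
      by_cases h1 : a < d + 3
      · exact (mate₁ a h1).symm.exists_mate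
      · exact (mate₂ a (2 * d + 3 - a) (by omega) (by omega)).exists_mate
    · intro a (ha : a < 2 * d)
      by_cases h1 : a < d + 1
      · exact (mate₂ (2 * d + 3 - a) a h1 (by omega)).symm.exists_mate
      · exact (mate₃ a (2 * d - 1 - a) (by omega) (by omega)).exists_mate
    · intro a (ha : a < 2 * d)
      by_cases h1 : a < d - 1
      · exact (mate₃ (2 * d - 1 - a) a h1 (by omega)).symm.exists_mate
      · exact (mate₄ a (by omega) ha).symm.exists_mate
  · refine forall_fin_two ?_ ?_
    · intro a (ha : a < 2 * (d + 2))
      exact reach_of_guest (some ⟨(0 : Fin 2), (0 : Fin 1)⟩) a (id a ha)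
    · intro a (ha : a < 2 * (d + 1))
      by_cases h1 : a < d + 1
      · exact reach_of_guest (some ⟨(1 : Fin 2), (0 : Fin 2)⟩) a (s₀ a h1)
      · obtain ⟨a, rfl⟩ : ∃ a', a = a' + 2 := ⟨a - 2, by omega⟩
        exact reach_of_guest (some ⟨(1 : Fin 2), (1 : Fin 2)⟩) a (s₁ a (by omega) (by omega))

end

end Tangle
end PlanarAlg

/-! ### Factorizations through `u E_{d+2} v` -/

namespace PlanarAlg

namespace Tangle

section

variable (d : ℕ) (hd : 1 ≤ d)

/-- The tangle `u E_{d+2} v` for `u, v ∈ P_{d+1}`. -/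
abbrev stackSucc : Tangle (Col.ofNat (d + 2)) :=
  stack (d + 1) (d + 2) d 2 rfl rfl two_pos

/-- The two factors of `mulStack`. -/
abbrev pairCap : ∀ i, Tangle ((stackSucc d).col i) :=
  fun i : Fin 2 => match i with
    | 0 => pair (d + 2) d (d + 1) (d + 3) (d - 1) (d + 1) (by omega) (by omega) (by omega)
      (by omega) (by omega)
    | 1 => cap d (d - 1) hd (by omega)

/-- This is `z x E_{d+1} y = u E_{d+2} (E_{d+1} y)`. The element `u ∈ P_{d+1}` is the chain of `z`
and `x` with the top right-most point of `z` moved to the bottom right of `u`. The one string to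
straighten starts at the bottom right-most point of `z`, turns at the arc of `E_{d+1} y` and ends at
the bottom right-most external point. -/
theorem exists_composite_stack_pair_cap :
    ∃ e : Composite (stackSucc d) (pairCap d hd) (mulStack d hd),
      e.box = sigmaFinTwoEquiv _ (m := 2) (n := 1) rfl rfl rfl := by
  let E := hostArc _ (pairCap d hd) none
  let m₀ := guestArc _ (pairCap d hd) (0 : Fin 2) none
  let m₁ := guestArc _ (pairCap d hd) (1 : Fin 2) none
  let z := guestArc _ (pairCap d hd) (0 : Fin 2) (some (0 : Fin 2))
  let x := guestArc _ (pairCap d hd) (0 : Fin 2) (some (1 : Fin 2))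
  let y := guestArc _ (pairCap d hd) (1 : Fin 2) (some (0 : Fin 1))
  have top : ∀ a, a < d + 2 → E a = m₀ a := fun a h =>
    (hostArc_congr (stack_arc_first (d + 1) (d + 2) d 2 _ _ _ (0 : Fin 2) rfl h)).trans
      (hostArc_some _ _)
  have mid : ∀ a a', a' < d → a + a' = 2 * d + 1 → m₀ a = m₁ a' := fun a a' h h' =>
    (hostArc_some _ _).symm.trans <|
      (hostArc_congr (stack_arc_mid (d + 1) (d + 2) d 2 _ _ _ (0 : Fin 2) (1 : Fin 2) rfl h
        (by omega))).trans (hostArc_some _ _)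
  have bot : ∀ a, d ≤ a → a < 2 * (d + 1) → E (a + 2) = m₁ a := fun a h h' =>
    (hostArc_congr (stack_arc_last (d + 1) (d + 2) d 2 _ _ _ (1 : Fin 2) rfl h h')).trans
      (hostArc_some _ _)
  have p₀ : ∀ a, a < d + 3 → m₀ a = z a := fun a h =>
    guestArc_congr (pair_arc_first _ _ _ _ _ _ _ _ _ _ _ h)
  have p₁ : ∀ a, d + 1 ≤ a → a < 2 * d → m₀ (a + 2) = x a := fun a h h' =>
    guestArc_congr (pair_arc_last _ _ _ _ _ _ _ _ _ _ _ (by omega) (by omega) (by omega))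
  have p₂ : ∀ a a', a' < d + 1 → a + a' = 2 * d + 3 → z a = x a' := fun a a' h h' =>
    guestArc_congr (pair_arc_mid _ _ _ _ _ _ _ _ _ _ _ h (by omega))
  have c₀ : ∀ a, a < d - 1 → m₁ a = y a := fun a h =>
    guestArc_congr (cap_arc d (d - 1) hd (by omega) (by omega) (.inl ⟨h, rfl⟩))
  have c₁ : ∀ a, d - 1 ≤ a → a < 2 * d → m₁ (a + 2) = y a := fun a h h' =>
    guestArc_congr (cap_arc d (d - 1) hd (by omega) h' (.inr ⟨h, rfl⟩))
  have c₂ : m₁ (d - 1) = m₁ d := by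
    have h : m₁ (d - 1) = m₁ (d - 1 + 1) :=
      guestArc_congr (cap_arc_cap d (d - 1) hd (by omega))
    rwa [Nat.sub_add_cancel hd] at h
  have t : ∀ a, a < d + 3 → E a = z a := by
    intro a h
    by_cases h1 : a < d + 2
    · exact (top a h1).trans (p₀ a h)
    · obtain rfl : a = d + 2 := by omega
      rw [bot d le_rfl (by omega), ← c₂, ← mid (d + 2) (d - 1) (by omega) (by omega), p₀ _ h]
  have mate₁ : ∀ a, a < d + 3 → Traced _ (pairCap d hd) (mulStack d hd)
      (sigmaFinTwoEquiv _ (m := 2) (n := 1) rfl rfl rfl) none a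
      (some ⟨(0 : Fin 2), (0 : Fin 2)⟩) a := fun a h =>
    .ext_int (by omega) (triple_arc_first _ _ _ _ _ _ _ _ _ _ _ _ _ _ _ h) (t a h)
  have mate₂ : ∀ a a', a' < d + 1 → a + a' = 2 * d + 3 → Traced _ (pairCap d hd)
      (mulStack d hd) (sigmaFinTwoEquiv _ (m := 2) (n := 1) rfl rfl rfl)
      (some ⟨(0 : Fin 2), (0 : Fin 2)⟩) a (some ⟨(0 : Fin 2), (1 : Fin 2)⟩) a' := fun a a' h h' =>
    .int_int (by omega) (triple_arc_mid _ _ _ _ _ _ _ _ _ _ _ _ _ _ _ h (by omega))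
      (p₂ a a' h h')
  have mate₃ : ∀ a a', a' < d - 1 → a + a' + 1 = 2 * d → Traced _ (pairCap d hd)
      (mulStack d hd) (sigmaFinTwoEquiv _ (m := 2) (n := 1) rfl rfl rfl)
      (some ⟨(0 : Fin 2), (1 : Fin 2)⟩) a (some ⟨(1 : Fin 2), (0 : Fin 1)⟩) a' := fun a a' h h' =>
    .int_int (by omega) (triple_arc_mid' _ _ _ _ _ _ _ _ _ _ _ _ _ _ _ h (by omega))
      ((p₁ a (by omega) (by omega)).symm.trans
        ((mid (a + 2) a' (by omega) (by omega)).trans (c₀ a' h)))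
  have mate₄ : ∀ a, d - 1 ≤ a → a < 2 * d → Traced _ (pairCap d hd)
      (mulStack d hd) (sigmaFinTwoEquiv _ (m := 2) (n := 1) rfl rfl rfl)
      none (a + 4) (some ⟨(1 : Fin 2), (0 : Fin 1)⟩) a := fun a h h' =>
    .ext_int (by omega) (triple_arc_last _ _ _ _ _ _ _ _ _ _ _ _ _ _ _ (by omega) (by omega)
      (by omega)) ((bot (a + 2) (by omega) (by omega)).trans (c₁ a h h'))
  refine exists_composite (stack_tight _ _ _ _ _ _ _)
    (forall_fin_two (pair_tight _ _ _ _ _ _ _ _ _ _ _) (cap_tight _ _ _ _))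
    (triple_tight _ _ _ _ _ _ _ _ _ _ _ _ _ _ _) (Nat.succ_pos _)
    (fun _ => Nat.succ_pos d) _ ?_ ?_ ?_
  · rintro ⟨i, j⟩
    match i, j with
    | (0 : Fin 2), (0 : Fin 2) => rfl
    | (0 : Fin 2), (1 : Fin 2) => rfl
    | (1 : Fin 2), (0 : Fin 1) => rfl
  · refine forall_option_sigma ?_ (forall_fin_two ?_ ?_) ?_
    · intro a (ha : a < 2 * (d + 2))
      by_cases h1 : a < d + 3
      · exact (mate₁ a h1).exists_mate
      · obtain ⟨a, rfl⟩ : ∃ a', a = a' + 4 := ⟨a - 4, by omega⟩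
        exact (mate₄ a (by omega) (by omega)).exists_mate
    · intro a (ha : a < 2 * (d + 2))
      by_cases h1 : a < d + 3
      · exact (mate₁ a h1).symm.exists_mate
      · exact (mate₂ a (2 * d + 3 - a) (by omega) (by omega)).exists_mate
    · intro a (ha : a < 2 * d)
      by_cases h1 : a < d + 1
      · exact (mate₂ (2 * d + 3 - a) a h1 (by omega)).symm.exists_mate
      · exact (mate₃ a (2 * d - 1 - a) (by omega) (by omega)).exists_mate
    · intro j
      obtain rfl : j = (0 : Fin 1) := Subsingleton.elim (α := Fin 1) _ _
      intro a (ha : a < 2 * d)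
      by_cases h1 : a < d - 1
      · exact (mate₃ (2 * d - 1 - a) a h1 (by omega)).symm.exists_mate
      · exact (mate₄ a (by omega) ha).symm.exists_mate
  · refine forall_fin_two ?_ ?_
    · intro a (ha : a < 2 * (d + 1))
      by_cases h1 : a < d + 3
      · exact reach_of_guest (some ⟨(0 : Fin 2), (0 : Fin 2)⟩) a (p₀ a h1)
      · obtain ⟨a, rfl⟩ : ∃ a', a = a' + 2 := ⟨a - 2, by omega⟩
        exact reach_of_guest (some ⟨(0 : Fin 2), (1 : Fin 2)⟩) a (p₁ a (by omega) (by omega))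
    · intro a (ha : a < 2 * (d + 1))
      by_cases h1 : a < d - 1
      · exact reach_of_guest (some ⟨(1 : Fin 2), (0 : Fin 1)⟩) a (c₀ a h1)
      · by_cases h2 : a = d - 1
        · exact reach_of_guest none (d + 2) (by
            rw [h2]
            exact c₂.trans (bot d le_rfl (by omega)).symm)
        · exact reach_of_guest none (a + 2) (bot a (by omega) ha).symm

/-- The tangles for a product `(w E_{d+1} x) E_{d+2} (E_{d+1} y)`. -/
abbrev stackCap : ∀ i, Tangle ((stackSucc d).col i) :=
  fun i : Fin 2 => match i with
    | 0 => stack d (d + 1) (d - 1) 2 (by omega) (by omega) two_pos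
    | 1 => cap d (d - 1) hd (by omega)

/-- The diagram is `w E_{d+1} x E_{d+2} E_{d+1} y`. The bottom right-most point of `x` reaches the
external box through the arc of `E_{d+1} y`, which separates the three boxes as in the three-box
stack. -/
theorem exists_composite_stack_stack_cap :
    ∃ e : Composite (stackSucc d) (stackCap d hd)
        (stack d (d + 2) (d - 1) 3 (by omega) (by omega) three_pos),
      e.box = sigmaFinTwoEquiv _ (m := 2) (n := 1) rfl rfl rfl := by
  let E := hostArc _ (stackCap d hd) none
  let m₀ := guestArc _ (stackCap d hd) (0 : Fin 2) none
  let m₁ := guestArc _ (stackCap d hd) (1 : Fin 2) none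
  let x := guestArc _ (stackCap d hd) (0 : Fin 2) (some (0 : Fin 2))
  let y := guestArc _ (stackCap d hd) (0 : Fin 2) (some (1 : Fin 2))
  let z := guestArc _ (stackCap d hd) (1 : Fin 2) (some (0 : Fin 1))
  have top : ∀ a, a < d + 2 → E a = m₀ a := fun a h =>
    (hostArc_congr (stack_arc_first (d + 1) (d + 2) d 2 _ _ _ (0 : Fin 2) rfl h)).trans
      (hostArc_some _ _)
  have mid : ∀ a a', a' < d → a + a' = 2 * d + 1 → m₀ a = m₁ a' := fun a a' h h' =>
    (hostArc_some _ _).symm.trans <|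
      (hostArc_congr (stack_arc_mid (d + 1) (d + 2) d 2 _ _ _ (0 : Fin 2) (1 : Fin 2) rfl h
        (by omega))).trans (hostArc_some _ _)
  have bot : ∀ a, d ≤ a → a < 2 * (d + 1) → E (a + 2) = m₁ a := fun a h h' =>
    (hostArc_congr (stack_arc_last (d + 1) (d + 2) d 2 _ _ _ (1 : Fin 2) rfl h h')).trans
      (hostArc_some _ _)
  have s₀ : ∀ a, a < d + 1 → m₀ a = x a := fun a h =>
    guestArc_congr (stack_arc_first d (d + 1) (d - 1) 2 _ _ _ (0 : Fin 2) rfl (by omega))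
  have s₁ : ∀ a, d - 1 ≤ a → a < 2 * d → m₀ (a + 2) = y a := fun a h h' =>
    guestArc_congr (stack_arc_last d (d + 1) (d - 1) 2 _ _ _ (1 : Fin 2) rfl h h')
  have s₂ : ∀ a a', a' < d - 1 → a + a' + 1 = 2 * d → x a = y a' := fun a a' h h' =>
    guestArc_congr (stack_arc_mid d (d + 1) (d - 1) 2 _ _ _ (0 : Fin 2) (1 : Fin 2) rfl h h')
  have c₀ : ∀ a, a < d - 1 → m₁ a = z a := fun a h =>
    guestArc_congr (cap_arc d (d - 1) hd (by omega) (by omega) (.inl ⟨h, rfl⟩))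
  have c₁ : ∀ a, d - 1 ≤ a → a < 2 * d → m₁ (a + 2) = z a := fun a h h' =>
    guestArc_congr (cap_arc d (d - 1) hd (by omega) h' (.inr ⟨h, rfl⟩))
  have c₂ : m₁ (d - 1) = m₁ d := by
    have h : m₁ (d - 1) = m₁ (d - 1 + 1) :=
      guestArc_congr (cap_arc_cap d (d - 1) hd (by omega))
    rwa [Nat.sub_add_cancel hd] at h
  have t : ∀ a, d - 1 ≤ a → a < d + 1 → E (a + 2) = y a := by
    intro a h h'
    by_cases h1 : a < d
    · exact (top (a + 2) (by omega)).trans (s₁ a h (by omega))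
    · obtain rfl : a = d := by omega
      rw [bot a le_rfl (by omega), ← c₂, ← mid (a + 2) (a - 1) (by omega) (by omega),
        s₁ a h (by omega)]
  have mate₁ : ∀ a, a < d + 1 → Traced _ (stackCap d hd)
      (stack d (d + 2) (d - 1) 3 (by omega) (by omega) three_pos)
      (sigmaFinTwoEquiv _ (m := 2) (n := 1) rfl rfl rfl) none a
      (some ⟨(0 : Fin 2), (0 : Fin 2)⟩) a := fun a h =>
    .ext_int (by omega) (stack_arc_first d (d + 2) (d - 1) 3 _ _ _ (0 : Fin 3) rfl (by omega))
      ((top a (by omega)).trans (s₀ a h))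
  have mate₂ : ∀ a a', a' < d - 1 → a + a' + 1 = 2 * d → Traced _ (stackCap d hd)
      (stack d (d + 2) (d - 1) 3 (by omega) (by omega) three_pos)
      (sigmaFinTwoEquiv _ (m := 2) (n := 1) rfl rfl rfl)
      (some ⟨(0 : Fin 2), (0 : Fin 2)⟩) a (some ⟨(0 : Fin 2), (1 : Fin 2)⟩) a' := fun a a' h h' =>
    .int_int (by omega) (stack_arc_mid d (d + 2) (d - 1) 3 _ _ _ (0 : Fin 3) (1 : Fin 3) rfl h h')
      (s₂ a a' h h')
  have mate₃ : ∀ a, d - 1 ≤ a → a < d + 1 → Traced _ (stackCap d hd)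
      (stack d (d + 2) (d - 1) 3 (by omega) (by omega) three_pos)
      (sigmaFinTwoEquiv _ (m := 2) (n := 1) rfl rfl rfl) none (a + 2)
      (some ⟨(0 : Fin 2), (1 : Fin 2)⟩) a := fun a h h' =>
    .ext_int (by omega) (stack_arc_right d (d + 2) (d - 1) 3 _ _ _ (1 : Fin 3) h (by omega) rfl)
      (t a h h')
  have mate₄ : ∀ a a', a' < d - 1 → a + a' + 1 = 2 * d → Traced _ (stackCap d hd)
      (stack d (d + 2) (d - 1) 3 (by omega) (by omega) three_pos)
      (sigmaFinTwoEquiv _ (m := 2) (n := 1) rfl rfl rfl)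
      (some ⟨(0 : Fin 2), (1 : Fin 2)⟩) a (some ⟨(1 : Fin 2), (0 : Fin 1)⟩) a' := fun a a' h h' =>
    .int_int (by omega) (stack_arc_mid d (d + 2) (d - 1) 3 _ _ _ (1 : Fin 3) (2 : Fin 3) rfl h h')
      ((s₁ a (by omega) (by omega)).symm.trans
        ((mid (a + 2) a' (by omega) (by omega)).trans (c₀ a' h)))
  have mate₅ : ∀ a, d - 1 ≤ a → a < 2 * d → Traced _ (stackCap d hd)
      (stack d (d + 2) (d - 1) 3 (by omega) (by omega) three_pos)
      (sigmaFinTwoEquiv _ (m := 2) (n := 1) rfl rfl rfl) none (a + 4)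
      (some ⟨(1 : Fin 2), (0 : Fin 1)⟩) a := fun a h h' =>
    .ext_int (by omega) (stack_arc_last d (d + 2) (d - 1) 3 _ _ _ (2 : Fin 3) rfl h h')
      ((bot (a + 2) (by omega) (by omega)).trans (c₁ a h h'))
  refine exists_composite (stack_tight _ _ _ _ _ _ _)
    (forall_fin_two (stack_tight _ _ _ _ _ _ _) (cap_tight _ _ _ _))
    (stack_tight _ _ _ _ _ _ _) (Nat.succ_pos _) (fun _ => Nat.succ_pos d) _ ?_ ?_ ?_
  · rintro ⟨i, j⟩
    match i, j with
    | (0 : Fin 2), (0 : Fin 2) => rfl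
    | (0 : Fin 2), (1 : Fin 2) => rfl
    | (1 : Fin 2), (0 : Fin 1) => rfl
  · refine forall_option_sigma ?_ (forall_fin_two ?_ ?_) ?_
    · intro a (ha : a < 2 * (d + 2))
      by_cases h1 : a < d + 1
      · exact (mate₁ a h1).exists_mate
      · by_cases h2 : a < d + 3
        · obtain ⟨a, rfl⟩ : ∃ a', a = a' + 2 := ⟨a - 2, by omega⟩
          exact (mate₃ a (by omega) (by omega)).exists_mate
        · obtain ⟨a, rfl⟩ : ∃ a', a = a' + 4 := ⟨a - 4, by omega⟩
          exact (mate₅ a (by omega) (by omega)).exists_mate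
    · intro a (ha : a < 2 * d)
      by_cases h1 : a < d + 1
      · exact (mate₁ a h1).symm.exists_mate
      · exact (mate₂ a (2 * d - 1 - a) (by omega) (by omega)).exists_mate
    · intro a (ha : a < 2 * d)
      by_cases h1 : a < d - 1
      · exact (mate₂ (2 * d - 1 - a) a h1 (by omega)).symm.exists_mate
      · by_cases h2 : a < d + 1
        · exact (mate₃ a (by omega) h2).symm.exists_mate
        · exact (mate₄ a (2 * d - 1 - a) (by omega) (by omega)).exists_mate
    · intro j
      obtain rfl : j = (0 : Fin 1) := Subsingleton.elim (α := Fin 1) _ _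
      intro a (ha : a < 2 * d)
      by_cases h1 : a < d - 1
      · exact (mate₄ (2 * d - 1 - a) a h1 (by omega)).symm.exists_mate
      · exact (mate₅ a (by omega) ha).symm.exists_mate
  · refine forall_fin_two ?_ ?_
    · intro a (ha : a < 2 * (d + 1))
      by_cases h1 : a < d + 1
      · exact reach_of_guest (some ⟨(0 : Fin 2), (0 : Fin 2)⟩) a (s₀ a h1)
      · obtain ⟨a, rfl⟩ : ∃ a', a = a' + 2 := ⟨a - 2, by omega⟩
        exact reach_of_guest (some ⟨(0 : Fin 2), (1 : Fin 2)⟩) a (s₁ a (by omega) (by omega))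
    · intro a (ha : a < 2 * (d + 1))
      by_cases h1 : a < d - 1
      · exact reach_of_guest (some ⟨(1 : Fin 2), (0 : Fin 1)⟩) a (c₀ a h1)
      · by_cases h2 : a = d - 1
        · exact reach_of_guest none (d + 2) (by
            rw [h2]
            exact c₂.trans (bot d le_rfl (by omega)).symm)
        · exact reach_of_guest none (a + 2) (bot a (by omega) ha).symm

end

end Tangle
end PlanarAlg

/-- Arguments in spans are reduced to arguments in the spanning sets one coordinate at a time, by
linearity in that coordinate. -/
theorem MultilinearMap.map_mem_span {R ι N : Type*} [Finite ι] {M : ι → Type*} [CommSemiring R]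
    [∀ i, AddCommMonoid (M i)] [∀ i, Module R (M i)] [AddCommMonoid N] [Module R N]
    (f : MultilinearMap R M N) (s : ∀ i, Set (M i)) (x : ∀ i, M i)
    (hx : ∀ i, x i ∈ Submodule.span R (s i)) :
    f x ∈ Submodule.span R (f '' Set.univ.pi s) := by
  classical
  have := Fintype.ofFinite ι
  -- `t` is the set of coordinates which may still be arbitrary members of the spans.
  suffices key : ∀ (t : Finset ι) (x : ∀ i, M i), (∀ i ∈ t, x i ∈ Submodule.span R (s i)) →
      (∀ i ∉ t, x i ∈ s i) → f x ∈ Submodule.span R (f '' Set.univ.pi s) from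
    key Finset.univ x (fun i _ => hx i) fun i h => absurd (Finset.mem_univ i) h
  intro t
  induction t using Finset.induction_on with
  | empty => exact fun x _ h => Submodule.subset_span ⟨x, fun i _ => h i (Finset.notMem_empty i), rfl⟩
  | insert j t hj ih =>
    intro x h h'
    have key : ∀ y ∈ Submodule.span R (s j),
        f (Function.update x j y) ∈ Submodule.span R (f '' Set.univ.pi s) := by
      intro y hy
      induction hy using Submodule.span_induction with
      | mem y hy =>
        refine ih _ (fun i hi => ?_) fun i hi => ?_
        · rw [Function.update_of_ne (by rintro rfl; exact hj hi)]
          exact h i (Finset.mem_insert_of_mem hi)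
        · by_cases hij : i = j
          · subst hij
            rwa [Function.update_self]
          · rw [Function.update_of_ne hij]
            exact h' i (by simp [hij, hi])
      | zero => simp
      | add y z _ _ hy hz =>
        rw [f.map_update_add]
        exact add_mem hy hz
      | smul c y _ hy =>
        rw [f.map_update_smul]
        exact Submodule.smul_mem _ c hy
    simpa using key (x j) (h j (Finset.mem_insert_self j t))

/-! ### Spans of the values of tangles -/

namespace PlanarAlg

open Tangle

namespace PlanarAlgebra

variable (P : PlanarAlgebra.{u})

/-- The boxes of `U` have the same colours as those of the `S i` only propositionally. Heterogeneous
equality replaces the casts, and for concrete tangles it holds by reflexivity. -/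
theorem Z_composite_of_heq {c : Col} {T : Tangle c} {S : ∀ i, Tangle (T.col i)} {U : Tangle c}
    (e : Composite T S U) (x : ∀ j, P.space (U.col j)) (y : ∀ i j, P.space ((S i).col j))
    (h : ∀ i j, HEq (x (e.box ⟨i, j⟩)) (y i j)) : P.Z U x = P.Z T fun i => P.Z (S i) (y i) := by
  rw [P.Z_composite e]
  congr 1
  funext i
  congr 1
  funext j
  exact eq_of_heq ((cast_heq _ _).trans (h i j))

/-- The span of all values of the tangle `T`. -/
def valueSpan {c : Col} (T : Tangle c) : Submodule ℂ (P.space c) :=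
  Submodule.span ℂ (Set.range (P.Z T))

/-- The values of a tangle on arguments taken from spanning sets span a space which contains all
of its values. -/
theorem map_Z_mem_span {c : Col} (T : Tangle c) (s : ∀ i, Set (P.space (T.col i)))
    (x : ∀ i, P.space (T.col i)) (hx : ∀ i, x i ∈ Submodule.span ℂ (s i)) :
    P.Z T x ∈ Submodule.span ℂ (P.Z T '' Set.univ.pi s) :=
  have := T.finite_box
  (P.Z T).map_mem_span s x hx

/-! ### Consequences of the depth condition -/

section Depth

variable (d : ℕ) (hd : 1 ≤ d)

/-- Each generator `x E_{d+1} y` is the value of the two-box stack at `(x, y)`: first `x E_{d+1}` is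
turned into a cap on `x`, then this is multiplied by `y`. -/
theorem valueSpan_stack_of_depthSpan (h : P.depthSpan d hd = ⊤) :
    P.valueSpan (stack d (d + 1) (d - 1) 2 (by omega) (by omega) two_pos) = ⊤ := by
  rw [eq_top_iff, ← h]
  refine Submodule.span_le.2 ?_
  rintro _ ⟨x, y, rfl⟩
  refine Submodule.subset_span ⟨fun i => match i with
    | (0 : Fin 2) => x
    | (1 : Fin 2) => y, ?_⟩
  obtain ⟨e, he⟩ := exists_composite_mult_incl_jones d hd
  obtain ⟨e', he'⟩ := exists_composite_mult_cap_incl d hd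
  have h₁ := P.Z_composite_of_heq e (fun _ => x) (fun i => match i with
    | (0 : Fin 2) => fun _ => x
    | (1 : Fin 2) => fun j => Fin.elim0 j) (by
      intro i j
      match i, j with
      | (0 : Fin 2), _ => exact HEq.rfl
      | (1 : Fin 2), j => exact Fin.elim0 j)
  have h₂ := P.Z_composite_of_heq e' (fun i => match i with
    | (0 : Fin 2) => x
    | (1 : Fin 2) => y) (fun i => match i with
    | (0 : Fin 2) => fun _ => x
    | (1 : Fin 2) => fun _ => y) (by
      -- The labels of the two boxes differ, so the numbering of boxes has to be known explicitly;
      -- for `e` it did not matter, as there is only one box.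
      rw [he']
      intro i j
      match i, j with
      | (0 : Fin 2), (0 : Fin 1) => exact HEq.rfl
      | (1 : Fin 2), (0 : Fin 1) => exact HEq.rfl)
  refine h₂.trans ?_
  unfold mul
  congr 1
  funext i
  match i with
  | (0 : Fin 2) =>
    refine h₁.trans ?_
    show _ = P.Z (mult (Col.ofNat (d + 1))) _
    congr 1
    funext i
    match i with
    | (0 : Fin 2) => rfl
    | (1 : Fin 2) =>
      show P.Z (jones (d + 1) _) _ = P.Z (jones (d + 1) _) _
      congr 1
  | (1 : Fin 2) => rfl

/-- Write `z = z · 1`, expand `1` in products `x E_{d+1} y` and use `z x E_{d+1} y = u E_{d+2}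
(E_{d+1} y)`. The second factor is recorded in the special form `E_{d+1} y`, since
`valueSpan_stack_three` depends on it. -/
theorem span_stackSucc_cap
    (h : P.valueSpan (stack d (d + 1) (d - 1) 2 (by omega) (by omega) two_pos) = ⊤) :
    Submodule.span ℂ {z | ∃ (x : P.space (Col.ofNat (d + 1))) (y : P.space (Col.ofNat d)),
      z = P.Z (stackSucc d) (fun i => match i with
        | (0 : Fin 2) => x
        | (1 : Fin 2) => P.Z (cap d (d - 1) hd (by omega)) fun _ => y)} = ⊤ := by
  rw [eq_top_iff]
  rintro z -
  obtain ⟨e₃, he₃⟩ := exists_composite_mulRight_identity_unit d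
  obtain ⟨e₄, he₄⟩ := exists_composite_mulRight_identity_stack d hd
  obtain ⟨e₅, he₅⟩ := exists_composite_stack_pair_cap d hd
  have h₃ := P.Z_composite_of_heq e₃ (fun _ => z) (fun i => match i with
    | (0 : Fin 2) => fun _ => z
    | (1 : Fin 2) => fun j => Fin.elim0 j) (by
      intro i j
      match i, j with
      | (0 : Fin 2), _ => exact HEq.rfl
      | (1 : Fin 2), j => exact Fin.elim0 j)
  rw [P.Z_identity] at h₃
  rw [h₃]
  -- Only the second argument, the unit, is expanded; the first one is left arbitrary, which is why
  -- its spanning set is everything.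
  refine Submodule.span_le.2 ?_ (P.map_Z_mem_span (mulRight d) (fun i => match i with
    | (0 : Fin 2) => Set.univ
    | (1 : Fin 2) =>
      Set.range (P.Z (stack d (d + 1) (d - 1) 2 (by omega) (by omega) two_pos))) _ ?_)
  · rintro _ ⟨x, hx, rfl⟩
    obtain ⟨y, hy⟩ : x (1 : Fin 2) ∈
      Set.range (P.Z (stack d (d + 1) (d - 1) 2 (by omega) (by omega) two_pos)) :=
        hx (1 : Fin 2) trivial
    have h₄ := P.Z_composite_of_heq e₄ (fun i => match i with
      | (0 : Fin 3) => x (0 : Fin 2)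
      | (1 : Fin 3) => y (0 : Fin 2)
      | (2 : Fin 3) => y (1 : Fin 2)) (fun i => match i with
      | (0 : Fin 2) => fun _ => x (0 : Fin 2)
      | (1 : Fin 2) => y) (by
        rw [he₄]
        intro i j
        match i, j with
        | (0 : Fin 2), (0 : Fin 1) => exact HEq.rfl
        | (1 : Fin 2), (0 : Fin 2) => exact HEq.rfl
        | (1 : Fin 2), (1 : Fin 2) => exact HEq.rfl)
    have h₅ := P.Z_composite_of_heq e₅ (fun i => match i with
      | (0 : Fin 3) => x (0 : Fin 2)
      | (1 : Fin 3) => y (0 : Fin 2)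
      | (2 : Fin 3) => y (1 : Fin 2)) (fun i => match i with
      | (0 : Fin 2) => fun i => match i with
        | (0 : Fin 2) => x (0 : Fin 2)
        | (1 : Fin 2) => y (0 : Fin 2)
      | (1 : Fin 2) => fun _ => y (1 : Fin 2)) (by
        rw [he₅]
        intro i j
        match i, j with
        | (0 : Fin 2), (0 : Fin 2) => exact HEq.rfl
        | (0 : Fin 2), (1 : Fin 2) => exact HEq.rfl
        | (1 : Fin 2), (0 : Fin 1) => exact HEq.rfl)
    refine Submodule.subset_span ⟨P.Z (pairCap d hd (0 : Fin 2)) (fun i => match i with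
      | (0 : Fin 2) => x (0 : Fin 2)
      | (1 : Fin 2) => y (0 : Fin 2)), y (1 : Fin 2), Eq.trans (congrArg _ ?_) (h₄.symm.trans
        (h₅.trans (congrArg _ ?_)))⟩
    · funext i
      match i with
      | (0 : Fin 2) => exact (P.Z_identity _ _).symm
      | (1 : Fin 2) => exact hy.symm
    · funext i
      match i with
      | (0 : Fin 2) => rfl
      | (1 : Fin 2) => rfl
  · intro i
    match i with
    | (0 : Fin 2) => exact Submodule.subset_span trivial
    | (1 : Fin 2) => exact h.ge trivial

/-- This is the inductive step from `P_{d+1} = P_d E_{d+1} P_d` to `P_{d+2} = P_{d+1} E_{d+2}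
P_{d+1}`. -/
theorem valueSpan_stackSucc
    (h : P.valueSpan (stack d (d + 1) (d - 1) 2 (by omega) (by omega) two_pos) = ⊤) :
    P.valueSpan (stackSucc d) = ⊤ := by
  rw [eq_top_iff, ← P.span_stackSucc_cap d hd h]
  refine Submodule.span_mono ?_
  rintro _ ⟨x, y, rfl⟩
  exact ⟨_, rfl⟩

/-- In `u E_{d+2} (E_{d+1} y)` the factor `u ∈ P_{d+1}` is again expanded in products `w E_{d+1} x`,
while the second factor stays fixed. -/
theorem valueSpan_stack_three
    (h : P.valueSpan (stack d (d + 1) (d - 1) 2 (by omega) (by omega) two_pos) = ⊤) :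
    P.valueSpan (stack d (d + 2) (d - 1) 3 (by omega) (by omega) three_pos) = ⊤ := by
  rw [eq_top_iff, ← P.span_stackSucc_cap d hd h]
  refine Submodule.span_le.2 ?_
  rintro _ ⟨x, y, rfl⟩
  obtain ⟨e, he⟩ := exists_composite_stack_stack_cap d hd
  refine Submodule.span_le.2 ?_ (P.map_Z_mem_span (stackSucc d) (fun i => match i with
    | (0 : Fin 2) => Set.range (P.Z (stack d (d + 1) (d - 1) 2 (by omega) (by omega) two_pos))
    | (1 : Fin 2) => {P.Z (cap d (d - 1) hd (by omega)) fun _ => y}) _ ?_)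
  · rintro _ ⟨u, hu, rfl⟩
    obtain ⟨w, hw⟩ : u (0 : Fin 2) ∈
      Set.range (P.Z (stack d (d + 1) (d - 1) 2 (by omega) (by omega) two_pos)) :=
        hu (0 : Fin 2) trivial
    have hu₁ : u (1 : Fin 2) = P.Z (cap d (d - 1) hd (by omega)) fun _ => y := hu (1 : Fin 2) trivial
    have h₆ := P.Z_composite_of_heq e (fun i => match i with
      | (0 : Fin 3) => w (0 : Fin 2)
      | (1 : Fin 3) => w (1 : Fin 2)
      | (2 : Fin 3) => y) (fun i => match i with
      | (0 : Fin 2) => w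
      | (1 : Fin 2) => fun _ => y) (by
        rw [he]
        intro i j
        match i, j with
        | (0 : Fin 2), (0 : Fin 2) => exact HEq.rfl
        | (0 : Fin 2), (1 : Fin 2) => exact HEq.rfl
        | (1 : Fin 2), (0 : Fin 1) => exact HEq.rfl)
    refine Submodule.subset_span ⟨_, h₆.trans (congrArg _ ?_)⟩
    funext i
    match i with
    | (0 : Fin 2) => exact hw
    | (1 : Fin 2) => exact hu₁.symm
  · intro i
    match i with
    | (0 : Fin 2) => exact h.ge trivial
    | (1 : Fin 2) => exact Submodule.subset_span rfl

end Depth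

theorem valueSpan_stack_of_le {d k : ℕ} (h : d ≤ k) (hd : 1 ≤ d)
    (h₀ : P.valueSpan (stack d (d + 1) (d - 1) 2 (by omega) (by omega) two_pos) = ⊤) :
    P.valueSpan (stack k (k + 1) (k - 1) 2 (by omega) (by omega) two_pos) = ⊤ := by
  induction h with
  | refl => exact h₀
  | step h ih => exact P.valueSpan_stackSucc _ (hd.trans h) (ih h₀)

/-- The infimum of a nonempty set of natural numbers is attained, so the depth itself starts the
induction. -/
theorem valueSpan_stack_of_depth_le (hfin : P.FiniteDepth) {k : ℕ} (hk : 1 ≤ k)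
    (h : P.depth ≤ k) :
    P.valueSpan (stack k (k + 1) (k - 1) 2 (by omega) (by omega) two_pos) = ⊤ :=
  have ⟨hd, h₀⟩ := Nat.sInf_mem hfin
  P.valueSpan_stack_of_le h hd (P.valueSpan_stack_of_depthSpan _ hd h₀)

/-- All boxes have colour `k`, so each argument is a combination of basis vectors and multilinearity
applies. -/
theorem range_eq_valueSpan {k : ℕ} {ι : Type v}
    (b : Module.Basis ι ℂ (P.space (Col.ofNat k))) {c : Col} (T : Tangle c)
    (hT : ∀ i, T.col i = Col.ofNat k) :
    P.range (Set.range fun i => (⟨Col.ofNat k, b i⟩ : Σ c, P.space c)) T = P.valueSpan T := by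
  refine le_antisymm (Submodule.span_mono ?_) (Submodule.span_le.2 ?_)
  · rintro _ ⟨x, -, rfl⟩
    exact ⟨x, rfl⟩
  · rintro _ ⟨x, rfl⟩
    refine Submodule.span_mono ?_ (P.map_Z_mem_span T (fun i =>
      {y | (⟨T.col i, y⟩ : Σ c, P.space c) ∈
        Set.range fun i => (⟨Col.ofNat k, b i⟩ : Σ c, P.space c)}) x fun i => ?_)
    · rintro _ ⟨x, hx, rfl⟩
      exact ⟨x, fun i => hx i trivial, rfl⟩
    -- Once the argument is a variable, the colour of the box can be rewritten to `k`, and the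
    -- admissible labels then contain the basis vectors.
    · generalize x i = y
      revert y
      rw [hT i]
      intro y
      refine Submodule.span_mono ?_ (b.span_eq.ge (Submodule.mem_top (x := y)))
      rintro _ ⟨j, rfl⟩
      exact ⟨j, rfl⟩

theorem valueSpan_identity (c : Col) : P.valueSpan (identity c) = ⊤ :=
  eq_top_iff.2 fun x _ => Submodule.subset_span ⟨fun _ => x, P.Z_identity c x⟩

end PlanarAlgebra

/-- The number of boxes in `T` is the expression `n - k + 1`; this replaces it by a numeral such as
`2` or `3`, which equals it only propositionally. -/
theorem Tangle.valueSpan_T (P : PlanarAlgebra.{u}) (k n b : ℕ) (hk : 1 ≤ k) (hkn : k ≤ n)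
    (h : n - k + 1 = b) :
    P.valueSpan (T k n hk hkn) =
      P.valueSpan (stack k n (k - 1) b (by omega) (by omega) (by omega)) := by
  subst h
  rfl

namespace SubfactorPlanarAlgebra

/-- A loop multiplies every value by `δ`, and `δ` is invertible. -/
theorem range_circle (P : SubfactorPlanarAlgebra.{u}) (B : Set (Σ c, P.space c)) (s : Bool) :
    P.range B (circle s) = P.range B (Tangle.unit (Col.zero s)) := by
  have hδ : (P.δ : ℂ) ≠ 0 := Complex.ofReal_ne_zero.2 P.δ_pos.ne'
  refine le_antisymm (Submodule.span_le.2 ?_) (Submodule.span_le.2 ?_)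
  · rintro _ ⟨x, hx, rfl⟩
    have : P.Z (circle s) x = (P.δ : ℂ) • P.Z (Tangle.unit (Col.zero s)) x :=
      P.modulus (Tangle.unit (Col.zero s)) _ x
    rw [this]
    exact Submodule.smul_mem _ _ (Submodule.subset_span ⟨x, hx, rfl⟩)
  · rintro _ ⟨x, hx, rfl⟩
    have : P.Z (circle s) x = (P.δ : ℂ) • P.Z (Tangle.unit (Col.zero s)) x :=
      P.modulus (Tangle.unit (Col.zero s)) _ x
    refine (Submodule.smul_mem_iff _ hδ).1 ?_
    rw [← this]
    exact Submodule.subset_span ⟨x, hx, rfl⟩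

end SubfactorPlanarAlgebra

end PlanarAlg

theorem proposition4p1 (P : PlanarAlg.SubfactorPlanarAlgebra.{u}) (k : ℕ) (hk : 1 ≤ k)
    (hfin : P.FiniteDepth) (hdepth : P.depth ≤ k)
    {ι : Type v} (b : Module.Basis ι ℂ (P.space (PlanarAlg.Col.ofNat k)))
    {c : PlanarAlg.Col} (S T : PlanarAlg.Tangle c) (hST : PlanarAlg.BasicTemplate k hk S T) :
    P.TemplateHolds
      (Set.range fun i => (⟨PlanarAlg.Col.ofNat k, b i⟩ : Σ c, P.space c)) S T := by
  have h₂ := P.valueSpan_stack_of_depth_le hfin hk hdepth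
  have h_id : P.range (Set.range fun i => (⟨PlanarAlg.Col.ofNat k, b i⟩ : Σ c, P.space c))
      (PlanarAlg.Tangle.identity (PlanarAlg.Col.ofNat k)) = ⊤ :=
    (P.range_eq_valueSpan b _ fun _ => rfl).trans (P.valueSpan_identity _)
  have h_T₂ : P.range (Set.range fun i => (⟨PlanarAlg.Col.ofNat k, b i⟩ : Σ c, P.space c))
      (PlanarAlg.Tangle.T k (k + 1) hk k.le_succ) = ⊤ :=
    (P.range_eq_valueSpan b _ fun _ => rfl).trans
      ((PlanarAlg.Tangle.valueSpan_T _ k (k + 1) 2 hk k.le_succ (by omega)).trans h₂)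
  have h_T₃ : P.range (Set.range fun i => (⟨PlanarAlg.Col.ofNat k, b i⟩ : Σ c, P.space c))
      (PlanarAlg.Tangle.T k (k + 2) hk (k.le_add_right 2)) = ⊤ :=
    (P.range_eq_valueSpan b _ fun _ => rfl).trans
      ((PlanarAlg.Tangle.valueSpan_T _ k (k + 2) 3 hk (k.le_add_right 2) (by omega)).trans
        (P.valueSpan_stack_three k hk h₂))
  -- Outside the modulus templates the right-hand range is the whole space, so nothing about the
  -- left-hand tangle enters.
  cases hST with
  | modulus s => exact (P.range_circle _ s).le
  | modulus' s => exact (P.range_circle _ s).ge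
  | unit => exact le_top.trans h_id.ge
  | inclusion => exact le_top.trans h_T₂.ge
  | jones n hn hnk _ _ => exact le_top.trans h_id.ge
  | multiplication => exact le_top.trans h_id.ge
  | expectation _ _ => exact le_top.trans h_id.ge
  | depth => exact le_top.trans h_T₂.ge
  | shift => exact le_top.trans h_T₃.ge
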